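/- Let $M$ be a compact connected smooth Riemannian manifold without boundary, let $m\ge 1$, and let $H_1,\dots,H_m:T^*M\to\mathbb R$ be continuous functions such that each $p\mapsto H_i(x,p)$ is convex on $T_x^*M$, and such that $\alpha(|p|)\le H_i(x,p)\le\beta(|p|)$ for all $i$ and all $(x,p)\in T^*M$, where $\alpha,\beta:[0,\infty)\to\mathbb R$ tend to $+\infty$ at $+\infty$. Let $B=(b_{ij})$ be a real $m\times m$ matrix with $b_{ij}\le 0$ for $i\ne j$ and $\sum_j b_{ij}=0$ for every $i$, which is irreducible: for every nonempty $I\subsetneq\{1,\dots,m\}$ there are $i\in I$ and $j\notin I$ with $b_{ij}\neq 0$. For $\lambda\ge 0$ and $c\in\mathbb R$ consider the system $$(B+\lambda\,\mathrm{Id})\mathbf u+\mathbb H(x,D\mathbf u)=c\,\mathbb 1\quad\text{in } M,\qquad \mathbb H(x,D\mathbf u)=(H_1(x,Du_1),\dots,H_m(x,Du_m))^T .\tag{$S_{\lambda,c}$}$$ A continuous $\mathbf u=(u_1,\dots,u_m):M\to\mathbb R^m$ is a (viscosity) subsolution of $(S_{\lambda,c})$ if $H_i(x,p)+((B+\lambda\,\mathrm{Id})\mathbf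 u(x))_i\le c$ for all $x\in M$, all $i$ and all $p$ in the superdifferential $D^+u_i(x)$; a supersolution if the reverse inequality holds for all $p$ in the subdifferential $D^-u_i(x)$; and a solution if it is both. Let $L_i(x,v)=\sup_{p\in T^*_xM}\{p(v)-H_i(x,p)\}\in(-\infty,+\infty]$ for $(x,v)\in TM$. A Borel probability measure $\mu$ on $TM\times\{1,\dots,m\}$ is closed if $\int|v|\,d\mu(x,v,i)<+\infty$ and $\int \big[(B\boldsymbol\phi(x))_i+D\phi_i(x)(v)\big]\,d\mu(x,v,i)=0$ for every $\boldsymbol\phi\in C^1(M)^m$; it is a Mather measure if it minimizes $\int L_i(x,v)\,d\mu(x,v,i)$ among the closed probability measures. Then there is a unique $c=c(\mathbb H)\in\mathbb R$ for which $(S_{0,c})$ has a solution; for every $\lambda>0$ the system $(S_{\lambda,c(\mathbb H)})$ has a unique solution $\mathbf u^\lambda$; and, as $\lambda\to0^+$, the functions $\mathbf u^\lambda$ converge uniformly on $M$ to a single solution $\mathbf u^0$ of the critical system $(S_{0,c(\mathbb H)})$. Moreover, for every $x\in M$ and $i\in\{1,\dots,m\}$, $$u^0_i(x)=\sup_{\mathbf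 w\in\mathcal F} w_i(x),$$ where $\mathcal F$ is the set of all subsolutions $\mathbf w$ of the critical system $(S_{0,c(\mathbb H)})$ such that $\int w_i(x)\,d\mu(x,v,i)\le 0$ for every Mather measure $\mu$. -/

import Mathlib

open scoped Manifold ContDiff Topology Bundle Matrix
open Set Filter MeasureTheory

noncomputable section

namespace WeaklyCoupled

section Definitions

variable {E : Type*} [NormedAddCommGroup E] [NormedSpace ℝ E]
  {M : Type*} [TopologicalSpace M] [ChartedSpace E M] {m : ℕ}

/-- The coupling matrices: nonpositive off-diagonal entries, vanishing row sums, irreducible. -/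
structure IsCouplingMatrix (B : Matrix (Fin m) (Fin m) ℝ) : Prop where
  offDiag_nonpos : ∀ i j, i ≠ j → B i j ≤ 0
  row_sum : ∀ i, ∑ j, B i j = 0
  irreducible : ∀ S : Set (Fin m), S.Nonempty → S ≠ univ → ∃ i ∈ S, ∃ j ∉ S, B i j ≠ 0

variable (E M) in
/-- The cotangent space `T_x^* M`. -/
abbrev Cotangent (x : M) : Type _ := TangentSpace 𝓘(ℝ, E) x →L[ℝ] ℝ

variable (E M) in
/-- The cotangent bundle `T^* M`, with the topology of the bundle of continuous linear maps from
the tangent bundle to the trivial line bundle. -/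
abbrev CotangentBundle : Type _ :=
  Bundle.TotalSpace (E →L[ℝ] ℝ)
    (fun x : M => TangentSpace 𝓘(ℝ, E) x →L[ℝ] Bundle.Trivial M ℝ x)

variable (E M m) in
/-- An `m`-tuple of functions `H_i (x, p)` with `x ∈ M` and `p ∈ T_x^* M`. -/
abbrev Hamiltonian : Type _ := Fin m → (x : M) → Cotangent E M x → ℝ

/-- Each `H_i` is continuous on the cotangent bundle. -/
def IsContinuousHamiltonian [IsManifold 𝓘(ℝ, E) 1 M] (H : Hamiltonian E M m) : Prop :=
  ∀ i, Continuous fun z : CotangentBundle E M => H i z.1 z.2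

/-- Each `H_i (x, ·)` is convex. -/
def IsConvexHamiltonian (H : Hamiltonian E M m) : Prop :=
  ∀ i x, ConvexOn ℝ univ (H i x)

/-- Coercivity: `α (|p|) ≤ H_i (x, p) ≤ β (|p|)` for two functions `α, β` that tend to `+∞` at
`+∞`; here `|p|` is the norm dual to the Riemannian norm. -/
def IsCoerciveHamiltonian [Bundle.RiemannianBundle (fun x : M => TangentSpace 𝓘(ℝ, E) x)]
    (H : Hamiltonian E M m) : Prop :=
  ∃ α β : ℝ → ℝ, Tendsto α atTop atTop ∧ Tendsto β atTop atTop ∧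
    ∀ i x (p : Cotangent E M x), α ‖p‖ ≤ H i x p ∧ H i x p ≤ β ‖p‖

variable (E) in
/-- The superdifferential `D⁺ f (x)`: differentials at `x` of `C¹` functions `φ` such that
`f - φ` has a local maximum at `x`. -/
def superdifferential (f : M → ℝ) (x : M) : Set (Cotangent E M x) :=
  {p | ∃ φ : M → ℝ, ContMDiffAt 𝓘(ℝ, E) 𝓘(ℝ, ℝ) 1 φ x ∧
    IsLocalMax (fun y => f y - φ y) x ∧ mvfderiv 𝓘(ℝ, E) φ x = p}

variable (E) in
/-- The subdifferential `D⁻ f (x)`: differentials at `x` of `C¹` functions `φ` such that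
`f - φ` has a local minimum at `x`. -/
def subdifferential (f : M → ℝ) (x : M) : Set (Cotangent E M x) :=
  {p | ∃ φ : M → ℝ, ContMDiffAt 𝓘(ℝ, E) 𝓘(ℝ, ℝ) 1 φ x ∧
    IsLocalMin (fun y => f y - φ y) x ∧ mvfderiv 𝓘(ℝ, E) φ x = p}

/-- Viscosity subsolutions of `(B + lam Id) u + H (x, Du) = c 𝟙`. -/
def IsSubsolution (B : Matrix (Fin m) (Fin m) ℝ) (lam : ℝ) (H : Hamiltonian E M m) (c : ℝ)
    (u : C(M, Fin m → ℝ)) : Prop :=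
  ∀ x i, ∀ p ∈ superdifferential E (fun y => u y i) x,
    H i x p + ((B + lam • (1 : Matrix (Fin m) (Fin m) ℝ)) *ᵥ u x) i ≤ c

/-- Viscosity supersolutions of `(B + lam Id) u + H (x, Du) = c 𝟙`. -/
def IsSupersolution (B : Matrix (Fin m) (Fin m) ℝ) (lam : ℝ) (H : Hamiltonian E M m) (c : ℝ)
    (u : C(M, Fin m → ℝ)) : Prop :=
  ∀ x i, ∀ p ∈ subdifferential E (fun y => u y i) x,
    c ≤ H i x p + ((B + lam • (1 : Matrix (Fin m) (Fin m) ℝ)) *ᵥ u x) i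

/-- Viscosity solutions of `(B + lam Id) u + H (x, Du) = c 𝟙`. -/
def IsSolution (B : Matrix (Fin m) (Fin m) ℝ) (lam : ℝ) (H : Hamiltonian E M m) (c : ℝ)
    (u : C(M, Fin m → ℝ)) : Prop :=
  IsSubsolution B lam H c u ∧ IsSupersolution B lam H c u

/-- `c` is the critical value: the unique real number for which `B u + H (x, Du) = c 𝟙` has a
solution. -/
def IsCriticalValue (B : Matrix (Fin m) (Fin m) ℝ) (H : Hamiltonian E M m) (c : ℝ) : Prop :=
  (∃ u, IsSolution B 0 H c u) ∧ ∀ c', (∃ u, IsSolution B 0 H c' u) → c' = c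

/-- The Lagrangian `L_i (x, v) = sup_p (⟨p, v⟩ - H_i (x, p))`, with values in `(-∞, +∞]`. -/
def lagrangian (H : Hamiltonian E M m) (i : Fin m) (x : M) (v : TangentSpace 𝓘(ℝ, E) x) :
    EReal :=
  ⨆ p : Cotangent E M x, ((p v - H i x p : ℝ) : EReal)

/-- The integral of an extended-real-valued function, as the integral of its positive part minus
the integral of its negative part. -/
def extIntegral {α : Type*} [MeasurableSpace α] (μ : Measure α) (f : α → EReal) : EReal :=
  ((∫⁻ z, (f z).toENNReal ∂μ : ENNReal) : EReal) - ((∫⁻ z, (-f z).toENNReal ∂μ : ENNReal) : EReal)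

variable [IsManifold 𝓘(ℝ, E) 1 M]

/-- The tangent bundle carries its Borel `σ`-algebra. -/
instance tangentBundleMeasurableSpace : MeasurableSpace (TangentBundle 𝓘(ℝ, E) M) := borel _

instance tangentBundleBorelSpace : BorelSpace (TangentBundle 𝓘(ℝ, E) M) := ⟨rfl⟩

/-- Closed probability measures on `TM × {1, …, m}`. -/
structure IsClosedMeasure [Bundle.RiemannianBundle (fun x : M => TangentSpace 𝓘(ℝ, E) x)]
    (B : Matrix (Fin m) (Fin m) ℝ) (μ : Measure (TangentBundle 𝓘(ℝ, E) M × Fin m)) : Prop where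
  isProbabilityMeasure : IsProbabilityMeasure μ
  lintegral_norm_lt_top : ∫⁻ z, ENNReal.ofReal ‖z.1.2‖ ∂μ < ⊤
  integral_eq_zero : ∀ φ : Fin m → M → ℝ, (∀ j, ContMDiff 𝓘(ℝ, E) 𝓘(ℝ, ℝ) 1 (φ j)) →
    ∫ z, ((B *ᵥ fun j => φ j z.1.1) z.2 + mvfderiv 𝓘(ℝ, E) (φ z.2) z.1.1 z.1.2) ∂μ = 0

/-- Mather measures: the closed probability measures that minimize `∫ L_i (x, v) dμ (x, v, i)`
among all closed probability measures. -/
def IsMatherMeasure [Bundle.RiemannianBundle (fun x : M => TangentSpace 𝓘(ℝ, E) x)]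
    (B : Matrix (Fin m) (Fin m) ℝ) (H : Hamiltonian E M m)
    (μ : Measure (TangentBundle 𝓘(ℝ, E) M × Fin m)) : Prop :=
  IsClosedMeasure B μ ∧ ∀ ν : Measure (TangentBundle 𝓘(ℝ, E) M × Fin m), IsClosedMeasure B ν →
    extIntegral μ (fun z => lagrangian H z.2 z.1.1 z.1.2) ≤
      extIntegral ν (fun z => lagrangian H z.2 z.1.1 z.1.2)

/-- The critical subsolutions `w` with `∫ w_i (x) dμ (x, v, i) ≤ 0` for every Mather measure. -/
def constrainedSubsolutions [Bundle.RiemannianBundle (fun x : M => TangentSpace 𝓘(ℝ, E) x)]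
    (B : Matrix (Fin m) (Fin m) ℝ) (H : Hamiltonian E M m) (c : ℝ) : Set C(M, Fin m → ℝ) :=
  {w | IsSubsolution B 0 H c w ∧
    ∀ μ : Measure (TangentBundle 𝓘(ℝ, E) M × Fin m), IsMatherMeasure B H μ →
      ∫ z, w z.1.1 z.2 ∂μ ≤ 0}

end Definitions

end WeaklyCoupled

end

/-!
Every subsolution is Lipschitz, because coercivity bounds its superdifferentials, and convexity of
the Hamiltonians allows it to be approximated uniformly by `C¹` functions that are subsolutions up
to a small error (`IsSubsolution.exists_regularization`). This replaces the doubling of variables: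
at a maximum point of the difference between the regularized subsolution and a supersolution, the
former is a test function for the latter, and the sign conditions on `B` make the coupling terms
harmless (`IsCouplingMatrix.mulVec_nonneg_of_max`). Comparison, hence uniqueness for `lam > 0` and
uniqueness of the critical value, follow (`IsSubsolution.comparison`). Discounted solutions come
from Perron's method (`exists_isSolution`). Irreducibility of `B` bounds the differences between the
components of a subsolution (`IsCouplingMatrix.exists_abs_sub_le`), so the normalized discounted
solutions are relatively compact and yield a critical solution (`exists_isSolution_critical`);
comparison with it bounds the solutions `u_lam` at the critical level, which are therefore
relatively compact too (`exists_solution_bound`, `isCompact_closure_subsolutions`).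

It remains to identify all limits of `u_lam` as `lam → 0`. A limit `u₀` is a critical solution. Since
an approximate subsolution `φ` satisfies `(B φ)_i + lam φ_i + Dφ_i (v) - c ≤ L_i (x, v)` up to a small
error, integration against a closed measure gives `lam ∫ u_lam - c ≤ ∫ L`, and for `lam = 0` the
action of a closed measure is at least `-c` (`IsClosedMeasure.le_extIntegral`). If the minimal action
is exactly `-c`, Mather measures satisfy `∫ u_lam ≤ 0`, so that `u₀` obeys the constraint.

Conversely let `w` be a critical subsolution, and fix `x` and `i`. There is a closed measure `μ` with
`∫ L dμ ≤ -c`, which is thus a Mather measure, and `∫ w dμ ≥ w_i (x) - (u₀)_i (x)`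
(`exists_isClosedMeasure_of_tendsto`); when `w` obeys the constraint, this forces
`w_i (x) ≤ (u₀)_i (x)`. The measure is obtained by duality: by the Hahn–Banach and Riesz theorems it
exists unless the linear conditions that it has to fulfil contradict each other
(`exists_functional_of_consistent`). That they do not is an inequality between the multipliers
`s, t, r, φ` of these conditions, which results from the comparison of `u_lam` with the perturbation
`(1 - θ t) w - θ φ` of `w`, where `θ = lam / r`, after division by `lam` in the limit `lam → 0`
(`IsSolution.perturbation_le`). So every limit of `u_lam` is the greatest element of the set of
constrained subsolutions (`isGreatest_of_tendsto`); it is unique, and the whole family converges.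
-/

noncomputable section

namespace WeaklyCoupled

set_option linter.unusedSectionVars false

/-! ### Charts and differentials -/

section Charts

variable {E : Type*} [NormedAddCommGroup E] [NormedSpace ℝ E] [FiniteDimensional ℝ E]
  {M : Type*} [TopologicalSpace M] [ChartedSpace E M] [IsManifold 𝓘(ℝ, E) ∞ M]

variable (E) in
/-- The Euclidean space of the same dimension as `E`, in which local computations take place. -/
abbrev Model : Type := EuclideanSpace ℝ (Fin (Module.finrank ℝ E))

variable (E) in
/-- The preferred chart at `x₀`, followed by a linear isomorphism onto a Euclidean space. -/
def euclChart (x₀ : M) (y : M) : Model E := toEuclidean (extChartAt 𝓘(ℝ, E) x₀ y)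

variable (E) in
/-- The inverse of `euclChart E x₀`. -/
def euclParam (x₀ : M) (z : Model E) : M := (extChartAt 𝓘(ℝ, E) x₀).symm (toEuclidean.symm z)

variable (E) in
/-- The derivative at `y` of `euclChart E x₀`. -/
def euclDeriv (x₀ y : M) : TangentSpace 𝓘(ℝ, E) y →L[ℝ] Model E :=
  (toEuclidean : E ≃L[ℝ] Model E).toContinuousLinearMap ∘L
    ((trivializationAt E (TangentSpace 𝓘(ℝ, E)) x₀).continuousLinearMapAt ℝ y)

variable (E) in
/-- The domain of the inverse chart `euclParam E x₀`. -/
def euclTarget (x₀ : M) : Set (Model E) :=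
  toEuclidean.symm ⁻¹' (extChartAt 𝓘(ℝ, E) x₀).target

lemma isOpen_euclTarget (x₀ : M) : IsOpen (euclTarget E x₀) :=
  (isOpen_extChartAt_target x₀).preimage (toEuclidean (E := E)).symm.continuous

lemma euclChart_self_mem (x₀ : M) : euclChart E x₀ x₀ ∈ euclTarget E x₀ := by
  simp [euclTarget, euclChart]

lemma euclParam_mem_source {x₀ : M} {z : Model E} (hz : z ∈ euclTarget E x₀) :
    euclParam E x₀ z ∈ (chartAt E x₀).source := by
  have := (extChartAt 𝓘(ℝ, E) x₀).map_target hz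
  rwa [extChartAt_source] at this

lemma euclChart_param {x₀ : M} {z : Model E} (hz : z ∈ euclTarget E x₀) :
    euclChart E x₀ (euclParam E x₀ z) = z := by
  rw [euclChart, euclParam, (extChartAt 𝓘(ℝ, E) x₀).right_inv hz]; simp

lemma euclParam_chart {x₀ y : M} (hy : y ∈ (chartAt E x₀).source) :
    euclParam E x₀ (euclChart E x₀ y) = y := by
  rw [← extChartAt_source 𝓘(ℝ, E)] at hy
  rw [euclChart, euclParam, ContinuousLinearEquiv.symm_apply_apply,
    (extChartAt 𝓘(ℝ, E) x₀).left_inv hy]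

lemma euclChart_mem_target {x₀ y : M} (hy : y ∈ (chartAt E x₀).source) :
    euclChart E x₀ y ∈ euclTarget E x₀ := by
  rw [← extChartAt_source 𝓘(ℝ, E)] at hy
  simpa [euclTarget, euclChart] using (extChartAt 𝓘(ℝ, E) x₀).map_source hy

lemma continuousOn_euclParam (x₀ : M) : ContinuousOn (euclParam E x₀) (euclTarget E x₀) :=
  (continuousOn_extChartAt_symm (I := 𝓘(ℝ, E)) x₀).comp
    (toEuclidean (E := E)).symm.continuous.continuousOn (fun _ h => h)

lemma continuousOn_euclChart (x₀ : M) : ContinuousOn (euclChart E x₀) (chartAt E x₀).source := by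
  have := continuousOn_extChartAt (I := 𝓘(ℝ, E)) x₀
  rw [extChartAt_source] at this
  exact (toEuclidean (E := E)).continuous.comp_continuousOn this

lemma contMDiffAt_euclChart {x₀ y : M} (hy : y ∈ (chartAt E x₀).source) :
    ContMDiffAt 𝓘(ℝ, E) 𝓘(ℝ, Model E) ∞ (euclChart E x₀) y :=
  (toEuclidean (E := E)).contDiff.contMDiff.contMDiffAt.comp y (contMDiffAt_extChartAt' hy)

lemma mfderiv_euclChart {x₀ y : M} (hy : y ∈ (chartAt E x₀).source) :
    mfderiv 𝓘(ℝ, E) 𝓘(ℝ, Model E) (euclChart E x₀) y = euclDeriv E x₀ y := by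
  have h1 : MDifferentiableAt 𝓘(ℝ, E) 𝓘(ℝ, E) (extChartAt 𝓘(ℝ, E) x₀) y :=
    mdifferentiableAt_extChartAt hy
  have h2 : MDifferentiableAt 𝓘(ℝ, E) 𝓘(ℝ, Model E) (toEuclidean : E ≃L[ℝ] Model E)
      (extChartAt 𝓘(ℝ, E) x₀ y) :=
    (toEuclidean (E := E)).differentiableAt.mdifferentiableAt
  have := mfderiv_comp y h2 h1
  rw [mfderiv_eq_fderiv, ContinuousLinearEquiv.fderiv] at this
  rw [euclDeriv, TangentBundle.continuousLinearMapAt_trivializationAt hy]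
  exact this

/-- Chain rule for a function expressed in a chart. -/
lemma mvfderiv_comp_euclChart {x₀ y : M} (hy : y ∈ (chartAt E x₀).source) {ψ : Model E → ℝ}
    (hψ : DifferentiableAt ℝ ψ (euclChart E x₀ y)) :
    mvfderiv 𝓘(ℝ, E) (fun y => ψ (euclChart E x₀ y)) y =
      (fderiv ℝ ψ (euclChart E x₀ y)) ∘L euclDeriv E x₀ y := by
  have h := mvfderiv_comp y hψ.mdifferentiableAt
    ((contMDiffAt_euclChart hy).mdifferentiableAt (by simp))
  rw [mfderiv_euclChart hy] at h
  refine Eq.trans h ?_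
  ext v
  simp [mvfderiv, mfderiv_eq_fderiv]
  rfl

lemma contMDiffAt_comp_euclChart {x₀ y : M} (hy : y ∈ (chartAt E x₀).source) {ψ : Model E → ℝ}
    (hψ : ContDiffAt ℝ 1 ψ (euclChart E x₀ y)) :
    ContMDiffAt 𝓘(ℝ, E) 𝓘(ℝ, ℝ) 1 (fun y => ψ (euclChart E x₀ y)) y :=
  hψ.contMDiffAt.comp y ((contMDiffAt_euclChart hy).of_le (by simp))

/-- In a chart the cotangent bundle is a product. -/
lemma continuousOn_cotangent_euclDeriv (x₀ : M) :
    ContinuousOn (fun a : M × (Model E →L[ℝ] ℝ) =>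
      (⟨a.1, a.2 ∘L euclDeriv E x₀ a.1⟩ : CotangentBundle E M))
      ((chartAt E x₀).source ×ˢ univ) := by
  have h := (trivializationAt (E →L[ℝ] ℝ)
    (fun x : M => TangentSpace 𝓘(ℝ, E) x →L[ℝ] Bundle.Trivial M ℝ x) x₀).continuousOn_invFun
  have h2 : Continuous (fun a : M × (Model E →L[ℝ] ℝ) =>
      ((a.1, a.2 ∘L (toEuclidean : E ≃L[ℝ] Model E).toContinuousLinearMap) :
        M × (E →L[ℝ] ℝ))) :=
    continuous_fst.prodMk (((ContinuousLinearMap.compL ℝ E (Model E) ℝ).flip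
      (toEuclidean : E ≃L[ℝ] Model E).toContinuousLinearMap).continuous.comp continuous_snd)
  refine (h.comp h2.continuousOn ?_).congr ?_
  · rintro ⟨y, q⟩ hy
    refine ⟨⟨?_, mem_univ _⟩, mem_univ _⟩
    simpa using hy.1
  · rintro ⟨y, q⟩ hy
    have key : ((trivializationAt (E →L[ℝ] ℝ) (fun x : M => TangentSpace 𝓘(ℝ, E) x →L[ℝ]
        Bundle.Trivial M ℝ x) x₀).invFun
        (y, q ∘L (toEuclidean : E ≃L[ℝ] Model E).toContinuousLinearMap) : CotangentBundle E M) =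
        ⟨y, ((trivializationAt ℝ (Bundle.Trivial M ℝ) x₀).symmL ℝ y) ∘L
          ((q ∘L (toEuclidean : E ≃L[ℝ] Model E).toContinuousLinearMap) ∘L
          ((trivializationAt E (TangentSpace 𝓘(ℝ, E)) x₀).continuousLinearMapAt ℝ y))⟩ := rfl
    refine Eq.trans ?_ key.symm
    refine congrArg (Bundle.TotalSpace.mk y) (ContinuousLinearMap.ext fun v => ?_)
    exact (DFunLike.congr_fun (Bundle.Trivial.symmL_trivialization ℝ M ℝ y)
      (q (euclDeriv E x₀ y v))).symm

lemma mvfderiv_congr {x : M} {φ ψ : M → ℝ} (h : φ =ᶠ[𝓝 x] ψ) :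
    mvfderiv 𝓘(ℝ, E) φ x = mvfderiv 𝓘(ℝ, E) ψ x := by
  have := h.mfderiv_eq (I := 𝓘(ℝ, E)) (I' := 𝓘(ℝ, ℝ))
  ext v
  simp only [mvfderiv]
  rw [this]
  rfl

/-- A covector field `y ↦ dψ(y)` read in a chart. -/
lemma mvfderiv_eq_fderiv_comp {x₀ y : M} (hy : y ∈ (chartAt E x₀).source) {ψ : M → ℝ}
    (hψ : ContMDiffAt 𝓘(ℝ, E) 𝓘(ℝ, ℝ) 1 ψ y) :
    ContDiffAt ℝ 1 (ψ ∘ euclParam E x₀) (euclChart E x₀ y) ∧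
    mvfderiv 𝓘(ℝ, E) ψ y =
      (fderiv ℝ (ψ ∘ euclParam E x₀) (euclChart E x₀ y)) ∘L euclDeriv E x₀ y := by
  have hz := euclChart_mem_target hy
  have h1 : ContMDiffAt 𝓘(ℝ, Model E) 𝓘(ℝ, E) 1 (euclParam E x₀) (euclChart E x₀ y) := by
    have h2 : ContMDiffAt 𝓘(ℝ, E) 𝓘(ℝ, E) 1 (extChartAt 𝓘(ℝ, E) x₀).symm
        ((toEuclidean (E := E)).symm (euclChart E x₀ y)) :=
      (contMDiffOn_extChartAt_symm x₀).contMDiffAt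
        ((isOpen_extChartAt_target x₀).mem_nhds hz)
    exact h2.comp _ (toEuclidean (E := E)).symm.contDiff.contMDiff.contMDiffAt
  have h3 : ContDiffAt ℝ 1 (ψ ∘ euclParam E x₀) (euclChart E x₀ y) := by
    rw [← contMDiffAt_iff_contDiffAt]
    refine ContMDiffAt.comp _ ?_ h1
    rwa [euclParam_chart hy]
  refine ⟨h3, ?_⟩
  rw [← mvfderiv_comp_euclChart hy (h3.differentiableAt (by simp))]
  refine mvfderiv_congr ?_
  filter_upwards [(chartAt E x₀).open_source.mem_nhds hy] with a ha
  simp [euclParam_chart ha]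

/-- The differential of a `C¹` function is a continuous covector field. -/
lemma continuousAt_cotangent_mvfderiv {x : M} {ψ : M → ℝ}
    (hψ : ContMDiffAt 𝓘(ℝ, E) 𝓘(ℝ, ℝ) 1 ψ x) :
    ContinuousAt (fun y => (⟨y, mvfderiv 𝓘(ℝ, E) ψ y⟩ : CotangentBundle E M)) x := by
  have hx : x ∈ (chartAt E x).source := mem_chart_source E x
  have h1 := (mvfderiv_eq_fderiv_comp hx hψ).1
  have h2 : ContinuousAt (euclChart E x) x :=
    (continuousOn_euclChart x).continuousAt ((chartAt E x).open_source.mem_nhds hx)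
  have h3 : ContinuousAt (fun y => (y, fderiv ℝ (ψ ∘ euclParam E x) (euclChart E x y))) x :=
    continuousAt_id.prodMk
      (ContinuousAt.comp (f := euclChart E x) (h1.continuousAt_fderiv (by simp)) h2)
  have h4 : ContinuousAt (fun a : M × (Model E →L[ℝ] ℝ) =>
      (⟨a.1, a.2 ∘L euclDeriv E x a.1⟩ : CotangentBundle E M))
      (x, fderiv ℝ (ψ ∘ euclParam E x) (euclChart E x x)) :=
    (continuousOn_cotangent_euclDeriv x).continuousAt
      (((chartAt E x).open_source.prod isOpen_univ).mem_nhds ⟨hx, mem_univ _⟩)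
  refine (ContinuousAt.comp (f := fun y => (y, fderiv ℝ (ψ ∘ euclParam E x) (euclChart E x y)))
    h4 h3).congr ?_
  filter_upwards [(chartAt E x).open_source.mem_nhds hx, (contMDiffAt_iff_contMDiffAt_nhds (by simp)).1 hψ] with y hy hψy
  simp [(mvfderiv_eq_fderiv_comp hy hψy).2]

/-- The derivative of a chart is a linear isomorphism. -/
lemma exists_euclDeriv_inverse {x₀ y : M} (hy : y ∈ (chartAt E x₀).source) :
    ∃ e : TangentSpace 𝓘(ℝ, E) y ≃L[ℝ] Model E,
      (e : TangentSpace 𝓘(ℝ, E) y →L[ℝ] Model E) = euclDeriv E x₀ y ∧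
      (e.symm : Model E →L[ℝ] TangentSpace 𝓘(ℝ, E) y) =
        ((trivializationAt E (TangentSpace 𝓘(ℝ, E)) x₀).symmL ℝ y) ∘L
          (toEuclidean : E ≃L[ℝ] Model E).symm.toContinuousLinearMap := by
  have hb : y ∈ (trivializationAt E (TangentSpace 𝓘(ℝ, E)) x₀).baseSet := by simpa using hy
  refine ⟨((trivializationAt E (TangentSpace 𝓘(ℝ, E)) x₀).continuousLinearEquivAt ℝ y hb).trans
    toEuclidean, ?_, ?_⟩
  · ext v
    simp [euclDeriv, Bundle.Trivialization.continuousLinearMapAt_apply, hy,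
      Bundle.Trivialization.linearMapAt_apply]
  · ext v
    exact (Bundle.Trivialization.symmL_apply _ hb _).symm

lemma mvfderiv_eq_zero_of_isLocalExtr {x : M} {ψ : M → ℝ}
    (hψ : ContMDiffAt 𝓘(ℝ, E) 𝓘(ℝ, ℝ) 1 ψ x) (h : IsLocalExtr ψ x) :
    mvfderiv 𝓘(ℝ, E) ψ x = 0 := by
  have hx : x ∈ (chartAt E x).source := mem_chart_source E x
  have hz := euclChart_self_mem (E := E) x
  have hpx : euclParam E x (euclChart E x x) = x := euclParam_chart hx
  have hc : Tendsto (euclParam E x) (𝓝 (euclChart E x x)) (𝓝 x) := by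
    have := (continuousOn_euclParam (E := E) x).continuousAt
      ((isOpen_euclTarget (E := E) x).mem_nhds hz)
    rwa [ContinuousAt, hpx] at this
  have h' : IsLocalExtr (ψ ∘ euclParam E x) (euclChart E x x) := by
    rcases h with h | h
    · left
      have := hc.eventually h
      filter_upwards [this] with a ha
      simpa [hpx] using ha
    · right
      have := hc.eventually h
      filter_upwards [this] with a ha
      simpa [hpx] using ha
  rw [(mvfderiv_eq_fderiv_comp hx hψ).2, h'.fderiv_eq_zero]
  simp

lemma mvfderiv_eq_of_isLocalExtr_sub {x : M} {φ ψ : M → ℝ}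
    (hφ : ContMDiffAt 𝓘(ℝ, E) 𝓘(ℝ, ℝ) 1 φ x) (hψ : ContMDiffAt 𝓘(ℝ, E) 𝓘(ℝ, ℝ) 1 ψ x)
    (h : IsLocalExtr (fun y => φ y - ψ y) x) :
    mvfderiv 𝓘(ℝ, E) φ x = mvfderiv 𝓘(ℝ, E) ψ x := by
  have h1 := mvfderiv_eq_zero_of_isLocalExtr (hφ.sub hψ) h
  have h2 := mvfderiv_sub (hφ.mdifferentiableAt (by simp)) (hψ.mdifferentiableAt (by simp))
  exact sub_eq_zero.1 (h2.symm.trans h1)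

section Bumps

variable [T2Space M] [CompactSpace M]

/-- A nonnegative smooth function vanishing exactly at `x₀`. -/
lemma exists_contMDiff_vanishing_at (x₀ : M) :
    ∃ g : M → ℝ, ContMDiff 𝓘(ℝ, E) 𝓘(ℝ, ℝ) ∞ g ∧ g x₀ = 0 ∧ ∀ y, y ≠ x₀ → 0 < g y := by
  obtain ⟨f⟩ : Nonempty (SmoothBumpFunction 𝓘(ℝ, E) x₀) := inferInstance
  let N : Model E → ℝ := fun z => ‖z - euclChart E x₀ x₀‖ ^ 2
  have hN : ContDiff ℝ ∞ N := (contDiff_id.sub contDiff_const).norm_sq ℝ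
  have hN' : ContMDiffOn 𝓘(ℝ, E) 𝓘(ℝ, ℝ) ∞ (fun y => N (euclChart E x₀ y))
      (chartAt E x₀).source := fun y hy =>
    (hN.contMDiff.contMDiffAt.comp y (contMDiffAt_euclChart hy)).contMDiffWithinAt
  have h1 := f.contMDiff_smul hN'
  refine ⟨fun y => f y • N (euclChart E x₀ y) + (1 - f y), ?_, ?_, fun y hy => ?_⟩
  · exact h1.add (contMDiff_const.sub f.contMDiff)
  · simp [N]
  · have hf0 := f.nonneg (x := y)
    have hf1 := f.le_one (x := y)
    have hNn : 0 ≤ N (euclChart E x₀ y) := by positivity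
    rcases hf0.eq_or_lt with h0 | h0
    · simp [← h0]
    · have hys : y ∈ (chartAt E x₀).source := by
        apply f.support_subset_source
        simpa using h0.ne'
      have : 0 < N (euclChart E x₀ y) := by
        have : euclChart E x₀ y ≠ euclChart E x₀ x₀ := fun h => hy (by
          rw [← euclParam_chart hys, h, euclParam_chart (mem_chart_source E x₀)])
        have := norm_pos_iff.2 (sub_ne_zero.2 this)
        positivity
      simp only [smul_eq_mul]
      nlinarith [mul_pos h0 this]

/-- A local `C¹` function touching a continuous function `u` from below at `x₀` can be replaced by
a global one with the same differential at `x₀`, which is strictly below `u` elsewhere. -/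
lemma exists_global_touching {u ψ : M → ℝ} (hu : Continuous u) {x₀ : M}
    (hψ : ContMDiffAt 𝓘(ℝ, E) 𝓘(ℝ, ℝ) 1 ψ x₀) (hmin : IsLocalMin (fun y => u y - ψ y) x₀) :
    ∃ θ : M → ℝ, ContMDiff 𝓘(ℝ, E) 𝓘(ℝ, ℝ) 1 θ ∧ θ x₀ = u x₀ ∧ (∀ y, y ≠ x₀ → θ y < u y) ∧
      mvfderiv 𝓘(ℝ, E) θ x₀ = mvfderiv 𝓘(ℝ, E) ψ x₀ := by
  obtain ⟨g, hg, hg0, hgpos⟩ := exists_contMDiff_vanishing_at (E := E) x₀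
  have hnh : {y | ContMDiffAt 𝓘(ℝ, E) 𝓘(ℝ, ℝ) 1 ψ y ∧ u x₀ - ψ x₀ ≤ u y - ψ y} ∈ 𝓝 x₀ :=
    ((contMDiffAt_iff_contMDiffAt_nhds (by simp)).1 hψ).and hmin
  obtain ⟨f, -, hf⟩ := (SmoothBumpFunction.nhds_basis_tsupport (I := 𝓘(ℝ, E)) x₀).mem_iff.1 hnh
  obtain ⟨A, hA⟩ : ∃ A, ∀ y, A ≤ u y := by
    obtain ⟨A, hA⟩ := (isCompact_range hu).bddBelow
    exact ⟨A, fun y => hA (mem_range_self y)⟩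
  -- `θ` interpolates between `ψ + const` near `x₀` and the lower bound `A` of `u` far away.
  let θ : M → ℝ := fun y => f y * (ψ y + (u x₀ - ψ x₀)) + (1 - f y) * A - g y
  have hf1 : ContMDiff 𝓘(ℝ, E) 𝓘(ℝ, ℝ) 1 f := f.contMDiff.of_le (by simp)
  have h1 : ContMDiff 𝓘(ℝ, E) 𝓘(ℝ, ℝ) 1 (fun y => f y * (ψ y + (u x₀ - ψ x₀))) := by
    refine contMDiff_of_tsupport fun y hy => ?_
    have : y ∈ tsupport f := closure_mono (fun a ha => by
      simp only [Function.mem_support] at ha ⊢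
      exact left_ne_zero_of_mul ha) hy
    exact hf1.contMDiffAt.mul ((hf this).1.add contMDiffAt_const)
  have hg1 : ContMDiff 𝓘(ℝ, E) 𝓘(ℝ, ℝ) 1 g := hg.of_le (by simp)
  have hθ : ContMDiff 𝓘(ℝ, E) 𝓘(ℝ, ℝ) 1 θ :=
    (h1.add ((contMDiff_const.sub hf1).mul contMDiff_const)).sub hg1
  have hle : ∀ y, f y * (ψ y + (u x₀ - ψ x₀)) + (1 - f y) * A ≤ u y := by
    intro y
    have hf0 := f.nonneg (x := y)
    have hf1 := f.le_one (x := y)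
    rcases hf0.eq_or_lt with h0 | h0
    · simp [← h0, hA y]
    · have := (hf (subset_tsupport _ (Function.mem_support.2 h0.ne'))).2
      nlinarith [mul_le_mul_of_nonneg_left (hA y) (sub_nonneg.2 hf1)]
  have hfx : f x₀ = 1 := f.eq_one
  refine ⟨θ, hθ, by simp [θ, hg0], fun y hy => ?_, ?_⟩
  · have := hle y
    have := hgpos y hy
    simp only [θ]; linarith
  · refine mvfderiv_eq_of_isLocalExtr_sub hθ.contMDiffAt hψ (Or.inr ?_)
    filter_upwards [f.eventuallyEq_one] with y hy
    have : 0 ≤ g y := by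
      rcases eq_or_ne y x₀ with rfl | h
      · exact hg0.ge
      · exact (hgpos y h).le
    simp only [θ]
    rw [hy, hfx, hg0]
    simp
    linarith

/-- The version of `exists_global_touching` for functions touching from above. -/
lemma exists_global_touching_above {u ψ : M → ℝ} (hu : Continuous u) {x₀ : M}
    (hψ : ContMDiffAt 𝓘(ℝ, E) 𝓘(ℝ, ℝ) 1 ψ x₀) (hmax : IsLocalMax (fun y => u y - ψ y) x₀) :
    ∃ θ : M → ℝ, ContMDiff 𝓘(ℝ, E) 𝓘(ℝ, ℝ) 1 θ ∧ θ x₀ = u x₀ ∧ (∀ y, y ≠ x₀ → u y < θ y) ∧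
      mvfderiv 𝓘(ℝ, E) θ x₀ = mvfderiv 𝓘(ℝ, E) ψ x₀ := by
  obtain ⟨θ, h1, h2, h3, h4⟩ := exists_global_touching (u := fun y => - u y)
    (ψ := fun y => - ψ y) hu.neg hψ.neg
    (by filter_upwards [hmax] with y hy; linarith)
  refine ⟨fun y => - θ y, h1.neg, by simp [h2], fun y hy => by linarith [h3 y hy], ?_⟩
  have e1 := mvfderiv_neg (I := 𝓘(ℝ, E)) (g := θ) (x := x₀)
  have e2 := mvfderiv_neg (I := 𝓘(ℝ, E)) (g := ψ) (x := x₀)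
  refine Eq.trans e1 ?_
  rw [h4]
  exact (congrArg Neg.neg e2).trans (neg_neg _)

/-- Every covector is the differential of a smooth function. -/
lemma exists_mvfderiv_eq (x : M) (p : Cotangent E M x) :
    ∃ ψ : M → ℝ, ContMDiff 𝓘(ℝ, E) 𝓘(ℝ, ℝ) 1 ψ ∧ mvfderiv 𝓘(ℝ, E) ψ x = p := by
  have hx : x ∈ (chartAt E x).source := mem_chart_source E x
  obtain ⟨e, he, -⟩ := exists_euclDeriv_inverse (E := E) hx
  let q : Model E →L[ℝ] ℝ := p ∘L (e.symm : Model E →L[ℝ] TangentSpace 𝓘(ℝ, E) x)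
  have h1 : ContMDiffAt 𝓘(ℝ, E) 𝓘(ℝ, ℝ) 1 (fun y => q (euclChart E x y)) x :=
    contMDiffAt_comp_euclChart hx q.contDiff.contDiffAt
  obtain ⟨f⟩ : Nonempty (SmoothBumpFunction 𝓘(ℝ, E) x) := inferInstance
  have h2 : ContMDiffOn 𝓘(ℝ, E) 𝓘(ℝ, ℝ) ∞ (fun y => q (euclChart E x y))
      (chartAt E x).source := fun y hy =>
    (q.contDiff.contMDiff.contMDiffAt.comp y (contMDiffAt_euclChart hy)).contMDiffWithinAt
  refine ⟨_, (f.contMDiff_smul h2).of_le (by simp), ?_⟩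
  have : (fun y => f y • q (euclChart E x y)) =ᶠ[𝓝 x] fun y => q (euclChart E x y) := by
    filter_upwards [f.eventuallyEq_one] with y hy
    simp [hy]
  rw [mvfderiv_congr this, mvfderiv_comp_euclChart hx q.differentiableAt, ← he]
  ext v
  simp [q]

end Bumps

section Riemannian

variable [Bundle.RiemannianBundle (fun x : M => TangentSpace 𝓘(ℝ, E) x)]
  [IsContinuousRiemannianBundle E (fun x : M => TangentSpace 𝓘(ℝ, E) x)]

/-- The Riemannian norm is locally equivalent to the Euclidean norm of a chart. -/
lemma exists_norm_equiv (x₀ : M) : ∃ C > 0, ∀ᶠ y in 𝓝 x₀, y ∈ (chartAt E x₀).source ∧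
    (∀ v : TangentSpace 𝓘(ℝ, E) y, ‖euclDeriv E x₀ y v‖ ≤ C * ‖v‖) ∧
    ∀ q : Model E →L[ℝ] ℝ, ‖q‖ ≤ C * ‖q ∘L euclDeriv E x₀ y‖ := by
  obtain ⟨C1, hC1, h1⟩ := eventually_norm_trivializationAt_lt E
    (fun x : M => TangentSpace 𝓘(ℝ, E) x) x₀
  obtain ⟨C2, hC2, h2⟩ := eventually_norm_symmL_trivializationAt_lt E
    (fun x : M => TangentSpace 𝓘(ℝ, E) x) x₀
  let T : E →L[ℝ] Model E := (toEuclidean : E ≃L[ℝ] Model E).toContinuousLinearMap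
  let S : Model E →L[ℝ] E := (toEuclidean : E ≃L[ℝ] Model E).symm.toContinuousLinearMap
  refine ⟨(‖T‖ * C1) + (C2 * ‖S‖) + 1, by positivity, ?_⟩
  filter_upwards [h1, h2, (chartAt E x₀).open_source.mem_nhds (mem_chart_source E x₀)]
    with y h1 h2 hy
  refine ⟨hy, fun v => ?_, fun q => ?_⟩
  · have : ‖euclDeriv E x₀ y v‖ ≤ ‖T‖ * (C1 * ‖v‖) := by
      refine (T.le_opNorm _).trans ?_
      gcongr
      exact (ContinuousLinearMap.le_opNorm _ _).trans (by gcongr)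
    refine this.trans ?_
    have hv := norm_nonneg v
    have : 0 ≤ C2 * ‖S‖ := by positivity
    nlinarith [mul_nonneg this hv]
  · obtain ⟨e, he, he'⟩ := exists_euclDeriv_inverse (E := E) hy
    have hq : q = (q ∘L euclDeriv E x₀ y) ∘L
        (e.symm : Model E →L[ℝ] TangentSpace 𝓘(ℝ, E) y) := by
      rw [← he]; ext v; simp
    have hn : ‖(e.symm : Model E →L[ℝ] TangentSpace 𝓘(ℝ, E) y)‖ ≤ C2 * ‖S‖ := by
      rw [he']
      exact (ContinuousLinearMap.opNorm_comp_le _ _).trans (by gcongr)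
    calc ‖q‖ = ‖(q ∘L euclDeriv E x₀ y) ∘L
        (e.symm : Model E →L[ℝ] TangentSpace 𝓘(ℝ, E) y)‖ := by rw [← hq]
      _ ≤ ‖q ∘L euclDeriv E x₀ y‖ * (C2 * ‖S‖) :=
        (ContinuousLinearMap.opNorm_comp_le _ _).trans (by gcongr)
      _ ≤ _ := by
        have := norm_nonneg (q ∘L euclDeriv E x₀ y)
        have h3 : 0 ≤ ‖T‖ * C1 := by positivity
        nlinarith [mul_nonneg h3 this]

end Riemannian

lemma isContinuousRiemannianBundle
    [Bundle.RiemannianBundle (fun x : M => TangentSpace 𝓘(ℝ, E) x)]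
    [IsContMDiffRiemannianBundle 𝓘(ℝ, E) ∞ E (fun x : M => TangentSpace 𝓘(ℝ, E) x)] :
    IsContinuousRiemannianBundle E (fun x : M => TangentSpace 𝓘(ℝ, E) x) := by
  obtain ⟨g, hg, h⟩ := IsContMDiffRiemannianBundle.exists_contMDiff (IB := 𝓘(ℝ, E)) (n := ∞)
    (F := E) (E := fun x : M => TangentSpace 𝓘(ℝ, E) x)
  exact ⟨g, hg.continuous, h⟩

end Charts

/-! ### Viscosity subsolutions in Euclidean space -/

section Euclidean

variable {F : Type*} [NormedAddCommGroup F] [InnerProductSpace ℝ F] [FiniteDimensional ℝ F]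

/-- If the gradients of all functions touching `w` from above have norm at most `ρ`, then `w` is
Lipschitz. The test functions are `(ρ + 1) ‖z - a‖` plus a large power of the distance to `a`, which
keeps the maximum away from the boundary. -/
lemma sub_le_of_touching_above_bound {w : F → ℝ} {z₀ : F} {R ρ : ℝ} (hR : 0 < R) (hρ : 0 ≤ ρ)
    (hw : ContinuousOn w (Metric.closedBall z₀ R))
    (htest : ∀ z ∈ Metric.ball z₀ R, ∀ ψ : F → ℝ, ContDiffAt ℝ 1 ψ z →
      IsLocalMax (fun y => w y - ψ y) z → ‖fderiv ℝ ψ z‖ ≤ ρ)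
    {a b : F} (ha : a ∈ Metric.ball z₀ (R / 4)) (hb : b ∈ Metric.ball z₀ (R / 4)) :
    w b - w a ≤ (ρ + 1) * ‖b - a‖ := by
  have hcpt : IsCompact (Metric.closedBall z₀ R) := isCompact_closedBall _ _
  have haR : a ∈ Metric.closedBall z₀ R :=
    (Metric.ball_subset_closedBall.trans (Metric.closedBall_subset_closedBall (by linarith))) ha
  have hbR : b ∈ Metric.closedBall z₀ R :=
    (Metric.ball_subset_closedBall.trans (Metric.closedBall_subset_closedBall (by linarith))) hb
  obtain ⟨C, hC⟩ := hcpt.exists_bound_of_continuousOn hw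
  -- the power is large at distance `3 R / 4` from `a` (the sphere of radius `R` is farther away) and
  -- small at distance `R / 2` (where `b` lies)
  let φ : ℕ → F → ℝ := fun n z => (ρ + 1) * ‖z - a‖ + (‖z - a‖ / (5 * R / 8)) ^ (2 * n)
  have hφa : ∀ n, n ≠ 0 → φ n a = 0 := fun n hn => by simp [φ, hn]
  have hmain : ∀ᶠ n : ℕ in atTop, w b - w a ≤ (ρ + 1) * ‖b - a‖ + ((4 / 5 : ℝ) ^ 2) ^ n := by
    have hlim : Tendsto (fun n : ℕ => ((6 / 5 : ℝ) ^ 2) ^ n) atTop atTop :=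
      tendsto_pow_atTop_atTop_of_one_lt (by norm_num)
    filter_upwards [hlim.eventually_gt_atTop (2 * C), eventually_ne_atTop 0] with n hn hn0
    have hφc : Continuous (φ n) := by fun_prop
    obtain ⟨z, hz, hmax⟩ := hcpt.exists_isMaxOn ⟨a, haR⟩ (hw.sub hφc.continuousOn)
    have hza : w a ≤ w z - φ n z := by
      have := hmax haR
      simpa [hφa n hn0] using this
    have hzball : z ∈ Metric.ball z₀ R := by
      by_contra hcon
      have hd : R ≤ ‖z - z₀‖ := by simpa [dist_eq_norm] using hcon
      have h1 : 3 * R / 4 ≤ ‖z - a‖ := by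
        have h2 : ‖z - z₀‖ ≤ ‖z - a‖ + ‖a - z₀‖ := norm_sub_le_norm_sub_add_norm_sub z a z₀
        have h3 : ‖a - z₀‖ < R / 4 := by simpa [dist_eq_norm] using ha
        linarith
      have h4 : (6 / 5 : ℝ) ≤ ‖z - a‖ / (5 * R / 8) := by
        rw [le_div_iff₀ (by positivity)]; linarith
      have h5 : ((6 / 5 : ℝ) ^ 2) ^ n ≤ (‖z - a‖ / (5 * R / 8)) ^ (2 * n) := by
        rw [← pow_mul]; gcongr
      have h6 := (abs_le.1 (hC z hz)).2
      have h7 := (abs_le.1 (hC a haR)).1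
      have h8 : 0 ≤ (ρ + 1) * ‖z - a‖ := by positivity
      simp only [φ] at hza
      linarith
    -- away from `a` the gradient of the test function is longer than `ρ`
    have hzeq : z = a := by
      by_contra hne
      have hne' : z - a ≠ 0 := sub_ne_zero.2 hne
      have hd : 0 < ‖z - a‖ := norm_pos_iff.2 hne'
      have hcd : ContDiffAt ℝ 1 (φ n) z := by
        have hN : ContDiffAt ℝ 1 (fun z => ‖z - a‖) z :=
          (contDiffAt_id.sub contDiffAt_const).norm ℝ hne'
        exact (contDiffAt_const.mul hN).add ((hN.div_const _).pow _)
      have hloc : IsLocalMax (fun y => w y - φ n y) z :=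
        hmax.isLocalMax (mem_of_superset (Metric.isOpen_ball.mem_nhds hzball)
          Metric.ball_subset_closedBall)
      have hbd := htest z hzball _ hcd hloc
      -- the derivative of the test function in the direction `z - a`
      have hline : HasDerivAt (fun t : ℝ => φ n (a + t • (z - a)))
          (fderiv ℝ (φ n) z (z - a)) 1 := by
        have h1 : HasDerivAt (fun t : ℝ => a + t • (z - a)) (z - a) 1 := by
          simpa using ((hasDerivAt_id (1 : ℝ)).smul_const (z - a)).const_add a
        have h2 : HasFDerivAt (φ n) (fderiv ℝ (φ n) z) (a + (1 : ℝ) • (z - a)) := by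
          simpa using (hcd.differentiableAt (by simp)).hasFDerivAt
        exact h2.comp_hasDerivAt 1 h1
      have hexpl : HasDerivAt (fun t : ℝ => (ρ + 1) * ‖z - a‖ * t +
          (‖z - a‖ / (5 * R / 8)) ^ (2 * n) * t ^ (2 * n))
          ((ρ + 1) * ‖z - a‖ * 1 + (‖z - a‖ / (5 * R / 8)) ^ (2 * n) *
            (((2 * n : ℕ) : ℝ) * 1 ^ (2 * n - 1))) 1 :=
        ((hasDerivAt_id (1 : ℝ)).const_mul _).add ((hasDerivAt_pow (2 * n) (1 : ℝ)).const_mul _)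
      have heq : (fun t : ℝ => φ n (a + t • (z - a))) =ᶠ[𝓝 1] fun t : ℝ =>
          (ρ + 1) * ‖z - a‖ * t + (‖z - a‖ / (5 * R / 8)) ^ (2 * n) * t ^ (2 * n) := by
        filter_upwards [lt_mem_nhds (zero_lt_one (α := ℝ))] with t ht
        simp only [φ, add_sub_cancel_left, norm_smul, Real.norm_eq_abs, abs_of_pos ht]
        rw [← mul_pow]
        congr 1
        · ring
        · congr 1; ring
      have hval := hline.unique (hexpl.congr_of_eventuallyEq heq)
      have h1 : (fderiv ℝ (φ n) z) (z - a) ≤ ρ * ‖z - a‖ :=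
        (le_abs_self _).trans (((fderiv ℝ (φ n) z).le_opNorm _).trans (by gcongr))
      have h2 : 0 ≤ (‖z - a‖ / (5 * R / 8)) ^ (2 * n) *
            (((2 * n : ℕ) : ℝ) * 1 ^ (2 * n - 1)) := by positivity
      linarith
    subst hzeq
    have hzb := hmax hbR
    have h1 : ‖b - z‖ / (5 * R / 8) ≤ 4 / 5 := by
      have h2 : ‖b - z‖ ≤ ‖b - z₀‖ + ‖z - z₀‖ := norm_sub_le_norm_sub_add_norm_sub b z₀ z |>.trans
        (by rw [norm_sub_rev z₀ z])
      have h3 : ‖z - z₀‖ < R / 4 := by simpa [dist_eq_norm] using ha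
      have h4 : ‖b - z₀‖ < R / 4 := by simpa [dist_eq_norm] using hb
      rw [div_le_iff₀ (by positivity)]; linarith
    have h5 : (‖b - z‖ / (5 * R / 8)) ^ (2 * n) ≤ ((4 / 5 : ℝ) ^ 2) ^ n := by
      rw [← pow_mul]; gcongr
    have h6 : w b - φ n b ≤ w z := by simpa [hφa n hn0] using hzb
    simp only [φ] at h6
    linarith
  have hlim : Tendsto (fun n : ℕ => (ρ + 1) * ‖b - a‖ + ((4 / 5 : ℝ) ^ 2) ^ n) atTop
      (𝓝 ((ρ + 1) * ‖b - a‖ + 0)) :=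
    tendsto_const_nhds.add (tendsto_pow_atTop_nhds_zero_of_lt_one (by norm_num) (by norm_num))
  rw [add_zero] at hlim
  exact ge_of_tendsto hlim hmain

/-- A viscosity inequality, tested with `C¹` functions touching from above, also holds for the
gradient at points of differentiability. -/
lemma le_of_differentiableAt {w : F → ℝ} {z : F} {U : Set F} (hU : IsOpen U) (hz : z ∈ U)
    {G : F → (F →L[ℝ] ℝ) → ℝ} {f : F → ℝ}
    (hG : ContinuousOn (fun a : F × (F →L[ℝ] ℝ) => G a.1 a.2) (U ×ˢ univ))
    (hf : ContinuousOn f U) (hw : ContinuousOn w U)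
    (htest : ∀ z ∈ U, ∀ ψ : F → ℝ, ContDiffAt ℝ 1 ψ z →
      IsLocalMax (fun y => w y - ψ y) z → G z (fderiv ℝ ψ z) ≤ f z)
    (hdiff : DifferentiableAt ℝ w z) : G z (fderiv ℝ w z) ≤ f z := by
  set q := fderiv ℝ w z with hq
  -- near `z` there are points where `w` is touched from above with gradient close to `q`
  have key : ∀ n : ℕ, ∃ y ∈ U, ∃ p : F →L[ℝ] ℝ, G y p ≤ f y ∧ ‖y - z‖ ≤ 1 / ((n : ℝ) + 1) ∧
      ‖p - q‖ ≤ 6 * (1 / ((n : ℝ) + 1)) := by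
    intro n
    set ε : ℝ := 1 / ((n : ℝ) + 1) with hε
    have hεpos : 0 < ε := Nat.one_div_pos_of_nat
    have h1 := hdiff.hasFDerivAt.isLittleO.def hεpos
    obtain ⟨δ, hδ, hball⟩ := Metric.eventually_nhds_iff_ball.1 (h1.and (hU.mem_nhds hz))
    set s := min (δ / 2) ε with hs
    have hspos : 0 < s := by positivity
    have hsub : Metric.closedBall z s ⊆ Metric.ball z δ :=
      Metric.closedBall_subset_ball ((min_le_left _ _).trans_lt (by linarith))
    -- the factor `2 ε / s` makes the quadratic term beat the error `ε ‖y - z‖` of the linear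
    -- approximation on the sphere of radius `s`, while its gradient is at most `4 ε` in the ball
    let ψ : F → ℝ := fun y => q (y - z) + (2 * ε / s) * ‖y - z‖ ^ 2
    have hψ : ContDiff ℝ 1 ψ :=
      (q.contDiff.comp (contDiff_id.sub contDiff_const)).add
        (contDiff_const.mul ((contDiff_id.sub contDiff_const).norm_sq ℝ))
    have hcont : ContinuousOn (fun y => w y - ψ y) (Metric.closedBall z s) :=
      (hw.mono fun y hy => (hball y (hsub hy)).2).sub hψ.continuous.continuousOn
    obtain ⟨y, hy, hmax⟩ := (isCompact_closedBall z s).exists_isMaxOn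
      ⟨z, Metric.mem_closedBall_self hspos.le⟩ hcont
    have hyz : ‖y - z‖ ≤ s := by simpa [dist_eq_norm] using hy
    have hyball : y ∈ Metric.ball z s := by
      by_contra hcon
      have hys : ‖y - z‖ = s := le_antisymm hyz (by simpa [dist_eq_norm] using hcon)
      have h2 := hmax (Metric.mem_closedBall_self hspos.le)
      have h3 := (abs_le.1 ((hball y (hsub hy)).1)).2
      simp only [ψ, mem_ofPred_eq, sub_self, map_zero, norm_zero, hys] at h2 h3
      have h4 : 2 * ε / s * s ^ 2 = 2 * ε * s := by field_simp
      have h5 : 0 < ε * s := by positivity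
      norm_num at h2
      rw [← hq, map_sub] at h3
      linarith
    have hloc : IsLocalMax (fun y => w y - ψ y) y :=
      hmax.isLocalMax (mem_of_superset (Metric.isOpen_ball.mem_nhds hyball)
        Metric.ball_subset_closedBall)
    refine ⟨y, (hball y (hsub hy)).2, fderiv ℝ ψ y,
      htest y (hball y (hsub hy)).2 ψ hψ.contDiffAt hloc, hyz.trans (min_le_right _ _), ?_⟩
    have hder : HasFDerivAt ψ (q + (2 * ε / s) • (2 • (innerSL ℝ (y - z)))) y := by
      have h1 : HasFDerivAt (fun y => q (y - z)) q y := by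
        have h := (q.hasFDerivAt (x := y - z)).comp y ((hasFDerivAt_id y).sub_const z)
        rwa [ContinuousLinearMap.comp_id] at h
      have h2 : HasFDerivAt (fun y : F => ‖y - z‖ ^ 2) (2 • (innerSL ℝ (y - z))) y := by
        simpa using ((hasFDerivAt_id y).sub_const z).norm_sq
      exact h1.add (h2.const_mul _)
    rw [hder.fderiv, add_sub_cancel_left, norm_smul, Real.norm_of_nonneg (by positivity)]
    have h6 : ‖2 • (innerSL ℝ (y - z))‖ ≤ 2 * s := by
      refine (norm_nsmul_le).trans ?_
      rw [innerSL_apply_norm]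
      push_cast
      linarith
    calc 2 * ε / s * ‖2 • (innerSL ℝ (y - z))‖ ≤ 2 * ε / s * (2 * s) := by gcongr
      _ = 4 * ε := by field_simp; norm_num
      _ ≤ 6 * ε := by linarith
  choose y hyU p hGp hyz hpq using key
  have hlim0 : Tendsto (fun n : ℕ => 1 / ((n : ℝ) + 1)) atTop (𝓝 0) :=
    tendsto_one_div_add_atTop_nhds_zero_nat
  have hylim : Tendsto y atTop (𝓝 z) :=
    tendsto_iff_norm_sub_tendsto_zero.2 (squeeze_zero (fun _ => norm_nonneg _) hyz hlim0)
  have hplim : Tendsto p atTop (𝓝 q) :=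
    tendsto_iff_norm_sub_tendsto_zero.2 (squeeze_zero (fun _ => norm_nonneg _) hpq
      (by simpa using hlim0.const_mul 6))
  have h1 : ContinuousAt (fun a : F × (F →L[ℝ] ℝ) => G a.1 a.2) (z, q) :=
    hG.continuousAt ((hU.prod isOpen_univ).mem_nhds ⟨hz, mem_univ _⟩)
  exact le_of_tendsto_of_tendsto' (h1.tendsto.comp (hylim.prodMk_nhds hplim))
    ((hf.continuousAt (hU.mem_nhds hz)).tendsto.comp hylim) hGp

variable [MeasurableSpace F] [BorelSpace F]

open scoped Convolution in
/-- Mollification of a Lipschitz function: the gradient of the mollified function is an average of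
gradients of the function at nearby points of differentiability (which have full measure by
Rademacher's theorem), so it lies in every closed convex set that contains them. -/
lemma exists_contDiff_average {g : F → ℝ} {K : NNReal} (hg : LipschitzWith K g) {η : ℝ}
    (hη : 0 < η) : ∃ φ : F → ℝ, ContDiff ℝ 1 φ ∧ (∀ z, |φ z - g z| ≤ K * η) ∧
      ∀ z, ∀ s : Set (F →L[ℝ] ℝ), Convex ℝ s → IsClosed s →
        (∀ y ∈ Metric.ball z η, DifferentiableAt ℝ g y → fderiv ℝ g y ∈ s) →
        fderiv ℝ φ z ∈ s := by
  let μ : Measure F := Measure.addHaar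
  let ρ : ContDiffBump (0 : F) := ⟨η / 2, η, by positivity, by linarith⟩
  let d : F → ENNReal := fun a => ENNReal.ofReal (ρ.normed μ a)
  have hd : Measurable d := (ρ.continuous_normed (μ := μ)).measurable.ennreal_ofReal
  -- the probability measure whose density is the mollifier
  let ν : Measure F := μ.withDensity d
  have hνint : ∀ {G : Type _} [NormedAddCommGroup G] [NormedSpace ℝ G] (f : F → G),
      ∫ a, f a ∂ν = ∫ a, ρ.normed μ a • f a ∂μ := by
    intro G _ _ f
    rw [integral_withDensity_eq_integral_toReal_smul hd
      (Eventually.of_forall fun a => ENNReal.ofReal_lt_top)]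
    refine integral_congr_ae (Eventually.of_forall fun a => ?_)
    simp only [d, ENNReal.toReal_ofReal (ρ.nonneg_normed a)]
  have hν : IsProbabilityMeasure ν := by
    constructor
    rw [withDensity_apply _ MeasurableSet.univ, Measure.restrict_univ,
      ← ofReal_integral_eq_lintegral_ofReal ρ.integrable_normed
        (Eventually.of_forall ρ.nonneg_normed), ρ.integral_normed, ENNReal.ofReal_one]
  have hνμ : ν ≪ μ := withDensity_absolutelyContinuous _ _
  have hνball : ∀ᵐ a ∂ν, a ∈ Metric.ball (0 : F) η := by
    rw [ae_withDensity_iff hd]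
    refine Eventually.of_forall fun a ha => ?_
    have h1 : ρ.normed μ a ≠ 0 := fun h => ha (by simp [d, h])
    have := Function.mem_support.2 h1
    rwa [ρ.support_normed_eq] at this
  let φ : F → ℝ := (ρ.normed μ) ⋆[ContinuousLinearMap.lsmul ℝ ℝ, μ] g
  have hφ : ∀ z, φ z = ∫ a, g (z - a) ∂ν := fun z => by
    rw [hνint]; rfl
  have hdiffae : ∀ z, ∀ᵐ a ∂ν, DifferentiableAt ℝ g (z - a) := fun z =>
    hνμ.ae_le ((quasiMeasurePreserving_sub_left μ z).ae hg.ae_differentiableAt)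
  have hder : ∀ z, Integrable (fun a => fderiv ℝ g (z - a)) ν ∧
      HasFDerivAt φ (∫ a, fderiv ℝ g (z - a) ∂ν) z := by
    intro z
    have hmeas : ∀ x, AEStronglyMeasurable (fun a => g (x - a)) ν := fun x =>
      (hg.continuous.comp (continuous_const.sub continuous_id)).aestronglyMeasurable
    have h := hasFDerivAt_integral_of_dominated_loc_of_lip (μ := ν) (𝕜 := ℝ)
      (F := fun x a => g (x - a)) (F' := fun a => fderiv ℝ g (z - a)) (x₀ := z)
      (bound := fun _ => (K : ℝ)) (s := univ) univ_mem
      (Eventually.of_forall hmeas) ?_ ?_ ?_ (integrable_const _) ?_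
    · refine ⟨h.1, ?_⟩
      have h2 := h.2
      have : φ = fun x => ∫ a, g (x - a) ∂ν := funext hφ
      rw [this]
      exact h2
    · have hbd : ∀ᵐ a ∂ν, a ∈ Metric.ball (0 : F) η := hνball
      refine ⟨hmeas z, HasFiniteIntegral.of_bounded (C := ‖g z‖ + K * η) ?_⟩
      filter_upwards [hbd] with a ha
      have h1 := hg.dist_le_mul (z - a) z
      rw [dist_eq_norm, dist_eq_norm] at h1
      have h2 : ‖z - a - z‖ ≤ η := by
        rw [sub_sub_cancel_left, norm_neg]; exact (mem_ball_zero_iff.1 ha).le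
      have h3 : ‖g (z - a)‖ ≤ ‖g z‖ + ‖g (z - a) - g z‖ := by
        have := norm_add_le (g z) (g (z - a) - g z)
        rwa [add_sub_cancel] at this
      have : (K : ℝ) * ‖z - a - z‖ ≤ K * η := by gcongr
      linarith
    · exact ((measurable_fderiv ℝ g).comp (measurable_const.sub measurable_id)).aestronglyMeasurable
    · refine Eventually.of_forall fun a => ?_
      refine LipschitzWith.lipschitzOnWith ?_
      have h1 : LipschitzWith (K * 1) (fun x => g (x - a)) :=
        hg.comp (LipschitzWith.of_dist_le_mul fun x y => by simp [dist_eq_norm])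
      simpa using h1
    · filter_upwards [hdiffae z] with a ha
      have h := ha.hasFDerivAt.comp z ((hasFDerivAt_id z).sub_const a)
      rwa [ContinuousLinearMap.comp_id] at h
  refine ⟨φ, ?_, fun z => ?_, fun z s hs hsc hmem => ?_⟩
  · exact ρ.hasCompactSupport_normed.contDiff_convolution_left _ ρ.contDiff_normed
      hg.continuous.locallyIntegrable
  · have := ρ.dist_normed_convolution_le (μ := μ) (x₀ := z) (ε := K * η)
      hg.continuous.aestronglyMeasurable fun x hx => by
        refine (hg.dist_le_mul x z).trans ?_
        gcongr
        exact (Metric.mem_ball.1 hx).le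
    rwa [Real.dist_eq] at this
  · rw [(hder z).2.fderiv]
    refine hs.integral_mem hsc ?_ (hder z).1
    filter_upwards [hdiffae z, hνball] with a ha hb
    refine hmem _ ?_ ha
    rw [Metric.mem_ball, dist_eq_norm, sub_sub_cancel_left, norm_neg]
    exact mem_ball_zero_iff.1 hb

/-- Local regularization of a Lipschitz viscosity subsolution of `G(z, Dw) ≤ f(z)` with `G` convex
in the gradient: the sublevel sets of `G z` are convex, so that they contain the gradients of a
mollification. -/
lemma exists_contDiff_subsolution {w : F → ℝ} {z₀ : F} {R : ℝ} (hR : 0 < R) {K : NNReal}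
    (hw : LipschitzOnWith K w (Metric.ball z₀ R))
    {G : F → (F →L[ℝ] ℝ) → ℝ} {f : F → ℝ}
    (hG : ContinuousOn (fun a : F × (F →L[ℝ] ℝ) => G a.1 a.2) (Metric.ball z₀ R ×ˢ univ))
    (hconv : ∀ z ∈ Metric.ball z₀ R, ConvexOn ℝ univ (G z))
    (hf : ContinuousOn f (Metric.ball z₀ R))
    (htest : ∀ z ∈ Metric.ball z₀ R, ∀ ψ : F → ℝ, ContDiffAt ℝ 1 ψ z →
      IsLocalMax (fun y => w y - ψ y) z → G z (fderiv ℝ ψ z) ≤ f z) {ε : ℝ} (hε : 0 < ε) :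
    ∃ φ : F → ℝ, ContDiff ℝ 1 φ ∧ ∀ z ∈ Metric.ball z₀ (R / 2),
      |φ z - w z| ≤ ε ∧ G z (fderiv ℝ φ z) ≤ f z + ε := by
  obtain ⟨g, hg, hgw⟩ := hw.extend_real
  have hdiff : ∀ z ∈ Metric.ball z₀ R, DifferentiableAt ℝ g z →
      G z (fderiv ℝ g z) ≤ f z := fun z hz hd => by
    refine le_of_differentiableAt Metric.isOpen_ball hz hG hf hg.continuous.continuousOn ?_ hd
    intro y hy ψ hψ hmax
    refine htest y hy ψ hψ ?_
    filter_upwards [hmax, Metric.isOpen_ball.mem_nhds hy] with a ha hab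
    rw [hgw hab, hgw hy]; exact ha
  -- uniform continuity of `G - f` on a compact set of positions and gradients
  have hcpt : IsCompact (Metric.closedBall z₀ (3 * R / 4) ×ˢ
      Metric.closedBall (0 : F →L[ℝ] ℝ) K) := (isCompact_closedBall _ _).prod
        (isCompact_closedBall _ _)
  have hsub : Metric.closedBall z₀ (3 * R / 4) ⊆ Metric.ball z₀ R :=
    Metric.closedBall_subset_ball (by linarith)
  have hcont : ContinuousOn (fun a : F × (F →L[ℝ] ℝ) => G a.1 a.2 - f a.1)
      (Metric.closedBall z₀ (3 * R / 4) ×ˢ Metric.closedBall (0 : F →L[ℝ] ℝ) K) :=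
    (hG.mono (prod_mono hsub (subset_univ _))).sub
      ((hf.mono hsub).comp continuousOn_fst fun a ha => ha.1)
  obtain ⟨δ, hδ, hunif⟩ := Metric.uniformContinuousOn_iff.1
    (hcpt.uniformContinuousOn_of_continuous hcont) ε hε
  set η := min (min δ (R / 4)) (ε / (K + 1)) with hηdef
  have hKpos : (0 : ℝ) < K + 1 := by positivity
  have hη : 0 < η := by positivity
  obtain ⟨φ, hφ, hφg, hφs⟩ := exists_contDiff_average hg hη
  refine ⟨φ, hφ, fun z hz => ⟨?_, ?_⟩⟩
  · rw [hgw (Metric.ball_subset_ball (by linarith) hz)]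
    refine (hφg z).trans ?_
    calc (K : ℝ) * η ≤ (K + 1) * (ε / (K + 1)) := by
          gcongr
          · linarith
          · exact min_le_right _ _
      _ = ε := by field_simp
  · have hzR : z ∈ Metric.ball z₀ R := Metric.ball_subset_ball (by linarith) hz
    have hz34 : z ∈ Metric.closedBall z₀ (3 * R / 4) :=
      (Metric.ball_subset_closedBall.trans (Metric.closedBall_subset_closedBall (by linarith))) hz
    have hclosed : IsClosed {q : F →L[ℝ] ℝ | G z q ≤ f z + ε} := by
      refine isClosed_le ?_ continuous_const
      have : ContinuousOn (fun q : F →L[ℝ] ℝ => G z q) univ :=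
        hG.comp (continuous_const.prodMk continuous_id).continuousOn
          (fun q _ => ⟨hzR, mem_univ _⟩)
      exact continuousOn_univ.1 this
    have hconvex : Convex ℝ {q : F →L[ℝ] ℝ | G z q ≤ f z + ε} := by
      simpa using (hconv z hzR).convex_le (f z + ε)
    refine hφs z _ hconvex hclosed fun y hy hdy => ?_
    have hyη : dist z y < η := by rw [dist_comm]; exact hy
    have hy34 : y ∈ Metric.closedBall z₀ (3 * R / 4) := by
      have h1 : dist y z₀ ≤ dist y z + dist z z₀ := dist_triangle _ _ _
      have h2 : dist z z₀ < R / 2 := hz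
      have h3 : dist y z < R / 4 := hy.trans_le ((min_le_left _ _).trans (min_le_right _ _))
      exact Metric.mem_closedBall.2 (by linarith)
    have hq : fderiv ℝ g y ∈ Metric.closedBall (0 : F →L[ℝ] ℝ) K := by
      simpa using norm_fderiv_le_of_lipschitz ℝ hg
    have h1 := hunif (z, fderiv ℝ g y) ⟨hz34, hq⟩ (y, fderiv ℝ g y) ⟨hy34, hq⟩ (by
      simp only [Prod.dist_eq, dist_self, max_eq_left dist_nonneg]
      exact hyη.trans_le ((min_le_left _ _).trans (min_le_left _ _)))
    rw [Real.dist_eq] at h1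
    have h2 := (abs_lt.1 h1).2
    have h3 := hdiff y (hsub hy34) hdy
    simp only [mem_ofPred_eq]
    linarith

end Euclidean

/-! ### Coercive convex Hamiltonians and regularization of subsolutions -/

section Scalar

variable {E : Type*} [NormedAddCommGroup E] [NormedSpace ℝ E] [FiniteDimensional ℝ E]
  {M : Type*} [TopologicalSpace M] [ChartedSpace E M] [IsManifold 𝓘(ℝ, E) ∞ M]

lemma mem_superdifferential_of_chart {x₀ y : M} (hy : y ∈ (chartAt E x₀).source) {w : M → ℝ}
    {ψ : Model E → ℝ} (hψ : ContDiffAt ℝ 1 ψ (euclChart E x₀ y))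
    (hmax : IsLocalMax (fun z => w (euclParam E x₀ z) - ψ z) (euclChart E x₀ y)) :
    (fderiv ℝ ψ (euclChart E x₀ y)) ∘L euclDeriv E x₀ y ∈ superdifferential E w y := by
  refine ⟨fun y => ψ (euclChart E x₀ y), contMDiffAt_comp_euclChart hy hψ, ?_,
    mvfderiv_comp_euclChart hy (hψ.differentiableAt (by simp))⟩
  have hc : ContinuousAt (euclChart E x₀) y :=
    (continuousOn_euclChart x₀).continuousAt ((chartAt E x₀).open_source.mem_nhds hy)
  filter_upwards [hc.eventually hmax, (chartAt E x₀).open_source.mem_nhds hy] with a ha has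
  simpa [euclParam_chart has, euclParam_chart hy] using ha

lemma superdifferential_mono {f g : M → ℝ} {x : M} (h : ∀ᶠ y in 𝓝 x, f y ≤ g y)
    (hx : f x = g x) : superdifferential E g x ⊆ superdifferential E f x := by
  rintro p ⟨φ, hφ, hmax, rfl⟩
  refine ⟨φ, hφ, ?_, rfl⟩
  filter_upwards [hmax, h] with y hy hfy
  linarith

lemma eq_mvfderiv_of_mem_superdifferential {f : M → ℝ} {x : M} {p : Cotangent E M x}
    (hf : ContMDiffAt 𝓘(ℝ, E) 𝓘(ℝ, ℝ) 1 f x) (hp : p ∈ superdifferential E f x) :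
    p = mvfderiv 𝓘(ℝ, E) f x := by
  obtain ⟨φ, hφ, hmax, rfl⟩ := hp
  exact (mvfderiv_eq_of_isLocalExtr_sub hf hφ (Or.inr hmax)).symm

variable [Bundle.RiemannianBundle (fun x : M => TangentSpace 𝓘(ℝ, E) x)]

/-- The norm of a covector is the operator norm for the Riemannian norm, but the topology and the
module structure of the cotangent space come from the model space `E`; basic facts on the norm are
therefore restated for covectors. -/
lemma norm_cotangent_zero (x : M) : ‖(0 : Cotangent E M x)‖ = 0 :=
  ContinuousLinearMap.opNorm_zero

lemma norm_cotangent_nonneg {x : M} (p : Cotangent E M x) : 0 ≤ ‖p‖ :=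
  ContinuousLinearMap.opNorm_nonneg p

lemma norm_cotangent_smul_le {x : M} (c : ℝ) (p : Cotangent E M x) : ‖c • p‖ ≤ |c| * ‖p‖ :=
  ContinuousLinearMap.opNorm_smul_le c p

lemma norm_cotangent_smul {x : M} (c : ℝ) (p : Cotangent E M x) : ‖c • p‖ = |c| * ‖p‖ := by
  rcases eq_or_ne c 0 with rfl | hc
  · rw [zero_smul, norm_cotangent_zero]; simp
  · refine le_antisymm (norm_cotangent_smul_le c p) ?_
    have h := norm_cotangent_smul_le c⁻¹ (c • p)
    rw [inv_smul_smul₀ hc, abs_inv] at h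
    have hc' : 0 < |c| := abs_pos.2 hc
    calc |c| * ‖p‖ ≤ |c| * (|c|⁻¹ * ‖c • p‖) := by gcongr
      _ = ‖c • p‖ := by field_simp

lemma norm_cotangent_sum_le {x : M} {ι : Type*} (s : Finset ι) (p : ι → Cotangent E M x) :
    ‖∑ k ∈ s, p k‖ ≤ ∑ k ∈ s, ‖p k‖ :=
  norm_sum_le s p

lemma abs_cotangent_apply_le {x : M} (p : Cotangent E M x) (v : TangentSpace 𝓘(ℝ, E) x) :
    |p v| ≤ ‖p‖ * ‖v‖ :=
  ContinuousLinearMap.le_opNorm p v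

/-- A continuous function on the cotangent bundle which is convex in the covector, bounded on
bounded sets and coercive. -/
structure IsCoerciveConvex (h : (x : M) → Cotangent E M x → ℝ) : Prop where
  continuous : Continuous fun z : CotangentBundle E M => h z.1 z.2
  convexOn : ∀ x, ConvexOn ℝ univ (h x)
  exists_bound : ∀ s, ∃ C, ∀ x (p : Cotangent E M x), ‖p‖ ≤ s → |h x p| ≤ C
  coercive : ∀ C, ∃ ρ, ∀ x (p : Cotangent E M x), h x p ≤ C → ‖p‖ ≤ ρ

/-- Convexity turns the two-sided bound by functions of the norm into bounds on bounded sets. -/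
lemma isCoerciveConvex {m : ℕ} {H : Hamiltonian E M m} (hcont : IsContinuousHamiltonian H)
    (hconv : IsConvexHamiltonian H) (hcoer : IsCoerciveHamiltonian H) (i : Fin m) :
    IsCoerciveConvex (H i) := by
  obtain ⟨α, β, hα, -, hαβ⟩ := hcoer
  have hupper : ∀ s, ∃ C, ∀ x (p : Cotangent E M x), ‖p‖ ≤ s → H i x p ≤ C := by
    intro s
    refine ⟨max (β (max s 1)) (β 0), fun x p hp => ?_⟩
    -- `p` lies on the segment between `0` and a covector of norm exactly `s'`, where `β s'` is a bound
    rcases eq_or_ne ‖p‖ 0 with h0 | h0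
    · have := (hαβ i x p).2
      rw [h0] at this
      exact this.trans (le_max_right _ _)
    · set s' := max s 1
      have hs' : 0 < s' := lt_max_of_lt_right one_pos
      have hp' : ‖p‖ ≤ s' := hp.trans (le_max_left _ _)
      set t := ‖p‖ / s'
      have ht0 : 0 ≤ t := by positivity
      have ht1 : t ≤ 1 := (div_le_one hs').2 hp'
      have hp0 : 0 < ‖p‖ := (norm_nonneg p).lt_of_ne h0.symm
      have h1 := (hconv i x).2 (mem_univ ((s' / ‖p‖) • p)) (mem_univ (0 : Cotangent E M x))
        ht0 (sub_nonneg.2 ht1) (by ring)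
      have h2 : t • ((s' / ‖p‖) • p) + (1 - t) • (0 : Cotangent E M x) = p := by
        rw [smul_zero, add_zero, smul_smul]
        have : t * (s' / ‖p‖) = 1 := by simp only [t]; field_simp
        rw [this, one_smul]
      rw [h2] at h1
      have h3 := (hαβ i x ((s' / ‖p‖) • p)).2
      have h4 : ‖(s' / ‖p‖) • p‖ = s' := by
        rw [norm_cotangent_smul, abs_of_nonneg (by positivity)]; field_simp
      rw [h4] at h3
      have h5 := (hαβ i x 0).2
      rw [norm_cotangent_zero] at h5
      simp only [smul_eq_mul] at h1
      have h6 := mul_le_mul_of_nonneg_left (h3.trans (le_max_left _ (β 0))) ht0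
      have h7 := mul_le_mul_of_nonneg_left (h5.trans (le_max_right (β s') _)) (sub_nonneg.2 ht1)
      linarith
  refine ⟨hcont i, hconv i, fun s => ?_, fun C => ?_⟩
  · obtain ⟨C, hC⟩ := hupper s
    refine ⟨|C| + 2 * |α 0|, fun x p hp => abs_le.2 ⟨?_, ?_⟩⟩
    -- the lower bound at `p` comes from the upper bound at `-p` and convexity at the midpoint `0`
    · have h1 := (hconv i x).2 (mem_univ p) (mem_univ (-p)) (by norm_num : (0:ℝ) ≤ 1 / 2)
        (by norm_num : (0:ℝ) ≤ 1 / 2) (by norm_num)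
      rw [smul_neg, add_neg_cancel] at h1
      have h2 := (hαβ i x 0).1
      rw [norm_cotangent_zero] at h2
      have h3 := hC x (-p) (by
        rw [← neg_one_smul ℝ p, norm_cotangent_smul]; simpa using hp)
      simp only [smul_eq_mul] at h1
      have h4 := neg_abs_le (α 0)
      have h5 := le_abs_self C
      linarith
    · have := hC x p hp
      have h4 := abs_nonneg (α 0)
      have h5 := le_abs_self C
      linarith
  · obtain ⟨ρ, hρ⟩ := eventually_atTop.1 (hα.eventually_gt_atTop C)
    refine ⟨ρ, fun x p hp => ?_⟩
    by_contra hcon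
    have := hρ ‖p‖ (not_le.1 hcon).le
    linarith [(hαβ i x p).1]

lemma IsCoerciveConvex.exists_lower_bound {h : (x : M) → Cotangent E M x → ℝ}
    (hh : IsCoerciveConvex h) : ∃ C, ∀ x (p : Cotangent E M x), -C ≤ h x p := by
  obtain ⟨ρ, hρ⟩ := hh.coercive 0
  obtain ⟨C, hC⟩ := hh.exists_bound ρ
  refine ⟨|C|, fun x p => ?_⟩
  by_cases hp : h x p ≤ 0
  · have := (abs_le.1 (hC x p (hρ x p hp))).1
    have := le_abs_self C
    linarith
  · have := abs_nonneg C
    linarith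

lemma IsCoerciveConvex.continuousAt_mvfderiv {h : (x : M) → Cotangent E M x → ℝ}
    (hh : IsCoerciveConvex h) {ψ : M → ℝ} {x : M}
    (hψ : ContMDiffAt 𝓘(ℝ, E) 𝓘(ℝ, ℝ) 1 ψ x) :
    ContinuousAt (fun y => h y (mvfderiv 𝓘(ℝ, E) ψ y)) x :=
  ContinuousAt.comp (f := fun y => (⟨y, mvfderiv 𝓘(ℝ, E) ψ y⟩ : CotangentBundle E M))
    hh.continuous.continuousAt (continuousAt_cotangent_mvfderiv hψ)

lemma IsCoerciveConvex.continuous_mvfderiv {h : (x : M) → Cotangent E M x → ℝ}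
    (hh : IsCoerciveConvex h) {ψ : M → ℝ} (hψ : ContMDiff 𝓘(ℝ, E) 𝓘(ℝ, ℝ) 1 ψ) :
    Continuous (fun y => h y (mvfderiv 𝓘(ℝ, E) ψ y)) :=
  continuous_iff_continuousAt.2 fun _ => hh.continuousAt_mvfderiv hψ.contMDiffAt

/-- The differential of a `C¹` function on a compact manifold is bounded, because a coercive
Hamiltonian is bounded along it. -/
lemma IsCoerciveConvex.exists_norm_mvfderiv_le [CompactSpace M]
    {h : (x : M) → Cotangent E M x → ℝ}
    (hh : IsCoerciveConvex h) {ψ : M → ℝ} (hψ : ContMDiff 𝓘(ℝ, E) 𝓘(ℝ, ℝ) 1 ψ) :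
    ∃ D, ∀ x, ‖(mvfderiv 𝓘(ℝ, E) ψ x : Cotangent E M x)‖ ≤ D := by
  obtain ⟨C, hC⟩ := (isCompact_range (hh.continuous_mvfderiv hψ)).bddAbove
  obtain ⟨ρ, hρ⟩ := hh.coercive C
  exact ⟨ρ, fun x => hρ x _ (hC (mem_range_self x))⟩

variable [IsContinuousRiemannianBundle E (fun x : M => TangentSpace 𝓘(ℝ, E) x)]

/-- A bound on the superdifferentials gives a Lipschitz bound in charts. -/
lemma exists_lipschitzOnWith_chart (x₀ : M) (ρ : ℝ) : ∃ r > 0, ∃ K : NNReal,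
    Metric.ball (euclChart E x₀ x₀) r ⊆ euclTarget E x₀ ∧
    ∀ w : M → ℝ, Continuous w → (∀ x, ∀ p ∈ superdifferential E w x, ‖p‖ ≤ ρ) →
      LipschitzOnWith K (w ∘ euclParam E x₀) (Metric.ball (euclChart E x₀ x₀) r) := by
  obtain ⟨C, hC, hCx⟩ := exists_norm_equiv (E := E) x₀
  set z₀ := euclChart E x₀ x₀
  have hz₀ := (isOpen_euclTarget (E := E) x₀).mem_nhds (euclChart_self_mem x₀)
  have hcont : ContinuousAt (euclParam E x₀) z₀ := (continuousOn_euclParam x₀).continuousAt hz₀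
  rw [ContinuousAt, euclParam_chart (mem_chart_source E x₀)] at hcont
  obtain ⟨R, hR, hball⟩ := Metric.nhds_basis_closedBall.mem_iff.1
    (inter_mem hz₀ (hcont.eventually hCx))
  refine ⟨R / 4, by positivity, Real.toNNReal (C * |ρ| + 1), ?_, fun w hw hρ => ?_⟩
  · exact fun z hz => (hball (Metric.ball_subset_closedBall.trans
      (Metric.closedBall_subset_closedBall (by linarith)) hz)).1
  · have hnn : 0 ≤ C * |ρ| + 1 := by positivity
    have hwc : ContinuousOn (w ∘ euclParam E x₀) (Metric.closedBall z₀ R) :=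
      hw.comp_continuousOn ((continuousOn_euclParam x₀).mono fun z hz => (hball hz).1)
    have key := fun {a b} => sub_le_of_touching_above_bound (w := w ∘ euclParam E x₀) hR
      (ρ := C * |ρ|) (by positivity) hwc (fun z hz ψ hψ hmax => by
        have hzt := hball (Metric.ball_subset_closedBall hz)
        have hy := euclParam_mem_source hzt.1
        have hcp := euclChart_param hzt.1
        have := mem_superdifferential_of_chart (w := w) (ψ := ψ) hy (by rwa [hcp])
          (by rw [hcp]; exact hmax)
        have h1 := hρ _ _ this
        rw [hcp] at h1
        exact (hzt.2.2.2 _).trans (by gcongr; exact h1.trans (le_abs_self _))) (a := a) (b := b)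
    refine LipschitzOnWith.of_dist_le_mul fun a ha b hb => ?_
    rw [Real.coe_toNNReal _ hnn, Real.dist_eq, dist_eq_norm, abs_le]
    have h1 := key ha hb
    have h2 := key hb ha
    rw [norm_sub_rev] at h1
    constructor <;> linarith

/-- Local regularization of subsolutions on the manifold. -/
lemma exists_local_regularization {h : (x : M) → Cotangent E M x → ℝ} (hh : IsCoerciveConvex h)
    {w f : M → ℝ} (hw : Continuous w) (hf : Continuous f) {ρ : ℝ}
    (hρ : ∀ x, ∀ p ∈ superdifferential E w x, ‖p‖ ≤ ρ)
    (hsub : ∀ x, ∀ p ∈ superdifferential E w x, h x p ≤ f x) (x₀ : M) :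
    ∃ U : Set M, IsOpen U ∧ x₀ ∈ U ∧ ∀ ε > 0, ∃ φ : M → ℝ, ∀ y ∈ U,
      ContMDiffAt 𝓘(ℝ, E) 𝓘(ℝ, ℝ) 1 φ y ∧ |φ y - w y| ≤ ε ∧
      h y (mvfderiv 𝓘(ℝ, E) φ y) ≤ f y + ε := by
  obtain ⟨r, hr, K, hrt, hK⟩ := exists_lipschitzOnWith_chart (E := E) x₀ ρ
  set z₀ := euclChart E x₀ x₀ with hz₀
  refine ⟨(chartAt E x₀).source ∩ euclChart E x₀ ⁻¹' Metric.ball z₀ (r / 2),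
    (continuousOn_euclChart x₀).isOpen_inter_preimage (chartAt E x₀).open_source Metric.isOpen_ball,
    ⟨mem_chart_source E x₀, Metric.mem_ball_self (by positivity)⟩, fun ε hε => ?_⟩
  have hpc : ContinuousOn (euclParam E x₀) (Metric.ball z₀ r) :=
    (continuousOn_euclParam x₀).mono hrt
  have hG : ContinuousOn (fun a : Model E × (Model E →L[ℝ] ℝ) =>
      h (euclParam E x₀ a.1) (a.2 ∘L euclDeriv E x₀ (euclParam E x₀ a.1)))
      (Metric.ball z₀ r ×ˢ univ) := by
    have h1 : ContinuousOn (fun a : Model E × (Model E →L[ℝ] ℝ) => (euclParam E x₀ a.1, a.2))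
        (Metric.ball z₀ r ×ˢ univ) :=
      (hpc.comp continuousOn_fst fun a ha => ha.1).prodMk continuousOn_snd
    exact (hh.continuous.comp_continuousOn (continuousOn_cotangent_euclDeriv x₀)).comp h1
      fun a ha => ⟨euclParam_mem_source (hrt ha.1), mem_univ _⟩
  have hconv : ∀ z ∈ Metric.ball z₀ r, ConvexOn ℝ univ (fun q : Model E →L[ℝ] ℝ =>
      h (euclParam E x₀ z) (q ∘L euclDeriv E x₀ (euclParam E x₀ z))) := by
    intro z hz
    refine ⟨convex_univ, fun p _ q _ a b ha hb hab => ?_⟩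
    have := (hh.convexOn (euclParam E x₀ z)).2
      (mem_univ (p ∘L euclDeriv E x₀ (euclParam E x₀ z)))
      (mem_univ (q ∘L euclDeriv E x₀ (euclParam E x₀ z))) ha hb hab
    rwa [← ContinuousLinearMap.smul_comp, ← ContinuousLinearMap.smul_comp,
      ← ContinuousLinearMap.add_comp] at this
  have htest : ∀ z ∈ Metric.ball z₀ r, ∀ ψ : Model E → ℝ, ContDiffAt ℝ 1 ψ z →
      IsLocalMax (fun y => (w ∘ euclParam E x₀) y - ψ y) z →
      h (euclParam E x₀ z) (fderiv ℝ ψ z ∘L euclDeriv E x₀ (euclParam E x₀ z)) ≤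
        (f ∘ euclParam E x₀) z := by
    intro z hz ψ hψ hmax
    have hy := euclParam_mem_source (hrt hz)
    have hcp := euclChart_param (hrt hz)
    have := mem_superdifferential_of_chart (w := w) (ψ := ψ) hy (by rwa [hcp])
      (by rw [hcp]; exact hmax)
    have h1 := hsub _ _ this
    rwa [hcp] at h1
  obtain ⟨φ, hφ, hφw⟩ := exists_contDiff_subsolution
    (G := fun z q => h (euclParam E x₀ z) (q ∘L euclDeriv E x₀ (euclParam E x₀ z)))
    (f := f ∘ euclParam E x₀) hr (hK w hw hρ) hG hconv (hf.comp_continuousOn hpc) htest hε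
  refine ⟨fun y => φ (euclChart E x₀ y), fun y hy => ⟨?_, ?_⟩⟩
  · exact contMDiffAt_comp_euclChart hy.1 hφ.contDiffAt
  · have := hφw _ hy.2
    simp only [Function.comp] at this
    rw [euclParam_chart hy.1] at this
    refine ⟨this.1, ?_⟩
    rw [mvfderiv_comp_euclChart hy.1 (hφ.differentiable (by simp)).differentiableAt]
    exact this.2

lemma mvfderiv_fintype_sum {ι : Type*} (s : Finset ι) {φ : ι → M → ℝ} {x : M}
    (hφ : ∀ k ∈ s, ContMDiffAt 𝓘(ℝ, E) 𝓘(ℝ, ℝ) 1 (φ k) x) :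
    mvfderiv 𝓘(ℝ, E) (fun y => ∑ k ∈ s, φ k y) x = ∑ k ∈ s, mvfderiv 𝓘(ℝ, E) (φ k) x := by
  classical
  induction s using Finset.induction_on with
  | empty => simpa using mvfderiv_const (I := 𝓘(ℝ, E)) (0 : ℝ) (x := x)
  | insert k s hk ih =>
    have h1 : ContMDiffAt 𝓘(ℝ, E) 𝓘(ℝ, ℝ) 1 (fun y => ∑ k ∈ s, φ k y) x :=
      ContMDiffAt.sum fun k hks => hφ k (Finset.mem_insert_of_mem hks)
    have h2 := mvfderiv_add ((hφ k (Finset.mem_insert_self _ _)).mdifferentiableAt (by simp))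
      (h1.mdifferentiableAt (by simp))
    rw [Finset.sum_insert hk, ← ih fun k hks => hφ k (Finset.mem_insert_of_mem hks), ← h2]
    refine mvfderiv_congr (Eventually.of_forall fun y => ?_)
    simp [Finset.sum_insert hk]

/-- Regularization: a viscosity subsolution of `h(x, Dw) ≤ f` with `h` convex and coercive is a
uniform limit of `C¹` functions which are subsolutions up to a small error. Local regularizations
are glued with a partition of unity; multiplying by a constant slightly less than `1` makes room for
the error term created by the derivatives of the partition. -/
theorem exists_contMDiff_regularization [T2Space M] [CompactSpace M]
    {h : (x : M) → Cotangent E M x → ℝ} (hh : IsCoerciveConvex h)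
    {w f : M → ℝ} (hw : Continuous w) (hf : Continuous f)
    (hsub : ∀ x, ∀ p ∈ superdifferential E w x, h x p ≤ f x) {ε : ℝ} (hε : 0 < ε) :
    ∃ φ : M → ℝ, ContMDiff 𝓘(ℝ, E) 𝓘(ℝ, ℝ) 1 φ ∧ ∀ x, |φ x - w x| ≤ ε ∧
      h x (mvfderiv 𝓘(ℝ, E) φ x) ≤ f x + ε := by
  obtain ⟨Cf, hCf⟩ : ∃ C, ∀ x, |f x| ≤ C := by
    obtain ⟨C, hC⟩ := (isCompact_range hf.abs).bddAbove
    exact ⟨C, fun x => hC (mem_range_self x)⟩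
  obtain ⟨Cw, hCw⟩ : ∃ C, ∀ x, |w x| ≤ C := by
    obtain ⟨C, hC⟩ := (isCompact_range hw.abs).bddAbove
    exact ⟨C, fun x => hC (mem_range_self x)⟩
  obtain ⟨ρ, hρ⟩ := hh.coercive Cf
  choose U hUo hxU hU using exists_local_regularization hh hw hf
    (fun x p hp => hρ x p ((hsub x p hp).trans ((le_abs_self _).trans (hCf x)))) hsub
  obtain ⟨t, ht⟩ := isCompact_univ.elim_finite_subcover U hUo
    (fun x _ => mem_iUnion.2 ⟨x, hxU x⟩)
  obtain ⟨χ, hχ⟩ := SmoothPartitionOfUnity.exists_isSubordinate 𝓘(ℝ, E) (s := (univ : Set M))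
    isClosed_univ (fun k : t => U k) (fun k => hUo k) (by
      intro x hx
      obtain ⟨k, hk, hxk⟩ := mem_iUnion₂.1 (ht hx)
      exact mem_iUnion.2 ⟨⟨k, hk⟩, hxk⟩)
  have hχ1 : ∀ k, ContMDiff 𝓘(ℝ, E) 𝓘(ℝ, ℝ) 1 (χ k) := fun k => (χ k).contMDiff.of_le (by simp)
  have hχsum : ∀ x, ∑ k, χ k x = 1 := fun x => by
    rw [← finsum_eq_sum_of_fintype]; exact χ.sum_eq_one (mem_univ x)
  choose D hD using fun k => hh.exists_norm_mvfderiv_le (hχ1 k)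
  set S := ∑ k, |D k| with hS
  have hS0 : 0 ≤ S := Finset.sum_nonneg fun k _ => abs_nonneg _
  obtain ⟨C0, hC0⟩ := hh.exists_bound 1
  -- the scaling parameter `τ`, and the precision `δ` of the local regularizations
  obtain ⟨τ, hτ0, hτ1, hτ⟩ : ∃ τ : ℝ, 0 < τ ∧ τ < 1 ∧
      τ * (|Cw| + 1 + |Cf| + |C0|) ≤ ε / 2 := by
    refine ⟨min (1 / 2) (ε / 2 / (|Cw| + 1 + |Cf| + |C0|)), by positivity,
      (min_le_left _ _).trans_lt (by norm_num), ?_⟩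
    calc min (1 / 2) (ε / 2 / (|Cw| + 1 + |Cf| + |C0|)) * (|Cw| + 1 + |Cf| + |C0|)
        ≤ (ε / 2 / (|Cw| + 1 + |Cf| + |C0|)) * (|Cw| + 1 + |Cf| + |C0|) := by
          gcongr; exact min_le_right _ _
      _ = ε / 2 := by field_simp
  obtain ⟨δ, hδ0, hδ1, hδε, hδS⟩ : ∃ δ : ℝ, 0 < δ ∧ δ ≤ 1 ∧ δ ≤ ε / 2 ∧ δ * S ≤ τ := by
    refine ⟨min (min 1 (ε / 2)) (τ / (S + 1)), by positivity,
      (min_le_left _ _).trans (min_le_left _ _), (min_le_left _ _).trans (min_le_right _ _), ?_⟩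
    calc min (min 1 (ε / 2)) (τ / (S + 1)) * S ≤ (τ / (S + 1)) * (S + 1) := by
          gcongr
          · exact min_le_right _ _
          · linarith
      _ = τ := by field_simp
  choose φ hφ using fun k : t => hU k δ hδ0
  have hterm : ∀ k, ContMDiff 𝓘(ℝ, E) 𝓘(ℝ, ℝ) 1 (fun y => χ k y * φ k y) := fun k => by
    refine contMDiff_of_tsupport fun y hy => ?_
    have : y ∈ tsupport (χ k) := closure_mono (fun a ha => by
      simp only [Function.mem_support] at ha ⊢
      exact left_ne_zero_of_mul ha) hy
    exact (hχ1 k).contMDiffAt.mul (hφ k y (hχ k this)).1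
  let Φ : M → ℝ := fun y => ∑ k, χ k y * φ k y
  have hΦ : ContMDiff 𝓘(ℝ, E) 𝓘(ℝ, ℝ) 1 Φ := ContMDiff.sum fun k _ => hterm k
  have hΦw : ∀ x, |Φ x - w x| ≤ δ := fun x => by
    have h1 : Φ x - w x = ∑ k, χ k x * (φ k x - w x) := by
      simp only [Φ, mul_sub, Finset.sum_sub_distrib, ← Finset.sum_mul, hχsum, one_mul]
    rw [h1]
    refine (Finset.abs_sum_le_sum_abs _ _).trans ?_
    calc ∑ k, |χ k x * (φ k x - w x)| ≤ ∑ k, χ k x * δ := by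
          refine Finset.sum_le_sum fun k _ => ?_
          rw [abs_mul, abs_of_nonneg (χ.nonneg k x)]
          rcases eq_or_ne (χ k x) 0 with h0 | h0
          · simp [h0]
          · exact mul_le_mul_of_nonneg_left
              (hφ k x (hχ k (subset_tsupport _ h0))).2.1 (χ.nonneg k x)
      _ = δ := by rw [← Finset.sum_mul, hχsum, one_mul]
  -- the gradient of `Φ` is a convex combination of gradients plus a small error `e`
  have hgrad : ∀ x, ∃ e : Cotangent E M x, ‖e‖ ≤ τ ∧
      mvfderiv 𝓘(ℝ, E) Φ x = (∑ k, χ k x • (mvfderiv 𝓘(ℝ, E) (φ k) x : Cotangent E M x)) + e := by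
    intro x
    have hout : ∀ k, x ∉ tsupport (χ k) → χ k =ᶠ[𝓝 x] fun _ => 0 := fun k hk =>
      notMem_tsupport_iff_eventuallyEq.1 hk
    have hdχ0 : ∀ k, x ∉ tsupport (χ k) →
        (mvfderiv 𝓘(ℝ, E) (χ k) x : Cotangent E M x) = 0 := fun k hk =>
      (mvfderiv_congr (hout k hk)).trans (mvfderiv_const (0 : ℝ))
    have hdsum : ∑ k, (mvfderiv 𝓘(ℝ, E) (χ k) x : Cotangent E M x) = 0 := by
      refine (mvfderiv_fintype_sum Finset.univ fun k _ => (hχ1 k).contMDiffAt).symm.trans ?_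
      refine (mvfderiv_congr (ψ := fun _ => (1 : ℝ))
        (Eventually.of_forall fun y => hχsum y)).trans (mvfderiv_const (1 : ℝ))
    have hd : ∀ k, (mvfderiv 𝓘(ℝ, E) (fun y => χ k y * φ k y) x : Cotangent E M x) =
        χ k x • (mvfderiv 𝓘(ℝ, E) (φ k) x : Cotangent E M x) +
          φ k x • (mvfderiv 𝓘(ℝ, E) (χ k) x : Cotangent E M x) := by
      intro k
      by_cases hk : x ∈ tsupport (χ k)
      · exact mvfderiv_mul ((hχ1 k).contMDiffAt.mdifferentiableAt (by simp))
          ((hφ k x (hχ k hk)).1.mdifferentiableAt (by simp))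
      · have h0 : χ k x = 0 := image_eq_zero_of_notMem_tsupport hk
        rw [hdχ0 k hk, h0, zero_smul, smul_zero, add_zero]
        refine (mvfderiv_congr (ψ := fun _ => (0 : ℝ)) ?_).trans (mvfderiv_const (0 : ℝ))
        filter_upwards [hout k hk] with y hy
        rw [hy, zero_mul]
    refine ⟨∑ k, (φ k x - w x) • (mvfderiv 𝓘(ℝ, E) (χ k) x : Cotangent E M x), ?_, ?_⟩
    · refine (norm_cotangent_sum_le _ _).trans ?_
      refine le_trans ?_ hδS
      rw [hS, Finset.mul_sum]
      refine Finset.sum_le_sum fun k _ => ?_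
      rw [norm_cotangent_smul]
      by_cases hk : x ∈ tsupport (χ k)
      · have h1 := (hφ k x (hχ k hk)).2.1
        have h2 := (hD k x).trans (le_abs_self _)
        exact mul_le_mul h1 h2 (norm_cotangent_nonneg _) hδ0.le
      · rw [hdχ0 k hk, norm_cotangent_zero, mul_zero]
        positivity
    · have h1 : (mvfderiv 𝓘(ℝ, E) Φ x : Cotangent E M x) =
          ∑ k, (mvfderiv 𝓘(ℝ, E) (fun y => χ k y * φ k y) x : Cotangent E M x) :=
        mvfderiv_fintype_sum Finset.univ fun k _ => (hterm k).contMDiffAt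
      rw [h1, Finset.sum_congr rfl fun k _ => hd k, Finset.sum_add_distrib]
      congr 1
      simp only [sub_smul, Finset.sum_sub_distrib, ← Finset.smul_sum, hdsum, smul_zero, sub_zero]
  refine ⟨fun y => (1 - τ) * Φ y, contMDiff_const.mul hΦ, fun x => ⟨?_, ?_⟩⟩
  · have h1 := hΦw x
    have h2 : |(1 - τ) * Φ x - w x| ≤ |Φ x - w x| + τ * (|Cw| + 1) := by
      have h3 : (1 - τ) * Φ x - w x = (Φ x - w x) - τ * Φ x := by ring
      have h4 : |Φ x| ≤ |Cw| + 1 := by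
        have h5 : |Φ x| ≤ |Φ x - w x| + |w x| := by
          have := abs_add_le (Φ x - w x) (w x)
          rwa [sub_add_cancel] at this
        have := (hCw x).trans (le_abs_self _)
        linarith
      rw [h3]
      refine (abs_sub _ _).trans ?_
      rw [abs_mul, abs_of_pos hτ0]
      gcongr
    have h3 : 0 ≤ τ * (|Cf| + |C0|) := by positivity
    nlinarith
  · obtain ⟨e, he, hge⟩ := hgrad x
    set q := ∑ k, χ k x • (mvfderiv 𝓘(ℝ, E) (φ k) x : Cotangent E M x) with hq
    have hqle : h x q ≤ f x + δ := by
      have h1 := (hh.convexOn x).map_sum_le (t := Finset.univ) (w := fun k => χ k x)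
        (p := fun k => (mvfderiv 𝓘(ℝ, E) (φ k) x : Cotangent E M x))
        (fun k _ => χ.nonneg k x) (hχsum x) (fun k _ => mem_univ _)
      refine h1.trans ?_
      calc ∑ k, χ k x • h x (mvfderiv 𝓘(ℝ, E) (φ k) x) ≤ ∑ k, χ k x * (f x + δ) := by
            refine Finset.sum_le_sum fun k _ => ?_
            rcases eq_or_ne (χ k x) 0 with h0 | h0
            · simp [h0]
            · exact mul_le_mul_of_nonneg_left
                (hφ k x (hχ k (subset_tsupport _ h0))).2.2 (χ.nonneg k x)
        _ = f x + δ := by rw [← Finset.sum_mul, hχsum, one_mul]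
    have h1 : (mvfderiv 𝓘(ℝ, E) (fun y => (1 - τ) * Φ y) x : Cotangent E M x) =
        (1 - τ) • q + τ • (((1 - τ) / τ) • e) := by
      have h2 := mvfderiv_mul (I := 𝓘(ℝ, E)) (f := fun _ => 1 - τ) (g := Φ) (x := x)
        (contMDiffAt_const (n := 1).mdifferentiableAt (by simp))
        (hΦ.contMDiffAt.mdifferentiableAt (by simp))
      refine h2.trans ?_
      rw [hge, mvfderiv_const, smul_zero, add_zero, smul_add, smul_smul]
      congr 2
      field_simp
    rw [h1]
    have h2 := (hh.convexOn x).2 (mem_univ q) (mem_univ (((1 - τ) / τ) • e))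
      (sub_nonneg.2 hτ1.le) hτ0.le (by ring)
    refine h2.trans ?_
    have h3 : ‖((1 - τ) / τ) • e‖ ≤ 1 := by
      rw [norm_cotangent_smul, abs_of_nonneg (div_nonneg (sub_nonneg.2 hτ1.le) hτ0.le)]
      calc (1 - τ) / τ * ‖e‖ ≤ (1 - τ) / τ * τ := by
            gcongr
        _ = 1 - τ := by field_simp
        _ ≤ 1 := by linarith
    have h4 := (abs_le.1 (hC0 x _ h3)).2
    have h5 := (abs_le.1 (hCf x)).1
    simp only [smul_eq_mul]
    have h6 : (1 - τ) * h x q ≤ (1 - τ) * (f x + δ) :=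
      mul_le_mul_of_nonneg_left hqle (sub_nonneg.2 hτ1.le)
    have h7 : τ * h x (((1 - τ) / τ) • e) ≤ τ * |C0| :=
      mul_le_mul_of_nonneg_left (h4.trans (le_abs_self _)) hτ0.le
    have h8 : τ * (-f x) ≤ τ * |Cf| :=
      mul_le_mul_of_nonneg_left (by linarith [le_abs_self Cf]) hτ0.le
    have h9 : 0 ≤ τ * (|Cw| + 1) := by positivity
    have h10 : 0 ≤ τ * δ := by positivity
    nlinarith

end Scalar

/-! ### Coupling matrices and stability of semidifferentials -/

section CouplingMatrix

variable {m : ℕ} {B : Matrix (Fin m) (Fin m) ℝ}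

lemma coupling_apply (B : Matrix (Fin m) (Fin m) ℝ) (lam : ℝ) (a : Fin m → ℝ) (i : Fin m) :
    ((B + lam • (1 : Matrix (Fin m) (Fin m) ℝ)) *ᵥ a) i = (B *ᵥ a) i + lam * a i := by
  rw [Matrix.add_mulVec, Matrix.smul_mulVec, Matrix.one_mulVec]; rfl

lemma IsCouplingMatrix.mulVec_eq_sum_sub (hB : IsCouplingMatrix B) (a : Fin m → ℝ) (i : Fin m) :
    (B *ᵥ a) i = ∑ j, B i j * (a j - a i) := by
  simp only [Matrix.mulVec, dotProduct, mul_sub, Finset.sum_sub_distrib, ← Finset.sum_mul,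
    hB.row_sum, zero_mul, sub_zero]

lemma IsCouplingMatrix.mulVec_const (hB : IsCouplingMatrix B) (k : ℝ) (i : Fin m) :
    (B *ᵥ fun _ => k) i = 0 := by
  simp [hB.mulVec_eq_sum_sub]

/-- The maximum principle for coupling matrices. -/
lemma IsCouplingMatrix.mulVec_nonneg_of_max (hB : IsCouplingMatrix B) {a : Fin m → ℝ} {i : Fin m}
    (h : ∀ j, a j ≤ a i) : 0 ≤ (B *ᵥ a) i := by
  rw [hB.mulVec_eq_sum_sub]
  refine Finset.sum_nonneg fun j _ => ?_
  rcases eq_or_ne i j with rfl | hij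
  · simp
  · exact mul_nonneg_of_nonpos_of_nonpos (hB.offDiag_nonpos i j hij) (sub_nonpos.2 (h j))

/-- Increasing the other components decreases `(B a) i`. -/
lemma IsCouplingMatrix.mulVec_anti (hB : IsCouplingMatrix B) {a b : Fin m → ℝ} {i : Fin m}
    (h : ∀ j, a j ≤ b j) (hi : a i = b i) : (B *ᵥ b) i ≤ (B *ᵥ a) i := by
  rw [hB.mulVec_eq_sum_sub, hB.mulVec_eq_sum_sub]
  refine Finset.sum_le_sum fun j _ => ?_
  rcases eq_or_ne i j with rfl | hij
  · simp
  · rw [hi]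
    exact mul_le_mul_of_nonpos_left (by linarith [h j]) (hB.offDiag_nonpos i j hij)

lemma mulVec_sub_le (B : Matrix (Fin m) (Fin m) ℝ) {a b : Fin m → ℝ} {ε : ℝ}
    (h : ∀ j, |a j - b j| ≤ ε) (i : Fin m) :
    |(B *ᵥ a) i - (B *ᵥ b) i| ≤ (∑ i, ∑ j, |B i j|) * ε := by
  have hε : 0 ≤ ε := (abs_nonneg _).trans (h i)
  have h1 : (B *ᵥ a) i - (B *ᵥ b) i = ∑ j, B i j * (a j - b j) := by
    simp only [Matrix.mulVec, dotProduct, mul_sub, Finset.sum_sub_distrib]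
  rw [h1]
  refine (Finset.abs_sum_le_sum_abs _ _).trans ?_
  calc ∑ j, |B i j * (a j - b j)| ≤ ∑ j, |B i j| * ε := by
        refine Finset.sum_le_sum fun j _ => ?_
        rw [abs_mul]
        exact mul_le_mul_of_nonneg_left (h j) (abs_nonneg _)
    _ = (∑ j, |B i j|) * ε := by rw [Finset.sum_mul]
    _ ≤ _ := by
      refine mul_le_mul_of_nonneg_right ?_ hε
      exact Finset.single_le_sum (f := fun i => ∑ j, |B i j|)
        (fun i _ => Finset.sum_nonneg fun j _ => abs_nonneg _) (Finset.mem_univ i)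

/-- An upper bound on `B a` bounds the differences between the components of `a`: starting from a
maximal component, irreducibility lets the bound propagate to all indices. -/
lemma IsCouplingMatrix.exists_abs_sub_le (hB : IsCouplingMatrix B) (C : ℝ) :
    ∃ D, ∀ a : Fin m → ℝ, (∀ i, (B *ᵥ a) i ≤ C) → ∀ i j, |a i - a j| ≤ D := by
  set β := ∑ i, ∑ j, |B i j| with hβ
  set κ := ∑ i, ∑ j, |B i j|⁻¹ with hκ
  have hle : ∀ (f : Fin m → Fin m → ℝ) (_ : ∀ i j, 0 ≤ f i j) (i j),
      f i j ≤ ∑ i, ∑ j, f i j := fun f hf i j =>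
    (Finset.single_le_sum (f := fun j => f i j) (fun j _ => hf i j) (Finset.mem_univ j)).trans
      (Finset.single_le_sum (f := fun i => ∑ j, f i j)
        (fun i _ => Finset.sum_nonneg fun j _ => hf i j) (Finset.mem_univ i))
  have hκ0 : 0 ≤ κ := Finset.sum_nonneg fun i _ => Finset.sum_nonneg fun j _ => by positivity
  have hβ0 : 0 ≤ β := Finset.sum_nonneg fun i _ => Finset.sum_nonneg fun j _ => by positivity
  -- by induction, at least `k` indices are almost maximal; the row of `B` that links such an index
  -- `i` to a new index `j` bounds `a i - a j`
  have key : ∀ k : ℕ, k ≤ m → ∃ D, 0 ≤ D ∧ ∀ a : Fin m → ℝ, (∀ i, (B *ᵥ a) i ≤ C) →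
      ∃ S : Finset (Fin m), k ≤ S.card ∧ ∀ i ∈ S, ∀ j, a j ≤ a i + D := by
    intro k
    induction k with
    | zero => exact fun _ => ⟨0, le_rfl, fun a _ => ⟨∅, by simp⟩⟩
    | succ k ih =>
      intro hk
      obtain ⟨D, hD, hS⟩ := ih (by omega)
      refine ⟨D + κ * (|C| + β * D), by positivity, fun a ha => ?_⟩
      obtain ⟨S, hSk, hSa⟩ := hS a ha
      have hmono : ∀ i ∈ S, ∀ j, a j ≤ a i + (D + κ * (|C| + β * D)) := fun i hi j =>
        (hSa i hi j).trans (by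
          have : 0 ≤ κ * (|C| + β * D) := by positivity
          linarith)
      by_cases hSu : S = Finset.univ
      · exact ⟨S, by rw [hSu]; simpa using hk, hmono⟩
      rcases S.eq_empty_or_nonempty with rfl | hne
      · -- the first index is a maximal one
        have : Nonempty (Fin m) := ⟨⟨k, by omega⟩⟩
        obtain ⟨i, hi⟩ := Finite.exists_max a
        have hk0 : k = 0 := by simpa using hSk
        refine ⟨{i}, by simp [hk0], fun i' hi' j => ?_⟩
        rw [Finset.mem_singleton.1 hi']
        have : 0 ≤ D + κ * (|C| + β * D) := by positivity
        linarith [hi j]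
      · obtain ⟨i, hi, j, hj, hij⟩ := hB.irreducible (S : Set (Fin m)) (by simpa using hne)
          (by simpa [Finset.coe_eq_univ] using hSu)
        have hiS : i ∈ S := by simpa using hi
        have hjS : j ∉ S := by simpa using hj
        have hne' : i ≠ j := fun h => hjS (h ▸ hiS)
        have hbpos : 0 < |B i j| := abs_pos.2 hij
        have hbneg : B i j = -|B i j| := by
          rw [abs_of_nonpos (hB.offDiag_nonpos i j hne'), neg_neg]
        have h1 := ha i
        rw [hB.mulVec_eq_sum_sub, ← Finset.add_sum_erase _ _ (Finset.mem_univ j)] at h1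
        have h2 : -(β * D) ≤ ∑ l ∈ Finset.univ.erase j, B i l * (a l - a i) := by
          have h3 : ∑ l ∈ Finset.univ.erase j, |B i l| ≤ β :=
            (Finset.sum_le_sum_of_subset_of_nonneg (Finset.erase_subset _ _)
              (fun _ _ _ => abs_nonneg _)).trans
              (Finset.single_le_sum (f := fun i => ∑ j, |B i j|)
                (fun i _ => Finset.sum_nonneg fun j _ => abs_nonneg _) (Finset.mem_univ i))
          have h4 : -((∑ l ∈ Finset.univ.erase j, |B i l|) * D) ≤
              ∑ l ∈ Finset.univ.erase j, B i l * (a l - a i) := by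
            rw [Finset.sum_mul, ← Finset.sum_neg_distrib]
            refine Finset.sum_le_sum fun l _ => ?_
            rcases eq_or_ne i l with rfl | hil
            · simp only [sub_self, mul_zero]
              have : 0 ≤ |B i i| * D := by positivity
              linarith
            · have hbn := hB.offDiag_nonpos i l hil
              rw [abs_of_nonpos hbn]
              have : a l - a i ≤ D := by linarith [hSa i hiS l]
              nlinarith
          have h5 := mul_le_mul_of_nonneg_right h3 hD
          linarith
        have h6 : |B i j| * (a i - a j) ≤ |C| + β * D := by
          have h7 : B i j * (a j - a i) = |B i j| * (a i - a j) := by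
            rw [hbneg, abs_neg, abs_abs]; ring
          have := le_abs_self C
          linarith
        have h8 : a i - a j ≤ κ * (|C| + β * D) := by
          calc a i - a j = |B i j|⁻¹ * (|B i j| * (a i - a j)) := by field_simp
            _ ≤ |B i j|⁻¹ * (|C| + β * D) := by gcongr
            _ ≤ κ * (|C| + β * D) := by
              gcongr
              exact hle (fun i j => |B i j|⁻¹) (fun i j => by positivity) i j
        refine ⟨insert j S, by rw [Finset.card_insert_of_notMem hjS]; omega, fun l hl l' => ?_⟩
        rcases Finset.mem_insert.1 hl with rfl | hl
        · linarith [hSa i hiS l']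
        · exact hmono l hl l'
  obtain ⟨D, hD, h⟩ := key m le_rfl
  refine ⟨D, fun a ha i j => ?_⟩
  obtain ⟨S, hS, hSa⟩ := h a ha
  have hSu : S = Finset.univ := by
    rw [← Finset.card_eq_iff_eq_univ, Fintype.card_fin]
    exact le_antisymm (by simpa using S.card_le_univ) hS
  have h1 := hSa i (by simp [hSu]) j
  have h2 := hSa j (by simp [hSu]) i
  exact abs_le.2 ⟨by linarith, by linarith⟩

end CouplingMatrix

section Viscosity

variable {E : Type*} [NormedAddCommGroup E] [NormedSpace ℝ E] [FiniteDimensional ℝ E]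
  {M : Type*} [TopologicalSpace M] [T2Space M] [CompactSpace M]
  [ChartedSpace E M] [IsManifold 𝓘(ℝ, E) ∞ M]

/-- If `F n → u` uniformly and `θ` touches `u` strictly from below at `x₀`, then there are minimum
points of `F n - θ` that tend to `x₀`. -/
lemma exists_tendsto_min {ι : Type*} {l : Filter ι} {F : ι → M → ℝ} {u θ : M → ℝ} {x₀ : M}
    (hF : ∀ n, Continuous (F n)) (hu : Continuous u) (hFu : TendstoUniformly F u l)
    (hθ : Continuous θ) (h0 : θ x₀ = u x₀) (hlt : ∀ y, y ≠ x₀ → θ y < u y) :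
    ∃ x : ι → M, Tendsto x l (𝓝 x₀) ∧ ∀ n y, F n (x n) - θ (x n) ≤ F n y - θ y := by
  have hmin : ∀ n, ∃ x, ∀ y, F n x - θ x ≤ F n y - θ y := fun n => by
    obtain ⟨x, -, hx⟩ := isCompact_univ.exists_isMinOn ⟨x₀, mem_univ _⟩
      ((hF n).sub hθ).continuousOn
    exact ⟨x, fun y => hx (mem_univ y)⟩
  choose x hx using hmin
  refine ⟨x, ?_, hx⟩
  rw [tendsto_nhds]
  intro U hU hxU
  rcases Uᶜ.eq_empty_or_nonempty with he | hne
  · rw [compl_empty_iff] at he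
    simp [he]
  obtain ⟨y₀, hy₀, hmin⟩ := hU.isClosed_compl.isCompact.exists_isMinOn hne
    (hu.sub hθ).continuousOn
  have hδ : 0 < u y₀ - θ y₀ := sub_pos.2 (hlt y₀ fun h => hy₀ (h ▸ hxU))
  filter_upwards [Metric.tendstoUniformly_iff.1 hFu ((u y₀ - θ y₀) / 2) (by positivity)] with n hn
  by_contra hcon
  have h1 : u y₀ - θ y₀ ≤ u (x n) - θ (x n) := hmin hcon
  have h2 := hx n x₀
  have h3 := abs_lt.1 (hn (x n))
  have h4 := abs_lt.1 (hn x₀)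
  linarith [h3.2, h4.1]

/-- Subdifferentials are stable under uniform convergence. -/
lemma exists_tendsto_subdifferential {ι : Type*} {l : Filter ι} {F : ι → M → ℝ} {u : M → ℝ}
    (hF : ∀ n, Continuous (F n)) (hu : Continuous u) (hFu : TendstoUniformly F u l)
    {x₀ : M} {p : Cotangent E M x₀} (hp : p ∈ subdifferential E u x₀) :
    ∃ (θ : M → ℝ) (x : ι → M), ContMDiff 𝓘(ℝ, E) 𝓘(ℝ, ℝ) 1 θ ∧ mvfderiv 𝓘(ℝ, E) θ x₀ = p ∧
      Tendsto x l (𝓝 x₀) ∧ ∀ n, mvfderiv 𝓘(ℝ, E) θ (x n) ∈ subdifferential E (F n) (x n) := by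
  obtain ⟨ψ, hψ, hmin, rfl⟩ := hp
  obtain ⟨θ, hθ, h0, hlt, hd⟩ := exists_global_touching hu hψ hmin
  obtain ⟨x, hx, hxmin⟩ := exists_tendsto_min hF hu hFu hθ.continuous h0 hlt
  exact ⟨θ, x, hθ, hd, hx, fun n => ⟨θ, hθ.contMDiffAt, Eventually.of_forall (hxmin n), rfl⟩⟩

/-- Superdifferentials are stable under uniform convergence. -/
lemma exists_tendsto_superdifferential {ι : Type*} {l : Filter ι} {F : ι → M → ℝ} {u : M → ℝ}
    (hF : ∀ n, Continuous (F n)) (hu : Continuous u) (hFu : TendstoUniformly F u l)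
    {x₀ : M} {p : Cotangent E M x₀} (hp : p ∈ superdifferential E u x₀) :
    ∃ (θ : M → ℝ) (x : ι → M), ContMDiff 𝓘(ℝ, E) 𝓘(ℝ, ℝ) 1 θ ∧ mvfderiv 𝓘(ℝ, E) θ x₀ = p ∧
      Tendsto x l (𝓝 x₀) ∧ ∀ n, mvfderiv 𝓘(ℝ, E) θ (x n) ∈ superdifferential E (F n) (x n) := by
  obtain ⟨ψ, hψ, hmax, rfl⟩ := hp
  obtain ⟨θ, hθ, h0, hlt, hd⟩ := exists_global_touching_above hu hψ hmax
  have hneg : TendstoUniformly (fun n y => - F n y) (fun y => - u y) l := by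
    rw [Metric.tendstoUniformly_iff] at hFu ⊢
    simpa [dist_neg_neg] using hFu
  obtain ⟨x, hx, hxmin⟩ := exists_tendsto_min (θ := fun y => - θ y) (fun n => (hF n).neg) hu.neg
    hneg hθ.continuous.neg (by simp [h0]) (fun y hy => neg_lt_neg (hlt y hy))
  refine ⟨θ, x, hθ, hd, hx, fun n => ⟨θ, hθ.contMDiffAt, Eventually.of_forall fun y => ?_, rfl⟩⟩
  have h1 := hxmin n y
  simp only [Pi.neg_apply] at h1
  linarith

/-- Points with nonempty superdifferential are dense: they include the maximum points of `w - A g`,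
which lie close to `x₀` when `g` vanishes only at `x₀` and `A` is large. -/
lemma exists_superdifferential_nonempty {w : M → ℝ} (hw : Continuous w) {U : Set M}
    (hU : IsOpen U) {x₀ : M} (hx₀ : x₀ ∈ U) : ∃ y ∈ U, (superdifferential E w y).Nonempty := by
  obtain ⟨g, hg, hg0, hgpos⟩ := exists_contMDiff_vanishing_at (E := E) x₀
  have hg1 : ContMDiff 𝓘(ℝ, E) 𝓘(ℝ, ℝ) 1 g := hg.of_le (by simp)
  obtain ⟨C, hC⟩ : ∃ C, ∀ x, |w x| ≤ C := by
    obtain ⟨C, hC⟩ := (isCompact_range hw.abs).bddAbove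
    exact ⟨C, fun x => hC (mem_range_self x)⟩
  obtain ⟨δ, hδ, hδU⟩ : ∃ δ > 0, ∀ y ∉ U, δ ≤ g y := by
    rcases Uᶜ.eq_empty_or_nonempty with he | hne
    · exact ⟨1, one_pos, fun y hy => by
        have : y ∈ Uᶜ := hy
        rw [he] at this; exact this.elim⟩
    · obtain ⟨y₀, hy₀, hmin⟩ := hU.isClosed_compl.isCompact.exists_isMinOn hne
        hg1.continuous.continuousOn
      exact ⟨g y₀, hgpos y₀ fun h => hy₀ (h ▸ hx₀), fun y hy => hmin hy⟩
  set A := (2 * C + 1) / δ with hA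
  have hθ : ContMDiff 𝓘(ℝ, E) 𝓘(ℝ, ℝ) 1 (fun y => A * g y) := contMDiff_const.mul hg1
  obtain ⟨y, -, hy⟩ := isCompact_univ.exists_isMaxOn ⟨x₀, mem_univ _⟩
    (hw.sub hθ.continuous).continuousOn
  refine ⟨y, ?_, _, fun y => A * g y, hθ.contMDiffAt,
    Eventually.of_forall fun z => hy (mem_univ z), rfl⟩
  by_contra hcon
  have h1 : w x₀ - A * g x₀ ≤ w y - A * g y := hy (mem_univ x₀)
  have hC0 : 0 ≤ C := (abs_nonneg _).trans (hC x₀)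
  have h2 : A * δ ≤ A * g y := by
    have : 0 ≤ A := by positivity
    exact mul_le_mul_of_nonneg_left (hδU y hcon) this
  have h3 : A * δ = 2 * C + 1 := by rw [hA]; field_simp
  have h4 := (abs_le.1 (hC x₀)).1
  have h5 := (abs_le.1 (hC y)).2
  rw [hg0] at h1
  linarith

end Viscosity

/-! ### Comparison, stability and compactness -/

section Compactness

variable {M : Type*} [TopologicalSpace M] [CompactSpace M] {m : ℕ}

/-- The Arzelà–Ascoli theorem. -/
lemma isCompact_closure_of_equicontinuous {S : Set C(M, Fin m → ℝ)}
    (hS : Equicontinuous (fun (w : S) x => (w : C(M, Fin m → ℝ)) x)) {C : ℝ}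
    (hC : ∀ w ∈ S, ∀ x i, |w x i| ≤ C) : IsCompact (closure S) := by
  let e := ContinuousMap.isometryEquivBoundedOfCompact M (Fin m → ℝ)
  have h := BoundedContinuousFunction.arzela_ascoli (Metric.closedBall (0 : Fin m → ℝ) |C|)
    (isCompact_closedBall _ _) (e '' S) (by
      rintro _ x ⟨w, hw, rfl⟩
      rw [mem_closedBall_zero_iff, pi_norm_le_iff_of_nonneg (abs_nonneg _)]
      exact fun i => (hC w hw x i).trans (le_abs_self _)) (by
      intro x V hV
      filter_upwards [hS x V hV] with y hy
      rintro ⟨_, w, hw, rfl⟩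
      exact hy ⟨w, hw⟩)
  have h2 := h.image e.symm.continuous
  have h3 : e.symm '' closure (e '' S) = closure S := by
    have : closure (e '' S) = e '' closure S := (e.toHomeomorph.image_closure S).symm
    rw [this, ← image_comp]
    simp
  rwa [h3] at h2

/-- On a compact connected space, the functions of an equicontinuous family have uniformly bounded
oscillation. -/
lemma exists_oscillation_bound [ConnectedSpace M] {S : Set C(M, Fin m → ℝ)}
    (hS : Equicontinuous (fun (w : S) x => (w : C(M, Fin m → ℝ)) x)) (x₀ : M) :
    ∃ D, ∀ w ∈ S, ∀ x i, |w x i - w x₀ i| ≤ D := by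
  have hloc : ∀ x, ∀ᶠ y in 𝓝 x, ∀ w ∈ S, ∀ i, |w x i - w y i| < 1 := fun x => by
    have := Metric.equicontinuousAt_iff_right.1 (hS x) 1 one_pos
    filter_upwards [this] with y hy w hw i
    exact (dist_le_pi_dist (w x) (w y) i).trans_lt (hy ⟨w, hw⟩)
  let P : Set M → Prop := fun s => ∃ D, ∀ y ∈ s, ∀ w ∈ S, ∀ i, |w y i - w x₀ i| ≤ D
  have hnhds : ∀ x, P {x} → ∃ t ∈ 𝓝 x, P t := by
    rintro x ⟨D, hD⟩
    refine ⟨_, hloc x, D + 1, fun y hy w hw i => ?_⟩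
    have h1 := hD x rfl w hw i
    have h2 := hy w hw i
    calc |w y i - w x₀ i| ≤ |w x i - w y i| + |w x i - w x₀ i| := by
          rw [abs_sub_comm (w x i) (w y i)]; exact abs_sub_le _ _ _
      _ ≤ D + 1 := by linarith
  have hclopen : IsClopen {x | P {x}} := by
    constructor
    · refine ⟨isOpen_iff_mem_nhds.2 fun x hx => ?_⟩
      filter_upwards [hloc x] with y hy
      rintro ⟨D, hD⟩
      refine hx ⟨D + 1, fun z hz w hw i => ?_⟩
      have h1 := hD y rfl w hw i
      have h2 := hy w hw i
      have := abs_sub_le (w x i) (w y i) (w x₀ i)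
      rw [mem_singleton_iff.1 hz]
      linarith
    · refine isOpen_iff_mem_nhds.2 fun x hx => ?_
      obtain ⟨t, ht, D, hD⟩ := hnhds x hx
      filter_upwards [ht] with y hy
      exact ⟨D, by rintro _ rfl; exact hD _ hy⟩
  have huniv : {x | P {x}} = univ := hclopen.eq_univ ⟨x₀, 0, by rintro _ rfl; simp⟩
  have hP : P univ := by
    refine isCompact_univ.induction_on (p := P) ⟨0, by simp⟩
      (fun s t hst ⟨D, hD⟩ => ⟨D, fun y hy => hD y (hst hy)⟩) ?_ ?_
    · rintro s t ⟨D, hD⟩ ⟨D', hD'⟩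
      refine ⟨max D D', fun y hy w hw i => ?_⟩
      rcases hy with hy | hy
      · exact (hD y hy w hw i).trans (le_max_left _ _)
      · exact (hD' y hy w hw i).trans (le_max_right _ _)
    · intro x _
      have : x ∈ {x | P {x}} := huniv ▸ mem_univ x
      obtain ⟨t, ht, hPt⟩ := hnhds x this
      exact ⟨t, mem_nhdsWithin_of_mem_nhds ht, hPt⟩
  obtain ⟨D, hD⟩ := hP
  exact ⟨D, fun w hw x i => hD x (mem_univ x) w hw i⟩

end Compactness

section Systems

variable {E : Type*} [NormedAddCommGroup E] [NormedSpace ℝ E] [FiniteDimensional ℝ E]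
  {M : Type*} [TopologicalSpace M] [T2Space M] [CompactSpace M]
  [ChartedSpace E M] [IsManifold 𝓘(ℝ, E) ∞ M] {m : ℕ}
  {B : Matrix (Fin m) (Fin m) ℝ} {H : Hamiltonian E M m} {lam c c' : ℝ}

lemma continuous_component (u : C(M, Fin m → ℝ)) (i : Fin m) : Continuous fun y => u y i :=
  (continuous_apply i).comp u.continuous

lemma continuous_mulVec (B : Matrix (Fin m) (Fin m) ℝ) (u : C(M, Fin m → ℝ)) (i : Fin m) :
    Continuous fun y => (B *ᵥ u y) i := by
  simp only [Matrix.mulVec, dotProduct]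
  exact continuous_finsetSum _ fun j _ => continuous_const.mul (continuous_component u j)

lemma isSubsolution_iff {u : C(M, Fin m → ℝ)} : IsSubsolution B lam H c u ↔
    ∀ x i, ∀ p ∈ superdifferential E (fun y => u y i) x,
      H i x p + ((B *ᵥ u x) i + lam * u x i) ≤ c := by
  simp only [IsSubsolution, coupling_apply]

lemma isSupersolution_iff {u : C(M, Fin m → ℝ)} : IsSupersolution B lam H c u ↔
    ∀ x i, ∀ p ∈ subdifferential E (fun y => u y i) x,
      c ≤ H i x p + ((B *ᵥ u x) i + lam * u x i) := by
  simp only [IsSupersolution, coupling_apply]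

/-- A continuous finite family of functions attains its maximum. -/
lemma exists_max_component [Nonempty M] (hm : 0 < m) {a : Fin m → M → ℝ}
    (ha : ∀ i, Continuous (a i)) :
    ∃ i x, ∀ j y, a j y ≤ a i x := by
  have : Nonempty (Fin m) := ⟨⟨0, hm⟩⟩
  have h1 : ∀ i, ∃ x, ∀ y, a i y ≤ a i x := fun i => by
    obtain ⟨x, -, hx⟩ := isCompact_univ.exists_isMaxOn univ_nonempty (ha i).continuousOn
    exact ⟨x, fun y => hx (mem_univ y)⟩
  choose x hx using h1
  obtain ⟨i, hi⟩ := Finite.exists_max fun i => a i (x i)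
  exact ⟨i, x i, fun j y => (hx j y).trans (hi j)⟩

/-- Comparison of a `C¹` subsolution with a viscosity supersolution: at a maximum point of the
difference the former is a test function for the latter. -/
lemma IsSupersolution.comparison_contMDiff (hB : IsCouplingMatrix B)
    {v : C(M, Fin m → ℝ)} (hv : IsSupersolution B lam H c' v) (hlam : 0 ≤ lam)
    {φ : Fin m → M → ℝ} (hφ : ∀ i, ContMDiff 𝓘(ℝ, E) 𝓘(ℝ, ℝ) 1 (φ i))
    (hsub : ∀ x i, mvfderiv 𝓘(ℝ, E) (φ i) x ∈ subdifferential E (fun y => v y i) x →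
      H i x (mvfderiv 𝓘(ℝ, E) (φ i) x) + ((B *ᵥ fun j => φ j x) i + lam * φ i x) ≤ c)
    (x : M) (i : Fin m) :
    lam * (φ i x - v x i) ≤ c - c' := by
  have : Nonempty M := ⟨x⟩
  obtain ⟨k, y, hk⟩ := exists_max_component (a := fun i y => φ i y - v y i) i.pos
    fun i => (hφ i).continuous.sub (continuous_component v i)
  have hmem : mvfderiv 𝓘(ℝ, E) (φ k) y ∈ subdifferential E (fun y => v y k) y :=
    ⟨φ k, (hφ k).contMDiffAt, Eventually.of_forall fun z => by linarith [hk k z], rfl⟩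
  have h1 := isSupersolution_iff.1 hv y k _ hmem
  have h2 := hsub y k hmem
  have h3 : 0 ≤ (B *ᵥ fun j => φ j y - v y j) k := hB.mulVec_nonneg_of_max fun j => hk j y
  have h4 : (B *ᵥ fun j => φ j y - v y j) k = (B *ᵥ fun j => φ j y) k - (B *ᵥ v y) k := by
    simp only [Matrix.mulVec, dotProduct, mul_sub, Finset.sum_sub_distrib]
  have h5 := mul_le_mul_of_nonneg_left (hk i x) hlam
  nlinarith

lemma superdifferential_const {k : ℝ} {x : M} {p : Cotangent E M x}
    (hp : p ∈ superdifferential E (fun _ => k) x) : p = 0 :=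
  (eq_mvfderiv_of_mem_superdifferential contMDiffAt_const hp).trans (mvfderiv_const k)

lemma zero_mem_superdifferential_of_isLocalMax {w : M → ℝ} {x : M} (h : IsLocalMax w x) :
    (0 : Cotangent E M x) ∈ superdifferential E w x :=
  ⟨fun _ => 0, contMDiffAt_const, by simpa using h, mvfderiv_const 0⟩

lemma isSubsolution_const (hB : IsCouplingMatrix B) {k : ℝ} (hk : ∀ x i, H i x 0 + lam * k ≤ c) :
    IsSubsolution B lam H c (ContinuousMap.const M fun _ => k) := by
  rw [isSubsolution_iff]
  intro x i p hp
  rw [superdifferential_const hp]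
  have := hB.mulVec_const k i
  have h := hk x i
  simp only [ContinuousMap.const_apply]
  rw [this]
  linarith

/-- The componentwise maximum of two subsolutions is a subsolution. -/
lemma IsSubsolution.componentwise_max (hB : IsCouplingMatrix B) {u v w : C(M, Fin m → ℝ)}
    (hu : IsSubsolution B lam H c u) (hv : IsSubsolution B lam H c v)
    (hw : ∀ x i, w x i = max (u x i) (v x i)) : IsSubsolution B lam H c w := by
  rw [isSubsolution_iff] at *
  intro x i p hp
  rcases le_total (u x i) (v x i) with h | h
  · have hwx : w x i = v x i := by rw [hw, max_eq_right h]
    have h1 := hv x i p (superdifferential_mono (f := fun y => v y i) (g := fun y => w y i)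
      (Eventually.of_forall fun y => by rw [hw]; exact le_max_right _ _) hwx.symm hp)
    have h2 := hB.mulVec_anti (a := v x) (b := w x) (i := i)
      (fun j => by rw [hw]; exact le_max_right _ _) hwx.symm
    rw [hwx]; linarith
  · have hwx : w x i = u x i := by rw [hw, max_eq_left h]
    have h1 := hu x i p (superdifferential_mono (f := fun y => u y i) (g := fun y => w y i)
      (Eventually.of_forall fun y => by rw [hw]; exact le_max_left _ _) hwx.symm hp)
    have h2 := hB.mulVec_anti (a := u x) (b := w x) (i := i)
      (fun j => by rw [hw]; exact le_max_left _ _) hwx.symm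
    rw [hwx]; linarith

/-- Subtracting a constant shifts the right-hand side, because the rows of `B` have sum zero. -/
lemma IsSolution.sub_const (hB : IsCouplingMatrix B) {u v : C(M, Fin m → ℝ)}
    (hu : IsSolution B lam H c u) {k : ℝ} (hv : ∀ x i, v x i = u x i - k) :
    IsSolution B lam H (c - lam * k) v := by
  have hBv : ∀ x i, (B *ᵥ v x) i = (B *ᵥ u x) i := fun x i => by
    rw [hB.mulVec_eq_sum_sub, hB.mulVec_eq_sum_sub]
    refine Finset.sum_congr rfl fun j _ => ?_
    rw [hv, hv]; ring
  refine ⟨isSubsolution_iff.2 fun x i p hp => ?_, isSupersolution_iff.2 fun x i p hp => ?_⟩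
  · obtain ⟨φ, hφ, hmax, hd⟩ := hp
    have h1 := isSubsolution_iff.1 hu.1 x i p ⟨φ, hφ, by
      filter_upwards [hmax] with y hy
      rw [hv, hv] at hy; linarith, hd⟩
    rw [hBv, hv]; linarith
  · obtain ⟨φ, hφ, hmin, hd⟩ := hp
    have h1 := isSupersolution_iff.1 hu.2 x i p ⟨φ, hφ, by
      filter_upwards [hmin] with y hy
      rw [hv, hv] at hy; linarith, hd⟩
    rw [hBv, hv]; linarith

variable [Bundle.RiemannianBundle (fun x : M => TangentSpace 𝓘(ℝ, E) x)]

section Stability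

variable {ι : Type*} {l : Filter ι} {lams cs : ι → ℝ} {ws : ι → C(M, Fin m → ℝ)}
  {w : C(M, Fin m → ℝ)}

lemma tendstoUniformly_component (hw : Tendsto ws l (𝓝 w)) (i : Fin m) :
    TendstoUniformly (fun n y => ws n y i) (fun y => w y i) l := by
  have h := ContinuousMap.tendsto_iff_tendstoUniformly.1 hw
  rw [Metric.tendstoUniformly_iff] at h ⊢
  intro ε hε
  filter_upwards [h ε hε] with n hn y
  exact (dist_le_pi_dist (w y) (ws n y) i).trans_lt (hn y)

lemma tendsto_coupling (hlam : Tendsto lams l (𝓝 lam)) (hw : Tendsto ws l (𝓝 w)) {xs : ι → M}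
    {x : M} (hx : Tendsto xs l (𝓝 x)) (i : Fin m) :
    Tendsto (fun n => (B *ᵥ ws n (xs n)) i + lams n * ws n (xs n) i) l
      (𝓝 ((B *ᵥ w x) i + lam * w x i)) := by
  have h : ∀ j, Tendsto (fun n => ws n (xs n) j) l (𝓝 (w x j)) := fun j =>
    (tendstoUniformly_component hw j).tendsto_comp (continuous_component w j).continuousAt hx
  refine Tendsto.add ?_ (hlam.mul (h i))
  simp only [Matrix.mulVec, dotProduct]
  exact tendsto_finsetSum _ fun j _ => tendsto_const_nhds.mul (h j)

/-- Stability of viscosity subsolutions under uniform convergence. -/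
lemma IsSubsolution.of_tendsto [l.NeBot] (hH : ∀ i, IsCoerciveConvex (H i))
    (hlam : Tendsto lams l (𝓝 lam)) (hc : Tendsto cs l (𝓝 c)) (hw : Tendsto ws l (𝓝 w))
    (hsub : ∀ᶠ n in l, IsSubsolution B (lams n) H (cs n) (ws n)) : IsSubsolution B lam H c w := by
  rw [isSubsolution_iff]
  intro x i p hp
  obtain ⟨θ, xs, hθ, rfl, hxs, hmem⟩ := exists_tendsto_superdifferential
    (fun n => continuous_component (ws n) i) (continuous_component w i)
    (tendstoUniformly_component hw i) hp
  have h1 : Tendsto (fun n => H i (xs n) (mvfderiv 𝓘(ℝ, E) θ (xs n))) l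
      (𝓝 (H i x (mvfderiv 𝓘(ℝ, E) θ x))) :=
    (((hH i).continuous_mvfderiv hθ).tendsto x).comp hxs
  refine le_of_tendsto_of_tendsto (h1.add (tendsto_coupling hlam hw hxs i)) hc ?_
  filter_upwards [hsub] with n hn
  exact isSubsolution_iff.1 hn (xs n) i _ (hmem n)

/-- Stability of viscosity supersolutions under uniform convergence. -/
lemma IsSupersolution.of_tendsto [l.NeBot] (hH : ∀ i, IsCoerciveConvex (H i))
    (hlam : Tendsto lams l (𝓝 lam)) (hc : Tendsto cs l (𝓝 c)) (hw : Tendsto ws l (𝓝 w))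
    (hsup : ∀ᶠ n in l, IsSupersolution B (lams n) H (cs n) (ws n)) :
    IsSupersolution B lam H c w := by
  rw [isSupersolution_iff]
  intro x i p hp
  obtain ⟨θ, xs, hθ, rfl, hxs, hmem⟩ := exists_tendsto_subdifferential
    (fun n => continuous_component (ws n) i) (continuous_component w i)
    (tendstoUniformly_component hw i) hp
  have h1 : Tendsto (fun n => H i (xs n) (mvfderiv 𝓘(ℝ, E) θ (xs n))) l
      (𝓝 (H i x (mvfderiv 𝓘(ℝ, E) θ x))) :=
    (((hH i).continuous_mvfderiv hθ).tendsto x).comp hxs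
  refine le_of_tendsto_of_tendsto hc (h1.add (tendsto_coupling hlam hw hxs i)) ?_
  filter_upwards [hsup] with n hn
  exact isSupersolution_iff.1 hn (xs n) i _ (hmem n)

end Stability

/-- The superdifferentials of subsolutions with a lower bound on `lam • u` are uniformly bounded: the
lower bound on `H` bounds `B u` from above on a dense set, hence everywhere; irreducibility then
bounds `B u` from below, and coercivity applies. -/
lemma exists_superdifferential_bound (hB : IsCouplingMatrix B)
    (hH : ∀ i, IsCoerciveConvex (H i)) (C : ℝ) :
    ∃ D ρ, ∀ lam c, ∀ u : C(M, Fin m → ℝ), IsSubsolution B lam H c u → c ≤ C →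
      (∀ x i, -C ≤ lam * u x i) → (∀ x i j, |u x i - u x j| ≤ D) ∧
      ∀ x i, ∀ p ∈ superdifferential E (fun y => u y i) x, ‖p‖ ≤ ρ := by
  choose A hA using fun i => (hH i).exists_lower_bound
  set A' := ∑ i, |A i|
  have hAA' : ∀ i, A i ≤ A' := fun i => (le_abs_self _).trans
    (Finset.single_le_sum (f := fun i => |A i|) (fun i _ => abs_nonneg _) (Finset.mem_univ i))
  obtain ⟨D, hD⟩ := hB.exists_abs_sub_le (2 * C + A')
  set β := ∑ i, ∑ j, |B i j|
  choose ρ hρ using fun i => (hH i).coercive (2 * C + β * D)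
  refine ⟨D, ∑ i, |ρ i|, fun lam c u hu hc hlam => ?_⟩
  rw [isSubsolution_iff] at hu
  have hBu : ∀ x i, (B *ᵥ u x) i ≤ 2 * C + A' := by
    intro x i
    by_contra hcon
    have hopen : IsOpen {y | 2 * C + A' < (B *ᵥ u y) i} :=
      isOpen_lt continuous_const (continuous_mulVec B u i)
    obtain ⟨y, hy, p, hp⟩ := exists_superdifferential_nonempty (E := E)
      (continuous_component u i) hopen (not_le.1 hcon)
    have h1 := hu y i p hp
    have h2 := hA i y p
    have h3 := hlam y i
    have h4 := hAA' i
    simp only [mem_ofPred_eq] at hy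
    linarith
  have hdiff : ∀ x i j, |u x i - u x j| ≤ D := fun x => hD (u x) (hBu x)
  refine ⟨hdiff, fun x i p hp => ?_⟩
  have h1 := hu x i p hp
  have h2 := hlam x i
  have h3 : -(β * D) ≤ (B *ᵥ u x) i := by
    have := mulVec_sub_le B (a := u x) (b := fun _ => u x i) (fun j => hdiff x j i) i
    rw [hB.mulVec_const, sub_zero] at this
    exact (abs_le.1 this).1
  refine (hρ i x p (by linarith)).trans ((le_abs_self _).trans ?_)
  exact Finset.single_le_sum (f := fun i => |ρ i|) (fun i _ => abs_nonneg _) (Finset.mem_univ i)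

variable [IsContinuousRiemannianBundle E (fun x : M => TangentSpace 𝓘(ℝ, E) x)]

/-- A family of functions with uniformly bounded superdifferentials is equicontinuous. -/
lemma equicontinuous_of_superdifferential_bound {S : Set C(M, Fin m → ℝ)} {ρ : ℝ}
    (hS : ∀ u ∈ S, ∀ x i, ∀ p ∈ superdifferential E (fun y => u y i) x, ‖p‖ ≤ ρ) :
    Equicontinuous (fun (w : S) x => (w : C(M, Fin m → ℝ)) x) := by
  intro x₀
  rw [Metric.equicontinuousAt_iff_right]
  intro ε hε
  obtain ⟨r, hr, K, hrt, hK⟩ := exists_lipschitzOnWith_chart (E := E) x₀ ρ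
  have hs := (chartAt E x₀).open_source.mem_nhds (mem_chart_source E x₀)
  have hc : ContinuousAt (euclChart E x₀) x₀ := (continuousOn_euclChart x₀).continuousAt hs
  have hδ : 0 < min r (ε / (2 * (K + 1))) := by positivity
  filter_upwards [hs, hc.eventually (Metric.ball_mem_nhds _ hδ)] with y hy hyr
  rintro ⟨u, hu⟩
  refine lt_of_le_of_lt ((dist_pi_le_iff (by positivity : 0 ≤ ε / 2)).2 fun i => ?_) (half_lt_self hε)
  have h1 := (hK (fun y => u y i) (continuous_component u i) (fun x => hS u hu x i)).dist_le_mul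
    _ (Metric.mem_ball_self hr) _ (Metric.ball_subset_ball (min_le_left _ _) hyr)
  simp only [Function.comp, euclParam_chart hy, euclParam_chart (mem_chart_source E x₀)] at h1
  refine h1.trans ?_
  have h2 : dist (euclChart E x₀ x₀) (euclChart E x₀ y) ≤ ε / (2 * (K + 1)) := by
    rw [dist_comm]
    exact (Metric.mem_ball.1 hyr).le.trans (min_le_right _ _)
  calc (K : ℝ) * dist (euclChart E x₀ x₀) (euclChart E x₀ y)
      ≤ (K + 1) * (ε / (2 * (K + 1))) := by gcongr; linarith
    _ = ε / 2 := by field_simp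

/-- Viscosity subsolutions of the system are uniform limits of `C¹` approximate subsolutions. -/
lemma IsSubsolution.exists_regularization (hH : ∀ i, IsCoerciveConvex (H i))
    {u : C(M, Fin m → ℝ)} (hu : IsSubsolution B lam H c u) {ε : ℝ} (hε : 0 < ε) :
    ∃ φ : Fin m → M → ℝ, (∀ i, ContMDiff 𝓘(ℝ, E) 𝓘(ℝ, ℝ) 1 (φ i)) ∧
      (∀ x i, |φ i x - u x i| ≤ ε) ∧
      (∀ x i, H i x (mvfderiv 𝓘(ℝ, E) (φ i) x) + ((B *ᵥ u x) i + lam * u x i) ≤ c + ε) ∧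
      ∀ x i, H i x (mvfderiv 𝓘(ℝ, E) (φ i) x) +
        ((B *ᵥ fun j => φ j x) i + lam * φ i x) ≤ c + ε := by
  rw [isSubsolution_iff] at hu
  set β := ∑ i, ∑ j, |B i j|
  have hβ : 0 ≤ β := Finset.sum_nonneg fun i _ => Finset.sum_nonneg fun j _ => abs_nonneg _
  set δ := ε / (1 + β + |lam|) with hδ
  have hδ0 : 0 < δ := by positivity
  have hδε : δ * (1 + β + |lam|) = ε := by rw [hδ]; field_simp
  choose φ hφ hφu using fun i => exists_contMDiff_regularization (hH i)
    (continuous_component u i)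
    (continuous_const.sub ((continuous_mulVec B u i).add
      (continuous_const.mul (continuous_component u i))))
    (f := fun y => c - ((B *ᵥ u y) i + lam * u y i))
    (fun x p hp => by linarith [hu x i p hp]) hδ0
  have hle : δ ≤ ε := by
    have : 0 ≤ δ * (β + |lam|) := by positivity
    nlinarith
  refine ⟨φ, hφ, fun x i => (hφu i x).1.trans hle, fun x i => ?_, fun x i => ?_⟩
  · linarith [(hφu i x).2]
  · have h1 := (abs_le.1 (mulVec_sub_le B (a := fun j => φ j x) (b := u x)
      (fun j => (hφu j x).1) i)).2
    have h2 : lam * φ i x - lam * u x i ≤ |lam| * δ := by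
      rw [← mul_sub]
      refine (le_abs_self _).trans ?_
      rw [abs_mul]
      exact mul_le_mul_of_nonneg_left (hφu i x).1 (abs_nonneg _)
    have h3 := (hφu i x).2
    nlinarith

/-- Comparison principle. Two different levels `c` and `c'` are allowed: for `lam = 0` the conclusion
is `c' ≤ c`. -/
lemma IsSubsolution.comparison (hB : IsCouplingMatrix B) (hH : ∀ i, IsCoerciveConvex (H i))
    {u v : C(M, Fin m → ℝ)} (hu : IsSubsolution B lam H c u) (hv : IsSupersolution B lam H c' v)
    (hlam : 0 ≤ lam) (x : M) (i : Fin m) : lam * (u x i - v x i) ≤ c - c' := by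
  refine le_of_forall_pos_le_add fun ε hε => ?_
  have hδ : 0 < ε / (1 + lam) := by positivity
  obtain ⟨φ, hφ, hφu, -, hsub⟩ := hu.exists_regularization hH hδ
  have h1 := hv.comparison_contMDiff hB hlam hφ (fun x i _ => hsub x i) x i
  have h2 := mul_le_mul_of_nonneg_left (abs_le.1 (hφu x i)).1 hlam
  have h3 : (1 + lam) * (ε / (1 + lam)) = ε := by field_simp
  nlinarith

/-- By convexity, viscosity subsolutions also satisfy their inequality on subdifferentials. -/
lemma IsSubsolution.le_of_mem_subdifferential (hH : ∀ i, IsCoerciveConvex (H i))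
    {u : C(M, Fin m → ℝ)} (hu : IsSubsolution B lam H c u) {x : M} {i : Fin m}
    {p : Cotangent E M x} (hp : p ∈ subdifferential E (fun y => u y i) x) :
    H i x p + ((B *ᵥ u x) i + lam * u x i) ≤ c := by
  choose φ hφ hφu hsub _ using fun n : ℕ =>
    hu.exists_regularization hH (Nat.one_div_pos_of_nat (α := ℝ) (n := n))
  have hlim : Tendsto (fun n : ℕ => 1 / ((n : ℝ) + 1)) atTop (𝓝 0) :=
    tendsto_one_div_add_atTop_nhds_zero_nat
  have hunif : TendstoUniformly (fun n y => φ n i y) (fun y => u y i) atTop := by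
    rw [Metric.tendstoUniformly_iff]
    intro ε hε
    filter_upwards [hlim.eventually_lt_const hε] with n hn y
    rw [dist_comm, Real.dist_eq]
    exact (hφu n y i).trans_lt hn
  obtain ⟨θ, xs, hθ, rfl, hxs, hmem⟩ := exists_tendsto_subdifferential
    (fun n => (hφ n i).continuous) (continuous_component u i) hunif hp
  have h1 : Tendsto (fun n => H i (xs n) (mvfderiv 𝓘(ℝ, E) θ (xs n))) atTop
      (𝓝 (H i x (mvfderiv 𝓘(ℝ, E) θ x))) :=
    (((hH i).continuous_mvfderiv hθ).tendsto x).comp hxs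
  have h2 : Tendsto (fun n => (B *ᵥ u (xs n)) i + lam * u (xs n) i) atTop
      (𝓝 ((B *ᵥ u x) i + lam * u x i)) :=
    (((continuous_mulVec B u i).add
      (continuous_const.mul (continuous_component u i))).tendsto x).comp hxs
  have h3 : Tendsto (fun n : ℕ => c + 1 / ((n : ℝ) + 1)) atTop (𝓝 (c + 0)) :=
    hlim.const_add c
  rw [add_zero] at h3
  refine le_of_tendsto_of_tendsto' (h1.add h2) h3 fun n => ?_
  obtain ⟨ψ, hψ, hmin, hd⟩ := hmem n
  have h4 : mvfderiv 𝓘(ℝ, E) θ (xs n) = mvfderiv 𝓘(ℝ, E) (φ n i) (xs n) := by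
    rw [← hd]
    exact (mvfderiv_eq_of_isLocalExtr_sub (hφ n i).contMDiffAt hψ (Or.inl hmin)).symm
  rw [h4]
  exact hsub n (xs n) i

end Systems

/-! ### Existence of solutions -/

section Subgradient

/-- Existence of subgradients for convex functions on the dual of a finite-dimensional space. -/
lemma exists_subgradient {V : Type*} [NormedAddCommGroup V] [NormedSpace ℝ V]
    [FiniteDimensional ℝ V] {f : (V →L[ℝ] ℝ) → ℝ} (hf : ConvexOn ℝ univ f) (p : V →L[ℝ] ℝ) :
    ∃ v : V, ∀ q : V →L[ℝ] ℝ, f p + (q v - p v) ≤ f q := by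
  have hcont : Continuous f := by
    rw [← continuousOn_univ]
    simpa using hf.continuousOn_interior
  have hopen : IsOpen {a : (V →L[ℝ] ℝ) × ℝ | f a.1 < a.2} :=
    isOpen_lt (hcont.comp continuous_fst) continuous_snd
  have hconv : Convex ℝ {a : (V →L[ℝ] ℝ) × ℝ | f a.1 < a.2} := by
    simpa using hf.convex_strict_epigraph
  obtain ⟨Λ, hΛ⟩ := geometric_hahn_banach_open_point hconv hopen
    (x := (p, f p)) (by simp)
  set a := Λ (0, 1) with ha
  have hsplit : ∀ q r, Λ (q, r) = Λ (q, 0) + r * a := fun q r => by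
    have : ((q, r) : (V →L[ℝ] ℝ) × ℝ) = (q, 0) + r • (0, 1) := by simp
    rw [this, map_add, map_smul, smul_eq_mul]
  have ha0 : a < 0 := by
    have := hΛ (p, f p + 1) (by simp)
    rw [hsplit, hsplit p (f p)] at this
    linarith
  -- every linear form on the dual is an evaluation
  let ev : Module.Dual ℝ (Module.Dual ℝ V) :=
    { toFun := fun q => Λ (LinearMap.toContinuousLinearMap q, 0)
      map_add' := fun q r => by rw [← map_add]; simp
      map_smul' := fun t q => by
        rw [RingHom.id_apply, ← map_smul]; simp }
  set v := (Module.evalEquiv ℝ V).symm ev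
  have hv : ∀ q : V →L[ℝ] ℝ, Λ (q, 0) = q v := fun q => by
    have h1 : Module.evalEquiv ℝ V v = ev := LinearEquiv.apply_symm_apply _ _
    have h2 := DFunLike.congr_fun h1 (q : V →ₗ[ℝ] ℝ)
    simp only [Module.evalEquiv_apply, ev] at h2
    exact h2.symm
  refine ⟨(-a)⁻¹ • v, fun q => ?_⟩
  have key : ∀ ε > 0, q v + (f q + ε) * a ≤ p v + f p * a := fun ε hε => by
    have := hΛ (q, f q + ε) (by simpa using hε)
    rw [hsplit, hsplit p (f p), hv, hv] at this
    exact this.le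
  have key' : q v + f q * a ≤ p v + f p * a := by
    refine le_of_forall_pos_le_add fun ε hε => ?_
    have h := key (ε / (-a)) (div_pos hε (by linarith))
    have : ε / (-a) * a = -ε := by field_simp [ha0.ne]
    linarith
  rw [map_smul, map_smul, smul_eq_mul, smul_eq_mul, ← mul_sub]
  have h1 : (-a)⁻¹ * (q v - p v) ≤ (-a)⁻¹ * ((f q - f p) * (-a)) :=
    mul_le_mul_of_nonneg_left (by linarith) (by have : 0 < -a := by linarith
                                                positivity)
  have h2 : (-a)⁻¹ * ((f q - f p) * (-a)) = f q - f p := by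
    have : (-a) ≠ 0 := by linarith
    rw [mul_comm, mul_assoc, mul_inv_cancel₀ this, mul_one]
  linarith

end Subgradient

section Systems

variable {E : Type*} [NormedAddCommGroup E] [NormedSpace ℝ E] [FiniteDimensional ℝ E]
  {M : Type*} [TopologicalSpace M] [T2Space M] [CompactSpace M]
  [ChartedSpace E M] [IsManifold 𝓘(ℝ, E) ∞ M] {m : ℕ}
  {B : Matrix (Fin m) (Fin m) ℝ} {H : Hamiltonian E M m} {lam c c' : ℝ}
  [Bundle.RiemannianBundle (fun x : M => TangentSpace 𝓘(ℝ, E) x)]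

/-- The supremum that defines the Lagrangian is attained at `p` for some vector `v`, bounded in terms
of the norm of `p`. -/
lemma IsCoerciveConvex.exists_subgradient_le {h : (x : M) → Cotangent E M x → ℝ}
    (hh : IsCoerciveConvex h) (ρ : ℝ) : ∃ R, ∀ x (p : Cotangent E M x), ‖p‖ ≤ ρ →
      ∃ v : TangentSpace 𝓘(ℝ, E) x, ‖v‖ ≤ R ∧
        ∀ q : Cotangent E M x, q v - h x q ≤ p v - h x p := by
  obtain ⟨C, hC⟩ := hh.exists_bound (ρ + 1)
  refine ⟨2 * C, fun x p hp => ?_⟩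
  have : FiniteDimensional ℝ (TangentSpace 𝓘(ℝ, E) x) := inferInstanceAs (FiniteDimensional ℝ E)
  obtain ⟨v, hv⟩ := exists_subgradient (V := TangentSpace 𝓘(ℝ, E) x) (hh.convexOn x) p
  refine ⟨v, ?_, fun q => by linarith [hv q]⟩
  obtain ⟨q, hq1, hqv⟩ := exists_dual_vector'' ℝ v
  have h1 := hv (p + q)
  have h2 : ‖p + q‖ ≤ ρ + 1 := (ContinuousLinearMap.opNorm_add_le p q).trans (add_le_add hp hq1)
  have h3 := (abs_le.1 (hC x (p + q) h2)).2
  have h4 := (abs_le.1 (hC x p (by linarith))).1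
  have h5 : (p + q) v = p v + q v := rfl
  have h6 : q v = ‖v‖ := hqv
  rw [h5, h6] at h1
  linarith

lemma IsSubsolution.mul_le_of_neg_le (hm : 0 < m) (hB : IsCouplingMatrix B)
    {u : C(M, Fin m → ℝ)} (hu : IsSubsolution B lam H c u) (hlam : 0 ≤ lam) {A : ℝ}
    (hA : ∀ x i, -A ≤ H i x 0) (x : M) (i : Fin m) : lam * u x i ≤ c + A := by
  have : Nonempty M := ⟨x⟩
  obtain ⟨k, y, hk⟩ := exists_max_component (a := fun i y => u y i) hm (continuous_component u)
  have h1 := isSubsolution_iff.1 hu y k 0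
    (zero_mem_superdifferential_of_isLocalMax (Eventually.of_forall (hk k)))
  have h2 := hB.mulVec_nonneg_of_max fun j => hk j y
  have h3 := hA y k
  have h4 := mul_le_mul_of_nonneg_left (hk i x) hlam
  linarith

lemma exists_bound_zero (hH : ∀ i, IsCoerciveConvex (H i)) :
    ∃ A, 0 ≤ A ∧ ∀ x i, |H i x 0| ≤ A := by
  choose C hC using fun i => (hH i).exists_bound 0
  refine ⟨∑ i, |C i|, Finset.sum_nonneg fun i _ => abs_nonneg _, fun x i => ?_⟩
  refine (hC i x 0 (norm_cotangent_zero x).le).trans ((le_abs_self _).trans ?_)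
  exact Finset.single_le_sum (f := fun i => |C i|) (fun i _ => abs_nonneg _) (Finset.mem_univ i)

/-- A maximal subsolution is a supersolution: where the supersolution property fails, a subsolution
can be increased by a bump. -/
lemma IsSubsolution.isSupersolution_of_maximal (hB : IsCouplingMatrix B)
    (hH : ∀ i, IsCoerciveConvex (H i)) {u : C(M, Fin m → ℝ)} (hu : IsSubsolution B lam H c u)
    (hmax : ∀ w : C(M, Fin m → ℝ), IsSubsolution B lam H c w → (∀ y j, u y j ≤ w y j) →
      ∀ y j, w y j ≤ u y j) : IsSupersolution B lam H c u := by
  classical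
  rw [isSupersolution_iff]
  rintro x i p ⟨ψ, hψ, hmin, rfl⟩
  by_contra! hlt
  obtain ⟨θ, hθ, h0, hθlt, hd⟩ := exists_global_touching (continuous_component u i) hψ hmin
  rw [← hd] at hlt
  have hθle : ∀ y, θ y ≤ u y i := fun y => by
    rcases eq_or_ne y x with rfl | h
    · exact h0.le
    · exact (hθlt y h).le
  obtain ⟨η, hη, hlt'⟩ : ∃ η > 0, H i x (mvfderiv 𝓘(ℝ, E) θ x) +
      ((B *ᵥ u x) i + lam * u x i) < c - η :=
    ⟨(c - (H i x (mvfderiv 𝓘(ℝ, E) θ x) + ((B *ᵥ u x) i + lam * u x i))) / 2,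
      by linarith, by linarith⟩
  set N := {y | H i y (mvfderiv 𝓘(ℝ, E) θ y) + ((B *ᵥ u y) i + lam * u y i) < c - η}
  have hN : IsOpen N := isOpen_lt (((hH i).continuous_mvfderiv hθ).add
    ((continuous_mulVec B u i).add (continuous_const.mul (continuous_component u i))))
    continuous_const
  obtain ⟨δ₀, hδ₀, hδN⟩ : ∃ δ > 0, ∀ y ∉ N, δ ≤ u y i - θ y := by
    rcases Nᶜ.eq_empty_or_nonempty with he | hne
    · exact ⟨1, one_pos, fun y hy => by
        have : y ∈ Nᶜ := hy
        rw [he] at this; exact this.elim⟩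
    · obtain ⟨y₀, hy₀, hmin⟩ := hN.isClosed_compl.isCompact.exists_isMinOn hne
        ((continuous_component u i).sub hθ.continuous).continuousOn
      exact ⟨u y₀ i - θ y₀, sub_pos.2 (hθlt y₀ fun h => hy₀ (h ▸ hlt')), fun y hy => hmin hy⟩
  -- the height `δ` of the bump
  obtain ⟨δ, hδ, hδ1, hδ2⟩ : ∃ δ > 0, δ < δ₀ ∧ (|B i i| + |lam|) * δ ≤ η := by
    refine ⟨min (δ₀ / 2) (η / (|B i i| + |lam| + 1)), by positivity,
      (min_le_left _ _).trans_lt (by linarith), ?_⟩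
    calc (|B i i| + |lam|) * min (δ₀ / 2) (η / (|B i i| + |lam| + 1))
        ≤ (|B i i| + |lam| + 1) * (η / (|B i i| + |lam| + 1)) :=
          mul_le_mul (by linarith) (min_le_right _ _) (by positivity) (by positivity)
      _ = η := by field_simp
  let w : C(M, Fin m → ℝ) := ⟨fun y => Function.update (u y) i (max (u y i) (θ y + δ)),
    u.continuous.update i ((continuous_component u i).max (hθ.continuous.add continuous_const))⟩
  have hwi : ∀ y, w y i = max (u y i) (θ y + δ) := fun y => Function.update_self ..
  have hwj : ∀ y j, j ≠ i → w y j = u y j := fun y j hj => Function.update_of_ne hj ..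
  have hle : ∀ y j, u y j ≤ w y j := fun y j => by
    rcases eq_or_ne j i with rfl | hj
    · rw [hwi]; exact le_max_left _ _
    · exact (hwj y j hj).ge
  have hw : IsSubsolution B lam H c w := by
    rw [isSubsolution_iff] at hu ⊢
    intro y j p hp
    rcases eq_or_ne j i with rfl | hj
    · rcases le_or_gt (θ y + δ) (u y j) with h | h
      · have hwy : u y j = w y j := by rw [hwi, max_eq_left h]
        have h1 := hu y j p (superdifferential_mono (f := fun y => u y j) (g := fun y => w y j)
          (Eventually.of_forall fun z => hle z j) hwy hp)
        have h2 := hB.mulVec_anti (hle y) hwy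
        rw [← hwy]; linarith
      · have hwy : w y j = θ y + δ := by rw [hwi, max_eq_right h.le]
        have hyN : y ∈ N := by
          by_contra hcon
          linarith [hδN y hcon]
        have h1 : p = mvfderiv 𝓘(ℝ, E) θ y := by
          have h2 := superdifferential_mono (f := fun y => θ y + δ) (g := fun y => w y j)
            (Eventually.of_forall fun z => by rw [hwi]; exact le_max_right _ _) hwy.symm hp
          obtain ⟨φ, hφ, hmx, hdφ⟩ := h2
          refine eq_mvfderiv_of_mem_superdifferential hθ.contMDiffAt ⟨φ, hφ, ?_, hdφ⟩
          filter_upwards [hmx] with z hz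
          linarith
        rw [h1]
        have h3 : H j y (mvfderiv 𝓘(ℝ, E) θ y) + ((B *ᵥ u y) j + lam * u y j) < c - η := hyN
        set s := w y j - u y j with hs
        have hs0 : 0 ≤ s := sub_nonneg.2 (hle y j)
        have hsδ : s ≤ δ := by rw [hs, hwy]; linarith [hθle y]
        have h4 : (B *ᵥ w y) j = (B *ᵥ u y) j + B j j * s := by
          simp only [Matrix.mulVec, dotProduct]
          rw [← Finset.add_sum_erase _ _ (Finset.mem_univ j),
            ← Finset.add_sum_erase (Finset.univ) (fun k => B j k * u y k) (Finset.mem_univ j),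
            Finset.sum_congr rfl fun k hk => by rw [hwj y k (Finset.ne_of_mem_erase hk)]]
          rw [hs]; ring
        have h5 : (B j j + lam) * s ≤ η := by
          calc (B j j + lam) * s ≤ (|B j j| + |lam|) * s :=
                mul_le_mul_of_nonneg_right (add_le_add (le_abs_self _) (le_abs_self _)) hs0
            _ ≤ (|B j j| + |lam|) * δ := by gcongr
            _ ≤ η := hδ2
        have h6 : w y j = u y j + s := by rw [hs]; ring
        rw [h4, h6]
        linarith
    · have hwy : (fun y => w y j) = fun y => u y j := funext fun z => hwj z j hj
      rw [hwy] at hp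
      have h1 := hu y j p hp
      have h2 := hB.mulVec_anti (hle y) (hwj y j hj).symm
      rw [hwj y j hj]; linarith
  have := hmax w hw hle x i
  rw [hwi, h0] at this
  linarith [le_max_right (u x i) (u x i + δ)]

variable [IsContinuousRiemannianBundle E (fun x : M => TangentSpace 𝓘(ℝ, E) x)]

/-- Uniformly bounded subsolutions form a relatively compact family. -/
lemma isCompact_closure_subsolutions (hB : IsCouplingMatrix B)
    (hH : ∀ i, IsCoerciveConvex (H i)) (C : ℝ) :
    IsCompact (closure {u : C(M, Fin m → ℝ) | (∃ lam c, IsSubsolution B lam H c u ∧ c ≤ C ∧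
      ∀ x i, -C ≤ lam * u x i) ∧ ∀ x i, |u x i| ≤ C}) := by
  obtain ⟨D, ρ, h⟩ := exists_superdifferential_bound hB hH C
  refine isCompact_closure_of_equicontinuous
    (equicontinuous_of_superdifferential_bound (E := E) (ρ := ρ) ?_) fun u hu => hu.2
  rintro u ⟨⟨lam, c, hu, hc, hl⟩, -⟩
  exact (h lam c u hu hc hl).2

/-- Perron's method: the discounted system has a solution. By compactness there is a subsolution
above all subsolutions that are bounded below by a suitable constant `k`. -/
theorem exists_isSolution (hm : 0 < m) (hB : IsCouplingMatrix B)
    (hH : ∀ i, IsCoerciveConvex (H i)) (hlam : 0 < lam) (c : ℝ) :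
    ∃ u : C(M, Fin m → ℝ), IsSolution B lam H c u := by
  obtain ⟨A, hA0, hA⟩ := exists_bound_zero hH
  -- the constant `k` is a subsolution
  set k := (c - A) / lam with hk
  have hkl : lam * k = c - A := by rw [hk]; field_simp
  set T := {w : C(M, Fin m → ℝ) | IsSubsolution B lam H c w ∧ ∀ x i, k ≤ w x i} with hT
  have hconst : ContinuousMap.const M (fun _ : Fin m => k) ∈ T :=
    ⟨isSubsolution_const hB fun x i => by linarith [(abs_le.1 (hA x i)).2],
      fun x i => le_rfl⟩
  have hTclosed : IsClosed T := by
    have : T = {w | IsSubsolution B lam H c w} ∩ ⋂ x, ⋂ i, {w | k ≤ w x i} := by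
      ext w; simp [hT]
    rw [this]
    refine IsClosed.inter ?_ (isClosed_iInter fun x => isClosed_iInter fun i =>
      isClosed_le continuous_const ((continuous_apply i).comp (continuous_eval_const x)))
    refine isClosed_iff_clusterPt.2 fun w hw => ?_
    have : (𝓝 w ⊓ 𝓟 {w | IsSubsolution B lam H c w}).NeBot := hw
    exact IsSubsolution.of_tendsto (ws := id) (lams := fun _ => lam) (cs := fun _ => c)
      (l := 𝓝 w ⊓ 𝓟 {w | IsSubsolution B lam H c w}) hH tendsto_const_nhds tendsto_const_nhds
      inf_le_left (mem_inf_of_right (mem_principal_self _))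
  set C := |c| + A + |k| + (|c| + A) / lam
  have hC1 : 0 ≤ (|c| + A) / lam := by positivity
  have hTcpt : IsCompact T := by
    refine (isCompact_closure_subsolutions hB hH C).of_isClosed_subset hTclosed fun w hw =>
      subset_closure ⟨⟨lam, c, hw.1, ?_, fun x i => ?_⟩, fun x i => ?_⟩
    · have := le_abs_self c
      have := abs_nonneg k
      simp only [C]; linarith
    · have h1 := mul_le_mul_of_nonneg_left (hw.2 x i) hlam.le
      have := neg_abs_le c
      have := abs_nonneg k
      simp only [C]; linarith
    · have h1 := hw.1.mul_le_of_neg_le hm hB hlam.le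
        (fun x i => (abs_le.1 (hA x i)).1) x i
      have h2 : w x i ≤ (|c| + A) / lam := by
        rw [le_div_iff₀ hlam]
        linarith [le_abs_self c, mul_comm lam (w x i)]
      have h3 := hw.2 x i
      have h4 := neg_abs_le k
      have h5 := abs_nonneg k
      have h6 := abs_nonneg c
      exact abs_le.2 ⟨by simp only [C]; linarith, by simp only [C]; linarith⟩
  -- finite families in `T` have an upper bound in `T`, hence so does `T` by compactness
  obtain ⟨u, huT, hu⟩ : ∃ u ∈ T, ∀ w ∈ T, ∀ x i, w x i ≤ u x i := by
    have hfin : ∀ s : Finset T,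
        (T ∩ ⋂ w ∈ s, {u : C(M, Fin m → ℝ) | ∀ x i, (w : C(M, Fin m → ℝ)) x i ≤ u x i}).Nonempty := by
      classical
      intro s
      induction s using Finset.induction_on with
      | empty => exact ⟨_, hconst, by simp⟩
      | insert w s hw ih =>
        obtain ⟨u, huT, hu⟩ := ih
        let z : C(M, Fin m → ℝ) := ⟨fun x i => max ((w : C(M, Fin m → ℝ)) x i) (u x i),
          continuous_pi fun i => (continuous_component w.1 i).max (continuous_component u i)⟩
        refine ⟨z, ⟨w.2.1.componentwise_max hB huT.1 fun x i => rfl,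
          fun x i => (huT.2 x i).trans (le_max_right _ _)⟩, ?_⟩
        simp only [mem_iInter, mem_ofPred_eq] at hu ⊢
        intro w' hw' x i
        rcases Finset.mem_insert.1 hw' with rfl | h
        · exact le_max_left _ _
        · exact (hu w' h x i).trans (le_max_right _ _)
    obtain ⟨u, huT, hu⟩ := hTcpt.inter_iInter_nonempty
      (fun w : T => {u : C(M, Fin m → ℝ) | ∀ x i, (w : C(M, Fin m → ℝ)) x i ≤ u x i})
      (fun w => by
        have : {u : C(M, Fin m → ℝ) | ∀ x i, (w : C(M, Fin m → ℝ)) x i ≤ u x i} =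
            ⋂ x, ⋂ i, {u | (w : C(M, Fin m → ℝ)) x i ≤ u x i} := by ext; simp
        rw [this]
        exact isClosed_iInter fun x => isClosed_iInter fun i =>
          isClosed_le continuous_const ((continuous_apply i).comp (continuous_eval_const x)))
      hfin
    exact ⟨u, huT, fun w hw x i => mem_iInter.1 hu ⟨w, hw⟩ x i⟩
  exact ⟨u, huT.1, huT.1.isSupersolution_of_maximal hB hH fun w hw hle =>
    hu w ⟨hw, fun x i => (huT.2 x i).trans (hle x i)⟩⟩

/-- Existence of a solution of the critical system, as a limit of normalized solutions of the
discounted systems. -/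
theorem exists_isSolution_critical [ConnectedSpace M] (hm : 0 < m) (hB : IsCouplingMatrix B)
    (hH : ∀ i, IsCoerciveConvex (H i)) :
    ∃ c, ∃ u : C(M, Fin m → ℝ), IsSolution B 0 H c u := by
  obtain ⟨A, hA0, hA⟩ := exists_bound_zero hH
  choose v hv using fun n : ℕ => exists_isSolution (lam := 1 / ((n : ℝ) + 1)) hm hB hH
    Nat.one_div_pos_of_nat 0
  have hpos : ∀ n : ℕ, 0 < 1 / ((n : ℝ) + 1) := fun n => Nat.one_div_pos_of_nat
  have hvA : ∀ (n : ℕ) x i, |1 / ((n : ℝ) + 1) * v n x i| ≤ A := by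
    intro n x i
    refine abs_le.2 ⟨?_, ?_⟩
    · have hsub : IsSubsolution B (1 / ((n : ℝ) + 1)) H 0
          (ContinuousMap.const M fun _ => -A / (1 / ((n : ℝ) + 1))) :=
        isSubsolution_const hB fun x i => by
          have h1 := (abs_le.1 (hA x i)).2
          have h2 : 1 / ((n : ℝ) + 1) * (-A / (1 / ((n : ℝ) + 1))) = -A :=
            mul_div_cancel₀ _ (hpos n).ne'
          linarith
      have h3 := hsub.comparison hB hH (hv n).2 (hpos n).le x i
      simp only [ContinuousMap.const_apply, mul_sub] at h3
      have h2 : 1 / ((n : ℝ) + 1) * (-A / (1 / ((n : ℝ) + 1))) = -A :=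
            mul_div_cancel₀ _ (hpos n).ne'
      linarith
    · have := (hv n).1.mul_le_of_neg_le hm hB (hpos n).le
        (fun x i => (abs_le.1 (hA x i)).1) x i
      linarith
  let x₀ : M := Classical.arbitrary M
  let i₀ : Fin m := ⟨0, hm⟩
  let w : ℕ → C(M, Fin m → ℝ) := fun n => ⟨fun x i => v n x i - v n x₀ i₀,
    continuous_pi fun i => (continuous_component (v n) i).sub continuous_const⟩
  let cs : ℕ → ℝ := fun n => 0 - 1 / ((n : ℝ) + 1) * v n x₀ i₀
  have hw : ∀ n : ℕ, IsSolution B (1 / ((n : ℝ) + 1)) H (cs n) (w n) := fun n =>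
    (hv n).sub_const hB fun x i => rfl
  have hcs : ∀ n, cs n ∈ Icc (-A) A := fun n => by
    have := abs_le.1 (hvA n x₀ i₀)
    exact ⟨by simp only [cs]; linarith, by simp only [cs]; linarith⟩
  have hwl : ∀ (n : ℕ) x i, -(2 * A) ≤ 1 / ((n : ℝ) + 1) * w n x i := fun n x i => by
    have h1 := abs_le.1 (hvA n x₀ i₀)
    have h2 := abs_le.1 (hvA n x i)
    change -(2 * A) ≤ 1 / ((n : ℝ) + 1) * (v n x i - v n x₀ i₀)
    rw [mul_sub]
    linarith
  obtain ⟨D, ρ, hD⟩ := exists_superdifferential_bound hB hH (2 * A)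
  have hfam := fun n => hD _ _ (w n) (hw n).1 (by linarith [(hcs n).2]) (hwl n)
  have heq : Equicontinuous (fun (w : range w) x => (w : C(M, Fin m → ℝ)) x) := by
    refine equicontinuous_of_superdifferential_bound (E := E) (ρ := ρ) ?_
    rintro _ ⟨n, rfl⟩
    exact (hfam n).2
  obtain ⟨D', hD'⟩ := exists_oscillation_bound heq x₀
  have hcpt := isCompact_closure_of_equicontinuous heq (C := D' + D) (by
    rintro _ ⟨n, rfl⟩ x i
    have h1 := hD' _ (mem_range_self n) x i
    have h2 := (hfam n).1 x₀ i i₀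
    have h3 : w n x₀ i₀ = 0 := sub_self (v n x₀ i₀)
    rw [h3, sub_zero] at h2
    have := abs_add_le (w n x i - w n x₀ i) (w n x₀ i)
    rw [sub_add_cancel] at this
    linarith)
  let 𝒰 : Ultrafilter ℕ := Ultrafilter.of atTop
  have h𝒰 : (𝒰 : Filter ℕ) ≤ atTop := Ultrafilter.of_le _
  obtain ⟨u, -, hu⟩ := hcpt.ultrafilter_le_nhds' (𝒰.map w)
    (Ultrafilter.mem_map.2 (univ_mem' fun n => subset_closure (mem_range_self n)))
  obtain ⟨c, -, hc⟩ := (isCompact_Icc (a := -A) (b := A)).ultrafilter_le_nhds' (𝒰.map cs)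
    (Ultrafilter.mem_map.2 (univ_mem' hcs))
  have hu' : Tendsto w 𝒰 (𝓝 u) := hu
  have hc' : Tendsto cs 𝒰 (𝓝 c) := hc
  have hl : Tendsto (fun n : ℕ => 1 / ((n : ℝ) + 1)) 𝒰 (𝓝 0) :=
    tendsto_one_div_add_atTop_nhds_zero_nat.mono_left h𝒰
  exact ⟨c, u, IsSubsolution.of_tendsto hH hl hc' hu' (Eventually.of_forall fun n => (hw n).1),
    IsSupersolution.of_tendsto hH hl hc' hu' (Eventually.of_forall fun n => (hw n).2)⟩

/-- The solutions of the discounted systems at the critical level are uniformly bounded. -/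
lemma exists_solution_bound (hB : IsCouplingMatrix B) (hH : ∀ i, IsCoerciveConvex (H i))
    {w : C(M, Fin m → ℝ)} (hw : IsSolution B 0 H c w) :
    ∃ C, ∀ lam > 0, ∀ u : C(M, Fin m → ℝ), IsSolution B lam H c u → ∀ x i, |u x i| ≤ C := by
  obtain ⟨C, hC⟩ : ∃ C, ∀ x i, |w x i| ≤ C := by
    obtain ⟨C, hC⟩ := (isCompact_range w.continuous.norm).bddAbove
    exact ⟨C, fun x i => (norm_le_pi_norm (w x) i).trans (hC (mem_range_self x))⟩
  refine ⟨2 * C, fun lam hlam u hu x i => ?_⟩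
  -- `w - C` is a nonpositive subsolution and `w + C` a nonnegative supersolution
  let sh : ℝ → C(M, Fin m → ℝ) := fun k => w - ContinuousMap.const M fun _ => k
  have hsh : ∀ k : ℝ, IsSolution B 0 H c (sh k) := fun k => by
    have := hw.sub_const hB (k := k) (v := sh k) fun x i => rfl
    simpa using this
  have hval : ∀ k x i, sh k x i = w x i - k := fun _ _ _ => rfl
  have h1 : IsSubsolution B lam H c (sh C) :=
    isSubsolution_iff.2 fun x i p hp => by
      have h2 := isSubsolution_iff.1 (hsh C).1 x i p hp
      have h3 : lam * sh C x i ≤ 0 :=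
        mul_nonpos_of_nonneg_of_nonpos hlam.le (by
          rw [hval]; linarith [(abs_le.1 (hC x i)).2])
      linarith
  have h2 : IsSupersolution B lam H c (sh (-C)) :=
    isSupersolution_iff.2 fun x i p hp => by
      have h2 := isSupersolution_iff.1 (hsh (-C)).2 x i p hp
      have h3 : 0 ≤ lam * sh (-C) x i :=
        mul_nonneg hlam.le (by
          rw [hval]; linarith [(abs_le.1 (hC x i)).1])
      linarith
  have h3 := h1.comparison hB hH hu.2 hlam.le x i
  have h4 := hu.1.comparison hB hH h2 hlam.le x i
  rw [sub_self, hval] at h3 h4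
  have h5 := nonpos_of_mul_nonpos_right h3 hlam
  have h6 := nonpos_of_mul_nonpos_right h4 hlam
  have h7 := abs_le.1 (hC x i)
  exact abs_le.2 ⟨by linarith, by linarith⟩

end Systems

/-! ### The tangent bundle and the perturbation inequality -/

section TangentBundle

universe uE uM

variable {E : Type uE} [NormedAddCommGroup E] [NormedSpace ℝ E] [FiniteDimensional ℝ E]
  {M : Type uM} [TopologicalSpace M] [T2Space M] [CompactSpace M]
  [ChartedSpace E M] [IsManifold 𝓘(ℝ, E) ∞ M] {m : ℕ}
  {B : Matrix (Fin m) (Fin m) ℝ} {H : Hamiltonian E M m} {lam c : ℝ}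

lemma continuous_mvfderiv_apply {φ : M → ℝ} (hφ : ContMDiff 𝓘(ℝ, E) 𝓘(ℝ, ℝ) 1 φ) :
    Continuous fun z : TangentBundle 𝓘(ℝ, E) M => mvfderiv 𝓘(ℝ, E) φ z.1 z.2 := by
  have h1 : Continuous fun z : TangentBundle 𝓘(ℝ, E) M =>
      tangentBundleModelSpaceHomeomorph 𝓘(ℝ, ℝ) (tangentMap 𝓘(ℝ, E) 𝓘(ℝ, ℝ) φ z) :=
    (tangentBundleModelSpaceHomeomorph 𝓘(ℝ, ℝ)).continuous.comp (hφ.continuous_tangentMap le_rfl)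
  exact continuous_snd.comp h1

lemma continuous_bundle_proj :
    Continuous fun z : TangentBundle 𝓘(ℝ, E) M => (z.1 : M) :=
  FiberBundle.continuous_proj E (TangentSpace 𝓘(ℝ, E))

variable (B) in
/-- The integrand `(B φ (x))_i + D φ_i (x) (v)` of the closing condition, a function on
`TM × {1, …, m}`. -/
def closingForm (φ : Fin m → M → ℝ) (z : TangentBundle 𝓘(ℝ, E) M × Fin m) : ℝ :=
  (B *ᵥ fun j => φ j z.1.1) z.2 + mvfderiv 𝓘(ℝ, E) (φ z.2) z.1.1 z.1.2

lemma continuous_closingForm {φ : Fin m → M → ℝ}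
    (hφ : ∀ j, ContMDiff 𝓘(ℝ, E) 𝓘(ℝ, ℝ) 1 (φ j)) :
    Continuous (closingForm (E := E) B φ) := by
  refine continuous_prod_of_discrete_right.2 fun i => ?_
  refine Continuous.add ?_ (continuous_mvfderiv_apply (hφ i))
  simp only [Matrix.mulVec, dotProduct]
  exact continuous_finsetSum _ fun j _ => continuous_const.mul
    ((hφ j).continuous.comp continuous_bundle_proj)

lemma closingForm_add {φ ψ : Fin m → M → ℝ}
    (hφ : ∀ j, ContMDiff 𝓘(ℝ, E) 𝓘(ℝ, ℝ) 1 (φ j)) (hψ : ∀ j, ContMDiff 𝓘(ℝ, E) 𝓘(ℝ, ℝ) 1 (ψ j))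
    (z : TangentBundle 𝓘(ℝ, E) M × Fin m) :
    closingForm B (fun j y => φ j y + ψ j y) z = closingForm B φ z + closingForm B ψ z := by
  have h1 : mvfderiv 𝓘(ℝ, E) (fun y => φ z.2 y + ψ z.2 y) z.1.1 =
      mvfderiv 𝓘(ℝ, E) (φ z.2) z.1.1 + mvfderiv 𝓘(ℝ, E) (ψ z.2) z.1.1 :=
    mvfderiv_add ((hφ z.2).contMDiffAt.mdifferentiableAt (by simp))
      ((hψ z.2).contMDiffAt.mdifferentiableAt (by simp))
  simp only [closingForm, Matrix.mulVec, dotProduct, mul_add, Finset.sum_add_distrib]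
  rw [h1, add_apply]
  ring

lemma mvfderiv_const_mul {φ : M → ℝ} (hφ : ContMDiff 𝓘(ℝ, E) 𝓘(ℝ, ℝ) 1 φ) (a : ℝ) (x : M) :
    mvfderiv 𝓘(ℝ, E) (fun y => a * φ y) x = a • mvfderiv 𝓘(ℝ, E) φ x := by
  refine (mvfderiv_mul (contMDiffAt_const.mdifferentiableAt (n := 1) (by simp))
    (hφ.contMDiffAt.mdifferentiableAt (by simp))).trans ?_
  rw [mvfderiv_const]
  simp

lemma closingForm_const_mul {φ : Fin m → M → ℝ}
    (hφ : ∀ j, ContMDiff 𝓘(ℝ, E) 𝓘(ℝ, ℝ) 1 (φ j)) (a : ℝ)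
    (z : TangentBundle 𝓘(ℝ, E) M × Fin m) :
    closingForm B (fun j y => a * φ j y) z = a * closingForm B φ z := by
  simp only [closingForm, Matrix.mulVec, dotProduct]
  rw [mvfderiv_const_mul (hφ z.2), smul_apply, smul_eq_mul, mul_add,
    Finset.mul_sum]
  congr 1
  exact Finset.sum_congr rfl fun j _ => by ring

variable [Bundle.RiemannianBundle (fun x : M => TangentSpace 𝓘(ℝ, E) x)]
  [IsContinuousRiemannianBundle E (fun x : M => TangentSpace 𝓘(ℝ, E) x)]

/-- Vectors of bounded norm are covered by a compact Hausdorff space that maps continuously to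
the tangent bundle. -/
lemma exists_compact_cover_tangent (R : ℝ) :
    ∃ (Y : Type (max uE uM)) (_ : TopologicalSpace Y), CompactSpace Y ∧ T2Space Y ∧
      ∃ ϖ : Y → TangentBundle 𝓘(ℝ, E) M, Continuous ϖ ∧
        (∀ (x : M) (v : TangentSpace 𝓘(ℝ, E) x), ‖v‖ ≤ R → ∃ y, ϖ y = ⟨x, v⟩) ∧
        ∃ R', ∀ y, ‖(ϖ y).2‖ ≤ R' := by
  have h : ∀ x₀ : M, ∃ K ∈ 𝓝 x₀, IsCompact K ∧ ∃ C > 0, ∀ x ∈ K,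
      x ∈ (trivializationAt E (TangentSpace 𝓘(ℝ, E)) x₀).baseSet ∧
      (∀ v : TangentSpace 𝓘(ℝ, E) x, ‖(trivializationAt E (TangentSpace 𝓘(ℝ, E))
        x₀).continuousLinearMapAt ℝ x v‖ ≤ C * ‖v‖) ∧
      ∀ e : E, ‖(trivializationAt E (TangentSpace 𝓘(ℝ, E)) x₀).symmL ℝ x e‖ ≤ C * ‖e‖ := by
    intro x₀
    obtain ⟨C1, hC1, h1⟩ := eventually_norm_trivializationAt_lt E
      (fun x : M => TangentSpace 𝓘(ℝ, E) x) x₀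
    obtain ⟨C2, hC2, h2⟩ := eventually_norm_symmL_trivializationAt_lt E
      (fun x : M => TangentSpace 𝓘(ℝ, E) x) x₀
    have h3 := (trivializationAt E (TangentSpace 𝓘(ℝ, E)) x₀).open_baseSet.mem_nhds
      (FiberBundle.mem_baseSet_trivializationAt' x₀)
    obtain ⟨K, hK, hKs, hKc⟩ := local_compact_nhds (h1.and (h2.and h3))
    refine ⟨K, hK, hKc, max C1 C2, lt_max_of_lt_left hC1, fun x hx => ?_⟩
    obtain ⟨hx1, hx2, hx3⟩ := hKs hx
    refine ⟨hx3, fun v => ?_, fun e => ?_⟩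
    · exact (ContinuousLinearMap.le_opNorm _ v).trans
        (mul_le_mul_of_nonneg_right (hx1.le.trans (le_max_left _ _)) (norm_nonneg _))
    · exact (ContinuousLinearMap.le_opNorm _ e).trans
        (mul_le_mul_of_nonneg_right (hx2.le.trans (le_max_right _ _)) (norm_nonneg _))
  choose K hK hKc C hC hKC using h
  obtain ⟨t, ht⟩ := CompactSpace.elim_nhds_subcover K hK
  have hcomp : ∀ k, CompactSpace (K k) := fun k => isCompact_iff_compactSpace.1 (hKc k)
  have hball : ∀ k, CompactSpace (Metric.closedBall (0 : E) (C k * |R|)) := fun k =>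
    isCompact_iff_compactSpace.1 (isCompact_closedBall _ _)
  refine ⟨Σ k : t, K k × Metric.closedBall (0 : E) (C k * |R|), inferInstance, inferInstance,
    inferInstance, fun y => ⟨y.2.1, (trivializationAt E (TangentSpace 𝓘(ℝ, E))
      (y.1 : M)).symm y.2.1 y.2.2⟩, ?_, ?_, ?_⟩
  · refine continuous_sigma fun k => ?_
    have h1 := (trivializationAt E (TangentSpace 𝓘(ℝ, E)) (k : M)).continuousOn_symm
    exact h1.comp_continuous (f := fun y : K k × Metric.closedBall (0 : E) (C k * |R|) =>
      ((y.1 : M), (y.2 : E))) (by fun_prop) fun y => ⟨(hKC k y.1 y.1.2).1, mem_univ _⟩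
  · intro x v hv
    have hx : x ∈ ⋃ k ∈ t, K k := by rw [ht]; trivial
    simp only [mem_iUnion] at hx
    obtain ⟨k, hk, hxk⟩ := hx
    obtain ⟨hb, h1, -⟩ := hKC k x hxk
    refine ⟨⟨⟨k, hk⟩, ⟨x, hxk⟩, ⟨(trivializationAt E (TangentSpace 𝓘(ℝ, E))
        k).continuousLinearMapAt ℝ x v, ?_⟩⟩, ?_⟩
    · rw [mem_closedBall_zero_iff]
      exact (h1 v).trans (mul_le_mul_of_nonneg_left (hv.trans (le_abs_self R)) (hC k).le)
    · have := (trivializationAt E (TangentSpace 𝓘(ℝ, E)) k).symmL_continuousLinearMapAt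
        (R := ℝ) hb v
      rw [Bundle.Trivialization.symmL_apply _ hb] at this
      exact congrArg (Bundle.TotalSpace.mk x) this
  · refine ⟨∑ k ∈ t, C k * (C k * |R|), fun y => ?_⟩
    have h1 := (hKC y.1 y.2.1 y.2.1.2).2.2 y.2.2
    have h2 := mem_closedBall_zero_iff.1 y.2.2.2
    rw [Bundle.Trivialization.symmL_apply _ (hKC y.1 y.2.1 y.2.1.2).1] at h1
    refine (h1.trans (mul_le_mul_of_nonneg_left h2 (hC _).le)).trans ?_
    exact Finset.single_le_sum (f := fun k => C k * (C k * |R|))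
      (fun k _ => by have := hC k; positivity) y.1.2

lemma secondCountableTopology_tangentBundle :
    SecondCountableTopology (TangentBundle 𝓘(ℝ, E) M) := by
  have : SigmaCompactSpace (TangentBundle 𝓘(ℝ, E) M) := by
    choose Y tY cY _ ϖ hϖ hs _ using fun n : ℕ => exists_compact_cover_tangent (E := E) (M := M) n
    refine ⟨⟨fun n => range (ϖ n), fun n => isCompact_range (hϖ n), ?_⟩⟩
    refine eq_univ_of_forall fun z => mem_iUnion.2 ?_
    obtain ⟨n, hn⟩ := exists_nat_ge ‖z.2‖
    obtain ⟨y, hy⟩ := hs n z.1 z.2 hn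
    exact ⟨n, y, hy⟩
  have : SecondCountableTopology (ModelProd E E) :=
    inferInstanceAs (SecondCountableTopology (E × E))
  exact ChartedSpace.secondCountable_of_sigmaCompact (ModelProd E E) _

/-- The Lagrangian is the supremum of countably many continuous functions
`D ψ (x) (v) - H_i (x, D ψ (x))`. -/
lemma exists_lagrangian_eq_iSup (hH : ∀ i, IsCoerciveConvex (H i)) :
    ∃ ψ : ℕ → M → ℝ, (∀ n, ContMDiff 𝓘(ℝ, E) 𝓘(ℝ, ℝ) 1 (ψ n)) ∧
      ∀ z : TangentBundle 𝓘(ℝ, E) M × Fin m, lagrangian H z.2 z.1.1 z.1.2 =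
        ⨆ n, ((mvfderiv 𝓘(ℝ, E) (ψ n) z.1.1 z.1.2 -
          H z.2 z.1.1 (mvfderiv 𝓘(ℝ, E) (ψ n) z.1.1) : ℝ) : EReal) := by
  have := secondCountableTopology_tangentBundle (E := E) (M := M)
  let F : (M → ℝ) → TangentBundle 𝓘(ℝ, E) M × Fin m → EReal := fun ψ z =>
    ((mvfderiv 𝓘(ℝ, E) ψ z.1.1 z.1.2 - H z.2 z.1.1 (mvfderiv 𝓘(ℝ, E) ψ z.1.1) : ℝ) : EReal)
  let 𝓕 : Set (TangentBundle 𝓘(ℝ, E) M × Fin m → EReal) :=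
    F '' {ψ | ContMDiff 𝓘(ℝ, E) 𝓘(ℝ, ℝ) 1 ψ}
  have hcont : ∀ f ∈ 𝓕, LowerSemicontinuous f := by
    rintro _ ⟨ψ, hψ, rfl⟩
    refine Continuous.lowerSemicontinuous (continuous_coe_real_ereal.comp ?_)
    refine continuous_prod_of_discrete_right.2 fun i => ?_
    exact (continuous_mvfderiv_apply hψ).sub
      (((hH i).continuous_mvfderiv hψ).comp continuous_bundle_proj)
  have hlub : IsLUB 𝓕 fun z => lagrangian H z.2 z.1.1 z.1.2 := by
    refine isLUB_pi.2 fun z => ⟨?_, fun b hb => iSup_le fun p => ?_⟩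
    · rintro _ ⟨_, ⟨ψ, -, rfl⟩, rfl⟩
      exact le_iSup (fun p : Cotangent E M z.1.1 => ((p z.1.2 - H z.2 z.1.1 p : ℝ) : EReal)) _
    · obtain ⟨ψ, hψ, rfl⟩ := exists_mvfderiv_eq z.1.1 p
      exact hb ⟨F ψ, ⟨ψ, hψ, rfl⟩, rfl⟩
  obtain ⟨𝓖, h𝓖, hcount, hlub'⟩ := exists_countable_lowerSemicontinuous_isLUB hcont hlub
  have hzero : F (fun _ => 0) ∈ 𝓕 := ⟨_, contMDiff_const, rfl⟩
  obtain ⟨f, hf⟩ := (hcount.insert (F fun _ => 0)).exists_eq_range (insert_nonempty _ _)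
  have hf𝓕 : ∀ n, ∃ ψ, ContMDiff 𝓘(ℝ, E) 𝓘(ℝ, ℝ) 1 ψ ∧ F ψ = f n := fun n =>
    insert_subset hzero h𝓖 (hf ▸ mem_range_self n)
  choose ψ hψ hψf using hf𝓕
  refine ⟨ψ, hψ, fun z => le_antisymm ?_ (iSup_le fun n => ?_)⟩
  · refine (isLUB_pi.1 hlub' z).2 ?_
    rintro _ ⟨g, hg, rfl⟩
    obtain ⟨n, rfl⟩ : g ∈ range f := hf ▸ mem_insert_of_mem _ hg
    rw [← hψf n]
    exact le_iSup (fun n => F (ψ n) z) n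
  · exact le_iSup (fun p : Cotangent E M z.1.1 => ((p z.1.2 - H z.2 z.1.1 p : ℝ) : EReal)) _

/-- The inequality behind the duality argument: it shows that the system of conditions that defines
the minimizing measure is consistent. The maximum of `η - u` is inspected for the perturbation
`η = (1 - θ t) w - θ φ` of the critical subsolution `w`, where `θ = lam / r`. -/
lemma IsSolution.perturbation_le (hB : IsCouplingMatrix B)
    {u w : C(M, Fin m → ℝ)} (hu : IsSolution B lam H c u) (hlam : 0 < lam)
    {φ w' : Fin m → M → ℝ} (hφ : ∀ j, ContMDiff 𝓘(ℝ, E) 𝓘(ℝ, ℝ) 1 (φ j))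
    (hw' : ∀ j, ContMDiff 𝓘(ℝ, E) 𝓘(ℝ, ℝ) 1 (w' j)) {ε K ρ R r s t : ℝ} (hε : 0 ≤ ε)
    (hww' : ∀ j x, |w' j x - w x j| ≤ ε)
    (hsub : ∀ x i, H i x (mvfderiv 𝓘(ℝ, E) (w' i) x) + (B *ᵥ fun j => w' j x) i ≤ c + ε)
    (hK : ∀ j x, |t * w' j x + φ j x| ≤ K)
    (hρ : ∀ x i, ∀ p ∈ subdifferential E (fun y => u y i) x, ‖p‖ ≤ ρ)
    (hR : ∀ i x (p : Cotangent E M x), ‖p‖ ≤ ρ → ∃ v : TangentSpace 𝓘(ℝ, E) x, ‖v‖ ≤ R ∧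
        ∀ q : Cotangent E M x, q v - H i x q ≤ p v - H i x p)
    (ht : 0 ≤ t) (hr : 0 < r) (htr : lam * t ≤ r)
    (hcone : ∀ (z : TangentBundle 𝓘(ℝ, E) M × Fin m) (l : ℝ), ‖z.1.2‖ ≤ R →
      (∀ q : Cotangent E M z.1.1, q z.1.2 - H z.2 z.1.1 q ≤ l) →
      0 ≤ s + t * l + closingForm B φ z - r * w z.1.1 z.2) (x : M) (i : Fin m) :
    r * (w x i - u x i) ≤ s - t * c + (r * ε / lam + 2 * (r * ε + lam * K)) := by
  have : Nonempty M := ⟨x⟩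
  set θ := lam / r with hθ
  have hθ0 : 0 < θ := div_pos hlam hr
  have hθt : θ * t ≤ 1 := by rw [hθ, div_mul_eq_mul_div]; exact (div_le_one hr).2 htr
  have hθr : θ * r = lam := div_mul_cancel₀ _ hr.ne'
  let η : Fin m → M → ℝ := fun j y => (1 - θ * t) * w' j y + (-θ) * φ j y
  have hη : ∀ j, ContMDiff 𝓘(ℝ, E) 𝓘(ℝ, ℝ) 1 (η j) := fun j =>
    (contMDiff_const.mul (hw' j)).add (contMDiff_const.mul (hφ j))
  obtain ⟨k, y, hk⟩ := exists_max_component (a := fun j y => η j y - u y j) i.pos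
    fun j => (hη j).continuous.sub (continuous_component u j)
  have hloc : IsLocalMin (fun y' => u y' k - η k y') y :=
    Eventually.of_forall fun y' => by have := hk k y'; simp only at this ⊢; linarith
  set p : Cotangent E M y := mvfderiv 𝓘(ℝ, E) (η k) y
  have hp : p ∈ subdifferential E (fun y => u y k) y := ⟨η k, (hη k).contMDiffAt, hloc, rfl⟩
  obtain ⟨v, hv, hvq⟩ := hR k y p (hρ y k p hp)
  have h1 := hcone (⟨y, v⟩, k) (p v - H k y p) hv hvq
  have h2 := isSupersolution_iff.1 hu.2 y k p hp
  have h3 := hvq (mvfderiv 𝓘(ℝ, E) (w' k) y)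
  have h4 := hsub y k
  have h5 := hB.mulVec_nonneg_of_max (a := fun j => η j y - u y j) fun j => hk j y
  have h6 : (B *ᵥ fun j => η j y - u y j) k =
      (1 - θ * t) * (B *ᵥ fun j => w' j y) k - θ * (B *ᵥ fun j => φ j y) k - (B *ᵥ u y) k := by
    simp only [Matrix.mulVec, dotProduct, Finset.mul_sum, ← Finset.sum_sub_distrib, η]
    exact Finset.sum_congr rfl fun j _ => by ring
  have h7 : p v = (1 - θ * t) * mvfderiv 𝓘(ℝ, E) (w' k) y v -
      θ * mvfderiv 𝓘(ℝ, E) (φ k) y v := by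
    have h : p = (1 - θ * t) • mvfderiv 𝓘(ℝ, E) (w' k) y +
        (-θ) • mvfderiv 𝓘(ℝ, E) (φ k) y := by
      rw [← mvfderiv_const_mul (hw' k), ← mvfderiv_const_mul (hφ k)]
      exact mvfderiv_add ((contMDiff_const.mul (hw' k)).contMDiffAt.mdifferentiableAt (by simp))
        ((contMDiff_const.mul (hφ k)).contMDiffAt.mdifferentiableAt (by simp))
    rw [h, add_apply, smul_apply,
      smul_apply, smul_eq_mul, smul_eq_mul]
    ring
  simp only [closingForm] at h1
  set l := p v - H k y p
  set dw := (mvfderiv 𝓘(ℝ, E) (w' k) y : Cotangent E M y) v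
  set dφ := (mvfderiv 𝓘(ℝ, E) (φ k) y : Cotangent E M y) v
  set Bw := (B *ᵥ fun j => w' j y) k
  set Bφ := (B *ᵥ fun j => φ j y) k
  have hl : l = p v - H k y p := rfl
  rw [h6] at h5
  -- `v` is dual to `p`, so `w'` and `u` bound `dw` and `l`; adding up, the terms with `B` combine
  -- to `(B (η - u))_k`, which has a sign at the maximum
  have h8 : (1 - θ * t) * dw ≤ (1 - θ * t) * (l + (c - Bw)) + ε := by
    have h9 : dw ≤ l + (c - Bw) + ε := by linarith
    have h10 : (1 - θ * t) * ε ≤ ε := by nlinarith [mul_nonneg hθ0.le ht]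
    nlinarith [mul_le_mul_of_nonneg_left h9 (sub_nonneg.2 hθt)]
  have h9 : 0 ≤ θ * (s + t * l + (Bφ + dφ) - r * w y k) := mul_nonneg hθ0.le h1
  have h10 : lam * w y k - lam * u y k ≤ θ * (s - t * c) + ε := by
    rw [← hθr] at h2 ⊢
    nlinarith
  have hηw : ∀ j y', |η j y' - w y' j| ≤ ε + θ * K := fun j y' => by
    have h : η j y' - w y' j = (w' j y' - w y' j) - θ * (t * w' j y' + φ j y') := by
      simp only [η]; ring
    rw [h]
    refine (abs_sub _ _).trans (add_le_add (hww' j y') ?_)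
    rw [abs_mul, abs_of_pos hθ0]
    exact mul_le_mul_of_nonneg_left (hK j y') hθ0.le
  have h11 : lam * (w x i - u x i) ≤ θ * (s - t * c) + ε + 2 * (lam * (ε + θ * K)) := by
    have h12 := hk i x
    have h13 := (abs_le.1 (hηw i x)).1
    have h14 := (abs_le.1 (hηw k y)).2
    have : w x i - u x i ≤ (w y k - u y k) + 2 * (ε + θ * K) := by linarith
    nlinarith [mul_le_mul_of_nonneg_left this hlam.le]
  have h12 : r * (w x i - u x i) = (r / lam) * (lam * (w x i - u x i)) := by
    field_simp
  rw [h12]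
  refine (mul_le_mul_of_nonneg_left h11 (div_pos hr hlam).le).trans (le_of_eq ?_)
  rw [hθ]
  field_simp
  ring

end TangentBundle

/-! ### Integration and duality -/

section ExtIntegral

variable {α : Type*} [MeasurableSpace α] {μ : Measure α}

lemma toENNReal_coe_real (a : ℝ) : (a : EReal).toENNReal = ENNReal.ofReal a := by
  rw [EReal.toENNReal_of_ne_top (EReal.coe_ne_top a), EReal.toReal_coe]

lemma extIntegral_mono {f g : α → EReal} (h : ∀ z, f z ≤ g z) :
    extIntegral μ f ≤ extIntegral μ g :=
  EReal.sub_le_sub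
    (EReal.coe_ennreal_le_coe_ennreal_iff.2
      (lintegral_mono fun z => EReal.toENNReal_le_toENNReal (h z)))
    (EReal.coe_ennreal_le_coe_ennreal_iff.2
      (lintegral_mono fun z => EReal.toENNReal_le_toENNReal (EReal.neg_le_neg_iff.2 (h z))))

lemma extIntegral_coe {f : α → ℝ} (hf : Integrable f μ) :
    extIntegral μ (fun z => (f z : EReal)) = ((∫ z, f z ∂μ : ℝ) : EReal) := by
  have h1 : ∫⁻ z, ENNReal.ofReal (f z) ∂μ ≠ ⊤ :=
    (lintegral_ofReal_le_lintegral_enorm f).trans_lt hf.2 |>.ne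
  have h2 : ∫⁻ z, ENNReal.ofReal (-f z) ∂μ ≠ ⊤ :=
    (lintegral_ofReal_le_lintegral_enorm (fun z => -f z)).trans_lt hf.neg.2 |>.ne
  rw [integral_eq_lintegral_pos_part_sub_lintegral_neg_part hf, EReal.coe_sub,
    EReal.coe_ennreal_toReal h1, EReal.coe_ennreal_toReal h2]
  simp only [extIntegral, ← EReal.coe_neg, toENNReal_coe_real]

/-- Monotone convergence for `extIntegral`. -/
lemma extIntegral_le_of_eq_iSup {g : ℕ → α → ℝ} (hg : ∀ n, Integrable (g n) μ)
    (hmono : ∀ z, Monotone fun n => g n z) {f : α → EReal} (hf : ∀ z, f z = ⨆ n, (g n z : EReal))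
    {a : ℝ} (ha : ∀ n, ∫ z, g n z ∂μ ≤ a) : extIntegral μ f ≤ a := by
  have hmono' : ∀ z, Monotone fun n => (g n z : EReal) := fun z i j hij =>
    EReal.coe_le_coe_iff.2 (hmono z hij)
  have hlim : ∀ z, Tendsto (fun n => (g n z : EReal)) atTop (𝓝 (f z)) := fun z => by
    rw [hf z]; exact tendsto_atTop_iSup (hmono' z)
  have hmeas : ∀ n, AEMeasurable (fun z => (g n z : EReal)) μ := fun n =>
    measurable_coe_real_ereal.comp_aemeasurable (hg n).aestronglyMeasurable.aemeasurable
  have h1 : Tendsto (fun n => ∫⁻ z, (g n z : EReal).toENNReal ∂μ) atTop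
      (𝓝 (∫⁻ z, (f z).toENNReal ∂μ)) :=
    lintegral_tendsto_of_tendsto_of_monotone
      (fun n => EReal.continuous_toENNReal.measurable.comp_aemeasurable (hmeas n))
      (Eventually.of_forall fun z i j hij => EReal.toENNReal_le_toENNReal (hmono' z hij))
      (Eventually.of_forall fun z => (EReal.continuous_toENNReal.tendsto _).comp (hlim z))
  have hfin : ∫⁻ z, (-(g 0 z : EReal)).toENNReal ∂μ ≠ ⊤ := by
    simp only [← EReal.coe_neg, toENNReal_coe_real]
    exact (lintegral_ofReal_le_lintegral_enorm (fun z => -g 0 z)).trans_lt (hg 0).neg.2 |>.ne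
  have h2 : Tendsto (fun n => ∫⁻ z, (-(g n z : EReal)).toENNReal ∂μ) atTop
      (𝓝 (∫⁻ z, (-f z).toENNReal ∂μ)) :=
    lintegral_tendsto_of_tendsto_of_antitone
      (fun n => EReal.continuous_toENNReal.measurable.comp_aemeasurable
        ((continuous_neg (G := EReal)).measurable.comp_aemeasurable (hmeas n)))
      (Eventually.of_forall fun z i j hij =>
        EReal.toENNReal_le_toENNReal (EReal.neg_le_neg_iff.2 (hmono' z hij))) hfin
      (Eventually.of_forall fun z => (EReal.continuous_toENNReal.tendsto _).comp
        (((continuous_neg (G := EReal)).tendsto _).comp (hlim z)))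
  have hfin' : ∫⁻ z, (-f z).toENNReal ∂μ ≠ ⊤ := by
    refine ((lintegral_mono fun z => EReal.toENNReal_le_toENNReal
      (EReal.neg_le_neg_iff.2 ?_)).trans_lt hfin.lt_top).ne
    rw [hf z]
    exact le_iSup (fun n => (g n z : EReal)) 0
  have h3 : Tendsto (fun n => extIntegral μ fun z => (g n z : EReal)) atTop
      (𝓝 (extIntegral μ f)) := by
    have h4 := (EReal.continuousAt_add (p := (((∫⁻ z, (f z).toENNReal ∂μ : ENNReal) : EReal),
      -((∫⁻ z, (-f z).toENNReal ∂μ : ENNReal) : EReal)))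
      (Or.inr (by simpa using hfin')) (Or.inl (EReal.coe_ennreal_ne_bot _))).tendsto.comp
      (((continuous_coe_ennreal_ereal.tendsto _).comp h1).prodMk_nhds
        (((continuous_neg (G := EReal)).tendsto _).comp ((continuous_coe_ennreal_ereal.tendsto _).comp h2)))
    exact h4
  refine le_of_tendsto h3 (Eventually.of_forall fun n => ?_)
  rw [extIntegral_coe (hg n)]
  exact EReal.coe_le_coe_iff.2 (ha n)

end ExtIntegral

section Duality

variable {Y : Type*} [TopologicalSpace Y] [CompactSpace Y]

/-- The Riesz representation theorem on a compact space. -/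
lemma exists_measure_of_nonneg [T2Space Y] [MeasurableSpace Y] [BorelSpace Y]
    (Λ : C(Y, ℝ) →ₗ[ℝ] ℝ) (hΛ : ∀ f : C(Y, ℝ), (∀ y, 0 ≤ f y) → 0 ≤ Λ f) :
    ∃ μ : Measure Y, IsFiniteMeasure μ ∧ ∀ f : C(Y, ℝ), ∫ y, f y ∂μ = Λ f := by
  let Λ' : CompactlySupportedContinuousMap Y ℝ →ₚ[ℝ] ℝ :=
    { toFun := fun g => Λ g.toContinuousMap
      map_add' := fun f g => map_add Λ f.toContinuousMap g.toContinuousMap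
      map_smul' := fun a g => map_smul Λ a g.toContinuousMap
      monotone' := fun f g hfg => by
        have h := hΛ (g.toContinuousMap - f.toContinuousMap) fun y => sub_nonneg.2 (hfg y)
        rw [map_sub] at h
        exact sub_nonneg.1 h }
  exact ⟨RealRMK.rieszMeasure Λ', inferInstance, fun f => RealRMK.integral_rieszMeasure Λ'
    (CompactlySupportedContinuousMap.continuousMapEquiv f)⟩

/-- A consistency criterion for a system of linear conditions on a probability measure `Λ`:
`Λ` vanishes on `T`, `Λ L ≤ -c` and `d ≤ Λ w`. It is the separation theorem, applied to the cone of
functions that contradict these conditions. -/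
lemma exists_functional_of_consistent (T : Submodule ℝ C(Y, ℝ)) (L : Y → EReal) (w : C(Y, ℝ))
    (c d : ℝ)
    (h : ∀ s t r : ℝ, ∀ φ ∈ T, 0 ≤ t → 0 ≤ r →
      (∀ y (l : ℝ), L y ≤ l → 0 ≤ s + t * l + φ y - r * w y) → 0 ≤ s - t * c - r * d) :
    ∃ Λ : C(Y, ℝ) →ₗ[ℝ] ℝ, (∀ f : C(Y, ℝ), (∀ y, 0 ≤ f y) → 0 ≤ Λ f) ∧
      Λ (ContinuousMap.const Y 1) = 1 ∧ (∀ φ ∈ T, Λ φ = 0) ∧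
      (∀ f : C(Y, ℝ), (∀ y, (f y : EReal) ≤ L y) → Λ f ≤ -c) ∧ d ≤ Λ w := by
  let one : C(Y, ℝ) := ContinuousMap.const Y 1
  -- `s`, `t`, `r`, `φ` are the multipliers of the conditions on `Λ`
  let O : Set C(Y, ℝ) := {f | ∃ s t r : ℝ, ∃ φ ∈ T, 0 ≤ t ∧ 0 ≤ r ∧ s - t * c - r * d < 0 ∧
    ∀ y (l : ℝ), L y ≤ l → f y ≤ s + t * l + φ y - r * w y}
  have hconv : Convex ℝ O := by
    rintro f ⟨s, t, r, φ, hφ, ht, hr, hs, hf⟩ g ⟨s', t', r', φ', hφ', ht', hr', hs', hg⟩ a b ha hb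
      hab
    refine ⟨a * s + b * s', a * t + b * t', a * r + b * r', a • φ + b • φ',
      T.add_mem (T.smul_mem a hφ) (T.smul_mem b hφ'), by positivity, by positivity, ?_, ?_⟩
    · rcases ha.eq_or_lt with rfl | ha
      · have : b = 1 := by linarith
        subst this; linarith
      · nlinarith [mul_neg_of_pos_of_neg ha hs, mul_nonpos_of_nonneg_of_nonpos hb hs'.le]
    · intro y l hl
      have h1 := mul_le_mul_of_nonneg_left (hf y l hl) ha
      have h2 := mul_le_mul_of_nonneg_left (hg y l hl) hb
      simp only [ContinuousMap.add_apply, ContinuousMap.smul_apply, smul_eq_mul]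
      linarith
  have hopen : IsOpen O := by
    refine Metric.isOpen_iff.2 ?_
    rintro f ⟨s, t, r, φ, hφ, ht, hr, hs, hf⟩
    refine ⟨-(s - t * c - r * d) / 2, by linarith, fun g hg => ?_⟩
    refine ⟨s + -(s - t * c - r * d) / 2, t, r, φ, hφ, ht, hr, by linarith, fun y l hl => ?_⟩
    have h1 := (ContinuousMap.dist_lt_iff (by linarith)).1 hg y
    have h2 := (abs_lt.1 h1).2
    linarith [hf y l hl]
  have h0 : (0 : C(Y, ℝ)) ∉ O := by
    rintro ⟨s, t, r, φ, hφ, ht, hr, hs, hf⟩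
    exact absurd (h s t r φ hφ ht hr fun y l hl => hf y l hl) (not_le.2 hs)
  obtain ⟨Λ, hΛ⟩ := geometric_hahn_banach_open_point hconv hopen h0
  simp only [map_zero] at hΛ
  have key : ∀ f : C(Y, ℝ), (∀ κ : ℝ, 0 < κ → f - κ • one ∈ O) → Λ f ≤ 0 := fun f hf => by
    have h1 : ∀ κ : ℝ, 0 < κ → Λ f - κ * Λ one < 0 := fun κ hκ => by
      have := hΛ _ (hf κ hκ)
      rwa [map_sub, map_smul, smul_eq_mul] at this
    have h2 : Tendsto (fun κ : ℝ => Λ f - κ * Λ one) (𝓝[>] 0) (𝓝 (Λ f - 0 * Λ one)) :=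
      (Continuous.tendsto (by fun_prop) 0).mono_left nhdsWithin_le_nhds
    rw [zero_mul, sub_zero] at h2
    exact le_of_tendsto h2 (eventually_nhdsWithin_of_forall fun κ hκ => (h1 κ hκ).le)
  have hone : 0 < Λ one := by
    have := hΛ (-one) ⟨-1, 0, 0, 0, T.zero_mem, le_rfl, le_rfl, by norm_num, fun y l _ => by
      simp [one]⟩
    rw [map_neg] at this
    linarith
  have hpos : ∀ f : C(Y, ℝ), (∀ y, 0 ≤ f y) → 0 ≤ Λ f := fun f hf => by
    have := key (-f) fun κ hκ => ⟨-κ, 0, 0, 0, T.zero_mem, le_rfl, le_rfl, by linarith,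
      fun y l _ => by simp [one]; linarith [hf y]⟩
    rw [map_neg] at this
    linarith
  have hT : ∀ φ ∈ T, Λ φ ≤ 0 := fun φ hφ => key φ fun κ hκ =>
    ⟨-κ, 0, 0, φ, hφ, le_rfl, le_rfl, by linarith, fun y l _ => by simp [one]⟩
  have hL : ∀ f : C(Y, ℝ), (∀ y, (f y : EReal) ≤ L y) → Λ f + c * Λ one ≤ 0 := fun f hf => by
    have := key (f + c • one) fun κ hκ => ⟨c - κ, 1, 0, 0, T.zero_mem, zero_le_one, le_rfl,
      by linarith, fun y l hl => by
        have h1 : f y ≤ l := EReal.coe_le_coe_iff.1 ((hf y).trans hl)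
        simp [one]; linarith⟩
    rwa [map_add, map_smul, smul_eq_mul] at this
  have hw : d * Λ one - Λ w ≤ 0 := by
    have := key (d • one - w) fun κ hκ => ⟨d - κ, 0, 1, 0, T.zero_mem, le_rfl, zero_le_one,
      by linarith, fun y l hl => by simp [one]; linarith⟩
    rwa [map_sub, map_smul, smul_eq_mul] at this
  have happ : ∀ f, ((Λ one)⁻¹ • (Λ : C(Y, ℝ) →ₗ[ℝ] ℝ)) f = (Λ one)⁻¹ * Λ f := fun f => rfl
  refine ⟨(Λ one)⁻¹ • (Λ : C(Y, ℝ) →ₗ[ℝ] ℝ), fun f hf => ?_, ?_, fun φ hφ => ?_, fun f hf => ?_, ?_⟩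
  · rw [happ]
    exact mul_nonneg (inv_nonneg.2 hone.le) (hpos f hf)
  · exact inv_mul_cancel₀ hone.ne'
  · have h1 := hT (-φ) (T.neg_mem hφ)
    rw [map_neg] at h1
    rw [happ, le_antisymm (hT φ hφ) (by linarith), mul_zero]
  · rw [happ, inv_mul_le_iff₀ hone]
    linarith [hL f hf]
  · rw [happ, le_inv_mul_iff₀ hone]
    linarith

end Duality

/-! ### Closed measures and Mather measures -/

section Mather

variable {E : Type*} [NormedAddCommGroup E] [NormedSpace ℝ E] [FiniteDimensional ℝ E]
  {M : Type*} [TopologicalSpace M] [T2Space M] [CompactSpace M]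
  [ChartedSpace E M] [IsManifold 𝓘(ℝ, E) ∞ M] {m : ℕ}
  {B : Matrix (Fin m) (Fin m) ℝ} {H : Hamiltonian E M m} {lam c : ℝ}

lemma continuous_apply_tangent (w : C(M, Fin m → ℝ)) :
    Continuous fun z : TangentBundle 𝓘(ℝ, E) M × Fin m => w z.1.1 z.2 :=
  continuous_prod_of_discrete_right.2 fun i =>
    (continuous_component w i).comp continuous_bundle_proj

lemma exists_abs_le (w : C(M, Fin m → ℝ)) : ∃ C, ∀ x i, |w x i| ≤ C := by
  obtain ⟨C, hC⟩ := (isCompact_range w.continuous.norm).bddAbove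
  exact ⟨C, fun x i => (norm_le_pi_norm (w x) i).trans (hC (mem_range_self x))⟩

lemma integrable_apply_tangent {μ : Measure (TangentBundle 𝓘(ℝ, E) M × Fin m)}
    [IsFiniteMeasure μ] (w : C(M, Fin m → ℝ)) : Integrable (fun z => w z.1.1 z.2) μ := by
  obtain ⟨C, hC⟩ := exists_abs_le w
  exact Integrable.of_bound (continuous_apply_tangent w).aestronglyMeasurable C
    (Eventually.of_forall fun z => hC _ _)

variable [Bundle.RiemannianBundle (fun x : M => TangentSpace 𝓘(ℝ, E) x)]

lemma IsClosedMeasure.integrable_closingForm (hH : ∀ i, IsCoerciveConvex (H i))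
    {μ : Measure (TangentBundle 𝓘(ℝ, E) M × Fin m)} (hμ : IsClosedMeasure B μ)
    {φ : Fin m → M → ℝ} (hφ : ∀ j, ContMDiff 𝓘(ℝ, E) 𝓘(ℝ, ℝ) 1 (φ j)) :
    Integrable (closingForm B φ) μ := by
  have := hμ.isProbabilityMeasure
  choose D hD using fun i => (hH i).exists_norm_mvfderiv_le (hφ i)
  let w : C(M, Fin m → ℝ) := ⟨fun x => B *ᵥ fun j => φ j x,
    (continuous_const : Continuous fun _ : M => B).matrix_mulVec
      (continuous_pi fun j => (hφ j).continuous)⟩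
  obtain ⟨C, hC⟩ := exists_abs_le w
  refine ⟨(continuous_closingForm hφ).aestronglyMeasurable, ?_⟩
  have hbound : ∀ z : TangentBundle 𝓘(ℝ, E) M × Fin m, ‖closingForm B φ z‖ₑ ≤
      ENNReal.ofReal C + ENNReal.ofReal (∑ i, |D i|) * ENNReal.ofReal ‖z.1.2‖ := fun z => by
    have h0 : 0 ≤ C := (abs_nonneg _).trans (hC z.1.1 z.2)
    have hDs : 0 ≤ ∑ i, |D i| := Finset.sum_nonneg fun i _ => abs_nonneg _
    have h1 : D z.2 ≤ ∑ i, |D i| := (le_abs_self _).trans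
      (Finset.single_le_sum (f := fun i => |D i|) (fun i _ => abs_nonneg _) (Finset.mem_univ z.2))
    have h2 : |closingForm B φ z| ≤ C + (∑ i, |D i|) * ‖z.1.2‖ := by
      refine (abs_add_le _ _).trans (add_le_add (hC z.1.1 z.2) ?_)
      refine (abs_cotangent_apply_le _ _).trans ?_
      exact mul_le_mul_of_nonneg_right ((hD z.2 z.1.1).trans h1) (norm_nonneg _)
    rw [← ENNReal.ofReal_mul hDs, ← ENNReal.ofReal_add h0 (by positivity), ← ofReal_norm]
    exact ENNReal.ofReal_le_ofReal h2
  refine (lintegral_mono hbound).trans_lt ?_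
  rw [lintegral_add_left measurable_const, lintegral_const_mul' _ _ ENNReal.ofReal_ne_top]
  refine ENNReal.add_lt_top.2 ⟨?_, ENNReal.mul_lt_top ENNReal.ofReal_lt_top
    hμ.lintegral_norm_lt_top⟩
  simp

variable [IsContinuousRiemannianBundle E (fun x : M => TangentSpace 𝓘(ℝ, E) x)]

/-- Subsolutions bound the action of closed measures from below. -/
lemma IsClosedMeasure.le_extIntegral (hH : ∀ i, IsCoerciveConvex (H i))
    {μ : Measure (TangentBundle 𝓘(ℝ, E) M × Fin m)} (hμ : IsClosedMeasure B μ)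
    {u : C(M, Fin m → ℝ)} (hu : IsSubsolution B lam H c u) (hlam : 0 ≤ lam) :
    ((lam * ∫ z, u z.1.1 z.2 ∂μ - c : ℝ) : EReal) ≤
      extIntegral μ (fun z => lagrangian H z.2 z.1.1 z.1.2) := by
  have := hμ.isProbabilityMeasure
  by_contra! hlt
  obtain ⟨q, hq1, hq2⟩ := EReal.lt_iff_exists_real_btwn.1 hlt
  rw [EReal.coe_lt_coe_iff] at hq2
  set X := ∫ z, u z.1.1 z.2 ∂μ
  obtain ⟨ε, hε, hεq⟩ : ∃ ε > 0, (lam + 1) * ε ≤ lam * X - c - q :=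
    ⟨(lam * X - c - q) / (lam + 1), div_pos (by linarith) (by linarith), by
      rw [mul_div_cancel₀ _ (by linarith)]⟩
  obtain ⟨φ, hφ, hφu, -, hsub⟩ := hu.exists_regularization hH hε
  let w : C(M, Fin m → ℝ) := ⟨fun x i => φ i x, continuous_pi fun j => (hφ j).continuous⟩
  have hint1 := hμ.integrable_closingForm hH hφ
  have hint2 : Integrable (fun z => lam * w z.1.1 z.2) μ :=
    (integrable_apply_tangent (μ := μ) w).const_mul lam
  have hint12 : Integrable (fun z => closingForm B φ z + lam * w z.1.1 z.2) μ := hint1.add hint2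
  have hint3 : Integrable (fun z => closingForm B φ z + lam * w z.1.1 z.2 - (c + ε)) μ :=
    hint12.sub (integrable_const _)
  have h1 : ∫ z, (closingForm B φ z + lam * w z.1.1 z.2 - (c + ε)) ∂μ =
      lam * ∫ z, w z.1.1 z.2 ∂μ - (c + ε) := by
    have h0 : ∫ z, closingForm B φ z ∂μ = 0 := hμ.integral_eq_zero φ hφ
    rw [integral_sub hint12 (integrable_const _), integral_add hint1 hint2, h0,
      integral_const_mul, integral_const]
    simp
  have h2 : X - ε ≤ ∫ z, w z.1.1 z.2 ∂μ := by
    have : ∫ z, (u z.1.1 z.2 - ε) ∂μ ≤ ∫ z, w z.1.1 z.2 ∂μ :=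
      integral_mono ((integrable_apply_tangent u).sub (integrable_const _))
        (integrable_apply_tangent w) fun z => by
          have := (abs_le.1 (hφu z.1.1 z.2)).1
          change u z.1.1 z.2 - ε ≤ φ z.2 z.1.1
          linarith
    rw [integral_sub (integrable_apply_tangent u) (integrable_const _), integral_const] at this
    simpa using this
  have h3 := extIntegral_mono (μ := μ)
    (f := fun z => ((closingForm B φ z + lam * w z.1.1 z.2 - (c + ε) : ℝ) : EReal))
    (g := fun z => lagrangian H z.2 z.1.1 z.1.2) fun z => by
      refine le_trans ?_ (le_iSup (fun p : Cotangent E M z.1.1 =>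
        ((p z.1.2 - H z.2 z.1.1 p : ℝ) : EReal)) (mvfderiv 𝓘(ℝ, E) (φ z.2) z.1.1))
      rw [EReal.coe_le_coe_iff]
      have := hsub z.1.1 z.2
      simp only [closingForm, w, ContinuousMap.coe_mk]
      linarith
  rw [extIntegral_coe hint3, h1] at h3
  have h4 := EReal.coe_lt_coe_iff.1 (h3.trans_lt hq1)
  nlinarith [mul_le_mul_of_nonneg_left h2 hlam]

/-- A consistent system of conditions has a solution among the closed measures. The functional is
constructed on the compact space that covers the vectors of norm at most `R`, and the measure that
represents it is pushed forward. -/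
lemma exists_isClosedMeasure_of_consistent (hH : ∀ i, IsCoerciveConvex (H i)) {R d : ℝ}
    (w : C(M, Fin m → ℝ))
    (h : ∀ (s t r : ℝ) (φ : Fin m → M → ℝ), (∀ j, ContMDiff 𝓘(ℝ, E) 𝓘(ℝ, ℝ) 1 (φ j)) →
      0 ≤ t → 0 ≤ r → (∀ (z : TangentBundle 𝓘(ℝ, E) M × Fin m) (l : ℝ), ‖z.1.2‖ ≤ R →
        lagrangian H z.2 z.1.1 z.1.2 ≤ l →
          0 ≤ s + t * l + closingForm B φ z - r * w z.1.1 z.2) → 0 ≤ s - t * c - r * d) :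
    ∃ μ : Measure (TangentBundle 𝓘(ℝ, E) M × Fin m), IsClosedMeasure B μ ∧
      extIntegral μ (fun z => lagrangian H z.2 z.1.1 z.1.2) ≤ ((-c : ℝ) : EReal) ∧
      d ≤ ∫ z, w z.1.1 z.2 ∂μ := by
  have := secondCountableTopology_tangentBundle (E := E) (M := M)
  obtain ⟨Y₀, _, _, _, ϖ, hϖ, hcover, R', hR'⟩ :=
    exists_compact_cover_tangent (E := E) (M := M) R
  let Y := Y₀ × Fin m
  let g : Y → TangentBundle 𝓘(ℝ, E) M × Fin m := Prod.map ϖ id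
  have hg : Continuous g := hϖ.prodMap continuous_id
  let _ : MeasurableSpace Y := borel Y
  have _ : BorelSpace Y := ⟨rfl⟩
  have hgm : Measurable g := hg.measurable
  let T : Submodule ℝ C(Y, ℝ) :=
    { carrier := {f | ∃ φ : Fin m → M → ℝ, (∀ j, ContMDiff 𝓘(ℝ, E) 𝓘(ℝ, ℝ) 1 (φ j)) ∧
        ∀ y, f y = closingForm B φ (g y)}
      add_mem' := by
        rintro f f' ⟨φ, hφ, hf⟩ ⟨φ', hφ', hf'⟩
        exact ⟨fun j y => φ j y + φ' j y, fun j => (hφ j).add (hφ' j), fun y => by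
          rw [closingForm_add hφ hφ', ContinuousMap.add_apply, hf, hf']⟩
      zero_mem' := ⟨fun _ _ => 0, fun _ => contMDiff_const, fun y => by
        have h1 : mvfderiv 𝓘(ℝ, E) (fun _ : M => (0 : ℝ)) (g y).1.1 = 0 := mvfderiv_const 0
        simp only [closingForm, h1]
        simp [Matrix.mulVec, dotProduct]⟩
      smul_mem' := by
        rintro a f ⟨φ, hφ, hf⟩
        exact ⟨fun j y => a * φ j y, fun j => contMDiff_const.mul (hφ j), fun y => by
          rw [closingForm_const_mul hφ, ContinuousMap.smul_apply, hf, smul_eq_mul]⟩ }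
  let w' : C(Y, ℝ) := ⟨fun y => w (g y).1.1 (g y).2, (continuous_apply_tangent w).comp hg⟩
  obtain ⟨Λ, hΛ, hΛ1, hΛT, hΛL, hΛw⟩ := exists_functional_of_consistent T
    (fun y => lagrangian H (g y).2 (g y).1.1 (g y).1.2) w' c d (by
      rintro s t r f ⟨φ, hφ, hf⟩ ht hr hy
      refine h s t r φ hφ ht hr fun z l hz hl => ?_
      obtain ⟨y, hy'⟩ := hcover z.1.1 z.1.2 hz
      have hyz : g (y, z.2) = z := Prod.ext hy' rfl
      have h1 := hy (y, z.2) l (by rw [hyz]; exact hl)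
      rw [hf, hyz] at h1
      have h2 : w' (y, z.2) = w z.1.1 z.2 := by
        change w (g (y, z.2)).1.1 (g (y, z.2)).2 = _
        rw [hyz]
      rwa [h2] at h1)
  obtain ⟨ν, _, hν⟩ := exists_measure_of_nonneg Λ hΛ
  have hνuniv : ν univ = 1 := by
    have h1 := hν (ContinuousMap.const Y 1)
    rw [hΛ1] at h1
    simp only [ContinuousMap.const_apply, integral_const, smul_eq_mul, mul_one] at h1
    rwa [measureReal_def, ENNReal.toReal_eq_one_iff] at h1
  have hprob : IsProbabilityMeasure ν := ⟨hνuniv⟩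
  have hmap : ∀ f : TangentBundle 𝓘(ℝ, E) M × Fin m → ℝ, Continuous f →
      ∫ z, f z ∂(ν.map g) = ∫ y, f (g y) ∂ν := fun f hf =>
    integral_map hgm.aemeasurable hf.aestronglyMeasurable
  refine ⟨ν.map g, ⟨Measure.isProbabilityMeasure_map hgm.aemeasurable, ?_, fun φ hφ => ?_⟩, ?_, ?_⟩
  · have h2 := (lintegral_map_le (μ := ν) (fun z => ENNReal.ofReal ‖z.1.2‖) g).trans
      (lintegral_mono fun y => ENNReal.ofReal_le_ofReal (hR' y.1))
    refine h2.trans_lt ?_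
    rw [lintegral_const]
    exact ENNReal.mul_lt_top ENNReal.ofReal_lt_top (measure_lt_top _ _)
  · let f : C(Y, ℝ) := ⟨fun y => closingForm B φ (g y), (continuous_closingForm hφ).comp hg⟩
    exact (hmap _ (continuous_closingForm hφ)).trans
      ((hν f).trans (hΛT f ⟨φ, hφ, fun y => rfl⟩))
  · obtain ⟨ψ, hψ, hψL⟩ := exists_lagrangian_eq_iSup hH
    let F : ℕ → TangentBundle 𝓘(ℝ, E) M × Fin m → ℝ := fun n z =>
      mvfderiv 𝓘(ℝ, E) (ψ n) z.1.1 z.1.2 - H z.2 z.1.1 (mvfderiv 𝓘(ℝ, E) (ψ n) z.1.1)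
    have hF : ∀ n, Continuous (F n) := fun n =>
      continuous_prod_of_discrete_right.2 fun i => (continuous_mvfderiv_apply (hψ n)).sub
        (((hH i).continuous_mvfderiv (hψ n)).comp continuous_bundle_proj)
    -- `L` is an increasing limit of continuous functions, to which the bound on `Λ` applies
    let G : ℕ → TangentBundle 𝓘(ℝ, E) M × Fin m → ℝ := fun n z => partialSups (fun k => F k z) n
    have hG : ∀ n, Continuous (G n) := fun n => Continuous.partialSups_apply fun k _ => hF k
    have hGle : ∀ n z, (G n z : EReal) ≤ lagrangian H z.2 z.1.1 z.1.2 := fun n z => by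
      obtain ⟨k, -, hk⟩ : ∃ k ≤ n, G n z = F k z := exists_partialSups_eq _ _
      rw [hk, hψL z]
      exact le_iSup (fun n => (F n z : EReal)) k
    refine extIntegral_le_of_eq_iSup (g := G) (fun n => ?_) (fun z => (partialSups _).monotone)
      (fun z => ?_) fun n => ?_
    · refine (integrable_map_measure (hG n).aestronglyMeasurable hgm.aemeasurable).2 ?_
      exact ((hG n).comp hg).integrable_of_hasCompactSupport (HasCompactSupport.of_compactSpace _)
    · refine le_antisymm ?_ (iSup_le fun n => hGle n z)
      rw [hψL z]
      refine iSup_mono fun n => EReal.coe_le_coe_iff.2 ?_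
      exact le_partialSups (fun k => F k z) n
    · let f : C(Y, ℝ) := ⟨fun y => G n (g y), (hG n).comp hg⟩
      exact (hmap _ (hG n)).trans_le ((hν f).trans_le (hΛL f fun y => hGle n (g y)))
  · rw [hmap _ (continuous_apply_tangent w)]
    exact hΛw.trans_eq (hν w').symm

/-- The solutions of the discounted systems have uniformly bounded subdifferentials. -/
lemma exists_subdifferential_bound (hH : ∀ i, IsCoerciveConvex (H i)) (C c : ℝ) :
    ∃ ρ, ∀ lam, 0 < lam → lam ≤ 1 → ∀ u : C(M, Fin m → ℝ), IsSubsolution B lam H c u →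
      (∀ x i, |u x i| ≤ C) → ∀ x i, ∀ p ∈ subdifferential E (fun y => u y i) x, ‖p‖ ≤ ρ := by
  choose ρ hρ using fun i => (hH i).coercive (c + (∑ i, ∑ j, |B i j|) * C + C)
  refine ⟨∑ i, |ρ i|, fun lam hlam hlam1 u hu hC x i p hp => ?_⟩
  have h1 := hu.le_of_mem_subdifferential hH hp
  have h2 := mulVec_sub_le B (a := u x) (b := 0) (fun j => by simpa using hC x j) i
  have h3 : (B *ᵥ (0 : Fin m → ℝ)) i = 0 := by simp
  rw [h3, sub_zero] at h2
  have h4 : |lam * u x i| ≤ C := by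
    rw [abs_mul, abs_of_pos hlam]
    exact (mul_le_of_le_one_left (abs_nonneg _) hlam1).trans (hC x i)
  have h5 := (abs_le.1 h2).1
  have h6 := (abs_le.1 h4).1
  refine (hρ i x p (by linarith)).trans ((le_abs_self _).trans ?_)
  exact Finset.single_le_sum (f := fun i => |ρ i|) (fun i _ => abs_nonneg _) (Finset.mem_univ i)

/-- For a limit `u₀` of discounted solutions and a critical subsolution `w`, some closed measure
has action at most `-c` and integrates `w` to at least `w_i (x) - (u₀)_i (x)`. -/
lemma exists_isClosedMeasure_of_tendsto (hB : IsCouplingMatrix B)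
    (hH : ∀ i, IsCoerciveConvex (H i)) {l : Filter ℝ} [l.NeBot] (hl : l ≤ 𝓝[>] 0)
    {u : ℝ → C(M, Fin m → ℝ)} (hu : ∀ lam > 0, IsSolution B lam H c (u lam))
    {u₀ w : C(M, Fin m → ℝ)} (hlim : Tendsto u l (𝓝 u₀)) (hw : IsSubsolution B 0 H c w)
    {C : ℝ} (hC : ∀ lam > 0, ∀ x i, |u lam x i| ≤ C) (x : M) (i : Fin m) :
    ∃ μ : Measure (TangentBundle 𝓘(ℝ, E) M × Fin m), IsClosedMeasure B μ ∧
      extIntegral μ (fun z => lagrangian H z.2 z.1.1 z.1.2) ≤ ((-c : ℝ) : EReal) ∧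
      w x i - u₀ x i ≤ ∫ z, w z.1.1 z.2 ∂μ := by
  obtain ⟨ρ, hρ⟩ := exists_subdifferential_bound (B := B) hH C c
  choose Rs hRs using fun i => (hH i).exists_subgradient_le ρ
  set R := ∑ i, |Rs i|
  have hRsR : ∀ i, Rs i ≤ R := fun i => (le_abs_self _).trans
    (Finset.single_le_sum (f := fun i => |Rs i|) (fun i _ => abs_nonneg _) (Finset.mem_univ i))
  have hR : ∀ i x (p : Cotangent E M x), ‖p‖ ≤ ρ → ∃ v : TangentSpace 𝓘(ℝ, E) x, ‖v‖ ≤ R ∧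
      ∀ q : Cotangent E M x, q v - H i x q ≤ p v - H i x p := fun i x p hp => by
    obtain ⟨v, hv, h⟩ := hRs i x p hp
    exact ⟨v, hv.trans (hRsR i), h⟩
  obtain ⟨W, hW⟩ := exists_abs_le w
  refine exists_isClosedMeasure_of_consistent (R := R) hH w fun s t r φ hφ ht hr hcone => ?_
  obtain ⟨Φ, hΦ⟩ := exists_abs_le
    (⟨fun x j => φ j x, continuous_pi fun j => (hφ j).continuous⟩ : C(M, Fin m → ℝ))
  set K := t * (W + 1) + Φ
  -- replacing `r` by `r + κ` and `s` by `s + κ W` makes the division by `r` legitimate; the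
  -- regularization of `w` has precision `lam ^ 2`, which is negligible compared with `lam`
  have key : ∀ κ > 0, (r + κ) * (w x i - u₀ x i) ≤ s + κ * W - t * c := by
    intro κ hκ
    have hl0 : Tendsto (fun lam : ℝ => lam) l (𝓝 0) := hl.trans nhdsWithin_le_nhds
    have h1 : Tendsto (fun lam => (r + κ) * (w x i - u lam x i)) l
        (𝓝 ((r + κ) * (w x i - u₀ x i))) :=
      ((((tendstoUniformly_component hlim i).tendsto_at x).const_sub _).const_mul _)
    have h2 : Tendsto (fun lam => s + κ * W - t * c + ((r + κ) * lam ^ 2 / lam +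
        2 * ((r + κ) * lam ^ 2 + lam * K))) l (𝓝 (s + κ * W - t * c)) := by
      have h3 : Tendsto (fun lam => s + κ * W - t * c + ((r + κ) * lam +
          2 * ((r + κ) * lam ^ 2 + lam * K))) l (𝓝 (s + κ * W - t * c + ((r + κ) * 0 +
          2 * ((r + κ) * 0 ^ 2 + 0 * K)))) :=
        ((by fun_prop : Continuous fun lam => s + κ * W - t * c + ((r + κ) * lam +
          2 * ((r + κ) * lam ^ 2 + lam * K))).tendsto 0).comp hl0
      have h4 : s + κ * W - t * c + ((r + κ) * 0 + 2 * ((r + κ) * 0 ^ 2 + 0 * K)) =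
          s + κ * W - t * c := by ring
      rw [h4] at h3
      refine h3.congr fun lam => ?_
      rcases eq_or_ne lam 0 with rfl | h
      · simp
      · congr 2
        field_simp
    refine le_of_tendsto_of_tendsto h1 h2 ?_
    have h3 : ∀ᶠ lam in l, lam < 1 ∧ lam * t < r + κ := by
      refine (hl0.eventually_lt_const one_pos).and ?_
      have : Tendsto (fun lam => lam * t) l (𝓝 (0 * t)) := hl0.mul_const t
      rw [zero_mul] at this
      exact this.eventually_lt_const (by linarith)
    filter_upwards [h3, hl self_mem_nhdsWithin] with lam hlam1 hlam
    have hlam : 0 < lam := hlam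
    obtain ⟨w', hw', hww', -, hsub⟩ := hw.exists_regularization hH (pow_pos hlam 2)
    refine (hu lam hlam).perturbation_le hB hlam hφ hw' (R := R) (ρ := ρ) (sq_nonneg lam)
      (fun j x => hww' x j) (fun x i => by simpa using hsub x i) (fun j x => ?_)
      (hρ lam hlam hlam1.1.le _ (hu lam hlam).1 (hC lam hlam)) hR ht (by linarith) hlam1.2.le
      (fun z l hz hz' => ?_) x i
    · have h4 := abs_le.1 (hww' x j)
      have h5 := abs_le.1 (hW x j)
      have h6 : lam ^ 2 ≤ 1 := pow_le_one₀ hlam.le hlam1.1.le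
      refine (abs_add_le _ _).trans (add_le_add ?_ (hΦ x j))
      rw [abs_mul, abs_of_nonneg ht]
      exact mul_le_mul_of_nonneg_left (abs_le.2 ⟨by linarith, by linarith⟩) ht
    · have h4 := hcone z l hz (iSup_le fun q => EReal.coe_le_coe_iff.2 (hz' q))
      have h5 := mul_le_mul_of_nonneg_left (abs_le.1 (hW z.1.1 z.2)).2 hκ.le
      linarith
  have h1 : Tendsto (fun κ : ℝ => (r + κ) * (w x i - u₀ x i)) (𝓝[>] 0)
      (𝓝 ((r + 0) * (w x i - u₀ x i))) :=
    (Continuous.tendsto (by fun_prop) 0).mono_left nhdsWithin_le_nhds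
  have h2 : Tendsto (fun κ : ℝ => s + κ * W - t * c) (𝓝[>] 0) (𝓝 (s + 0 * W - t * c)) :=
    (Continuous.tendsto (by fun_prop) 0).mono_left nhdsWithin_le_nhds
  have h3 := le_of_tendsto_of_tendsto h1 h2 (eventually_nhdsWithin_of_forall key)
  rw [add_zero, zero_mul, add_zero] at h3
  linarith

/-- Limits of the discounted solutions are the largest critical subsolutions that satisfy the
constraint on Mather measures. -/
lemma isGreatest_of_tendsto (hB : IsCouplingMatrix B)
    (hH : ∀ i, IsCoerciveConvex (H i)) {l : Filter ℝ} [l.NeBot] (hl : l ≤ 𝓝[>] 0)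
    {u : ℝ → C(M, Fin m → ℝ)} (hu : ∀ lam > 0, IsSolution B lam H c (u lam))
    {u₀ : C(M, Fin m → ℝ)} (hlim : Tendsto u l (𝓝 u₀))
    {C : ℝ} (hC : ∀ lam > 0, ∀ x i, |u lam x i| ≤ C) :
    IsSolution B 0 H c u₀ ∧ u₀ ∈ constrainedSubsolutions B H c ∧
      ∀ w ∈ constrainedSubsolutions B H c, ∀ x i, w x i ≤ u₀ x i := by
  have hl0 : Tendsto (fun lam : ℝ => lam) l (𝓝 0) := hl.trans nhdsWithin_le_nhds
  have hpos : ∀ᶠ lam in l, 0 < lam := hl self_mem_nhdsWithin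
  have hsol : IsSolution B 0 H c u₀ :=
    ⟨IsSubsolution.of_tendsto hH hl0 tendsto_const_nhds hlim (hpos.mono fun lam h => (hu lam h).1),
      IsSupersolution.of_tendsto hH hl0 tendsto_const_nhds hlim
        (hpos.mono fun lam h => (hu lam h).2)⟩
  have hmin : ∀ ν : Measure (TangentBundle 𝓘(ℝ, E) M × Fin m), IsClosedMeasure B ν →
      ((-c : ℝ) : EReal) ≤ extIntegral ν (fun z => lagrangian H z.2 z.1.1 z.1.2) := fun ν hν => by
    simpa using hν.le_extIntegral hH hsol.1 le_rfl
  refine ⟨hsol, ⟨hsol.1, fun μ hμ => ?_⟩, fun w hw x i => ?_⟩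
  · have := hμ.1.isProbabilityMeasure
    obtain ⟨x, i⟩ : Nonempty (M × Fin m) := by
      obtain ⟨z⟩ := nonempty_of_isProbabilityMeasure μ
      exact ⟨z.1.1, z.2⟩
    obtain ⟨ν, hν, hνc, -⟩ := exists_isClosedMeasure_of_tendsto hB hH hl hu hlim hsol.1 hC x i
    have h1 := (hμ.2 ν hν).trans hνc
    have h2 : ∀ lam > 0, ∫ z, u lam z.1.1 z.2 ∂μ ≤ 0 := fun lam hlam => by
      have h3 := EReal.coe_le_coe_iff.1
        ((hμ.1.le_extIntegral hH (hu lam hlam).1 hlam.le).trans h1)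
      exact nonpos_of_mul_nonpos_right (by linarith) hlam
    refine le_of_forall_pos_le_add fun ε hε => ?_
    obtain ⟨lam, hlam, hd⟩ := (hpos.and (hlim.eventually (Metric.ball_mem_nhds u₀ hε))).exists
    have h3 : ∫ z, u₀ z.1.1 z.2 ∂μ ≤ ∫ z, (u lam z.1.1 z.2 + ε) ∂μ :=
      integral_mono (integrable_apply_tangent u₀)
        ((integrable_apply_tangent _).add (integrable_const _)) fun z => by
          have h4 := (dist_le_pi_dist (u lam z.1.1) (u₀ z.1.1) z.2).trans
            ((ContinuousMap.dist_apply_le_dist z.1.1).trans (Metric.mem_ball.1 hd).le)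
          have h5 := (abs_le.1 h4).1
          change u₀ z.1.1 z.2 ≤ u lam z.1.1 z.2 + ε
          linarith
    rw [integral_add (integrable_apply_tangent _) (integrable_const _), integral_const] at h3
    simp only [probReal_univ, one_smul] at h3
    linarith [h2 lam hlam]
  · obtain ⟨μ, hμ, hμc, hle⟩ := exists_isClosedMeasure_of_tendsto hB hH hl hu hlim hw.1 hC x i
    have := hw.2 μ ⟨hμ, fun ν hν => hμc.trans (hmin ν hν)⟩
    linarith

end Mather

end WeaklyCoupled

end

theorem theorem1
    {E : Type*} [NormedAddCommGroup E] [NormedSpace ℝ E] [FiniteDimensional ℝ E]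
    {M : Type*} [TopologicalSpace M] [T2Space M] [CompactSpace M] [ConnectedSpace M]
    [ChartedSpace E M] [IsManifold 𝓘(ℝ, E) ∞ M]
    [Bundle.RiemannianBundle (fun x : M => TangentSpace 𝓘(ℝ, E) x)]
    [IsContMDiffRiemannianBundle 𝓘(ℝ, E) ∞ E (fun x : M => TangentSpace 𝓘(ℝ, E) x)]
    {m : ℕ} (hm : 0 < m)
    (B : Matrix (Fin m) (Fin m) ℝ) (hB : WeaklyCoupled.IsCouplingMatrix B)
    (H : WeaklyCoupled.Hamiltonian E M m)
    (hcont : WeaklyCoupled.IsContinuousHamiltonian H)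
    (hconv : WeaklyCoupled.IsConvexHamiltonian H)
    (hcoer : WeaklyCoupled.IsCoerciveHamiltonian H) :
    ∃ c : ℝ, WeaklyCoupled.IsCriticalValue B H c ∧
      ∃ u : ℝ → C(M, Fin m → ℝ),
        (∀ lam : ℝ, 0 < lam → WeaklyCoupled.IsSolution B lam H c (u lam) ∧
          ∀ v, WeaklyCoupled.IsSolution B lam H c v → v = u lam) ∧
        ∃ u₀ : C(M, Fin m → ℝ),
          TendstoUniformly (fun lam x => u lam x) (fun x => u₀ x) (𝓝[>] (0 : ℝ)) ∧
          WeaklyCoupled.IsSolution B 0 H c u₀ ∧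
          ∀ x i, IsLUB {r : ℝ | ∃ w ∈ WeaklyCoupled.constrainedSubsolutions B H c, w x i = r}
            (u₀ x i) := by
  have hbundle : IsContinuousRiemannianBundle E (fun x : M => TangentSpace 𝓘(ℝ, E) x) :=
    WeaklyCoupled.isContinuousRiemannianBundle
  have hH := WeaklyCoupled.isCoerciveConvex hcont hconv hcoer
  obtain ⟨c, w, hw⟩ := WeaklyCoupled.exists_isSolution_critical hm hB hH
  have hcrit : WeaklyCoupled.IsCriticalValue B H c := by
    refine ⟨⟨w, hw⟩, ?_⟩
    rintro c' ⟨w', hw'⟩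
    let x₀ : M := Classical.arbitrary M
    have h1 := hw.1.comparison hB hH hw'.2 le_rfl x₀ ⟨0, hm⟩
    have h2 := hw'.1.comparison hB hH hw.2 le_rfl x₀ ⟨0, hm⟩
    rw [zero_mul] at h1 h2
    linarith
  have hex : ∀ lam : ℝ, ∃ v : C(M, Fin m → ℝ),
      0 < lam → WeaklyCoupled.IsSolution B lam H c v := fun lam => by
    by_cases hlam : 0 < lam
    · obtain ⟨v, hv⟩ := WeaklyCoupled.exists_isSolution hm hB hH hlam c
      exact ⟨v, fun _ => hv⟩
    · exact ⟨0, fun h => absurd h hlam⟩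
  choose u hu using hex
  have huniq : ∀ lam : ℝ, 0 < lam → ∀ v, WeaklyCoupled.IsSolution B lam H c v → v = u lam := by
    intro lam hlam v hv
    refine ContinuousMap.ext fun x => funext fun i => ?_
    have h1 := hv.1.comparison hB hH (hu lam hlam).2 hlam.le x i
    have h2 := (hu lam hlam).1.comparison hB hH hv.2 hlam.le x i
    rw [sub_self] at h1 h2
    have h3 := nonpos_of_mul_nonpos_right h1 hlam
    have h4 := nonpos_of_mul_nonpos_right h2 hlam
    linarith
  refine ⟨c, hcrit, u, fun lam hlam => ⟨hu lam hlam, huniq lam hlam⟩, ?_⟩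
  obtain ⟨C, hC⟩ := WeaklyCoupled.exists_solution_bound hB hH hw
  have hCu : ∀ lam > 0, ∀ x i, |u lam x i| ≤ C := fun lam hlam => hC lam hlam _ (hu lam hlam)
  -- the family is relatively compact, so that every ultrafilter has a limit
  have hcpt := WeaklyCoupled.isCompact_closure_subsolutions (M := M) hB hH (|c| + |C|)
  have hlimit : ∀ 𝒰 : Ultrafilter ℝ, (𝒰 : Filter ℝ) ≤ 𝓝[>] 0 → ∃ v, Tendsto u 𝒰 (𝓝 v) := by
    intro 𝒰 h𝒰
    have hmem : ∀ᶠ lam in (𝒰 : Filter ℝ), 0 < lam ∧ lam < 1 :=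
      h𝒰 ((eventually_nhdsWithin_of_forall fun lam h => h).and
        (nhdsWithin_le_nhds (Iio_mem_nhds one_pos)))
    obtain ⟨v, -, hv⟩ := hcpt.ultrafilter_le_nhds' (𝒰.map u) (Ultrafilter.mem_map.2 (by
      filter_upwards [hmem] with lam hlam
      refine subset_closure ⟨⟨lam, c, (hu lam hlam.1).1, ?_, fun x i => ?_⟩, fun x i => ?_⟩
      · linarith [le_abs_self c, abs_nonneg C]
      · have h1 := (abs_le.1 (hCu lam hlam.1 x i))
        have h2 : |lam * u lam x i| ≤ C := by
          rw [abs_mul, abs_of_pos hlam.1]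
          exact (mul_le_of_le_one_left (abs_nonneg _) hlam.2.le).trans (hCu lam hlam.1 x i)
        linarith [(abs_le.1 h2).1, le_abs_self C, abs_nonneg c]
      · linarith [hCu lam hlam.1 x i, le_abs_self C, abs_nonneg c]))
    exact ⟨v, hv⟩
  obtain ⟨u₀, hu₀⟩ := hlimit (Ultrafilter.of (𝓝[>] 0)) (Ultrafilter.of_le _)
  obtain ⟨hsol, hmem, hmax⟩ := WeaklyCoupled.isGreatest_of_tendsto hB hH (Ultrafilter.of_le _) hu hu₀ hCu
  refine ⟨u₀, ?_, hsol, fun x i => ⟨?_, fun b hb => hb ⟨u₀, hmem, rfl⟩⟩⟩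
  · refine ContinuousMap.tendsto_iff_tendstoUniformly.1 (tendsto_iff_ultrafilter _ _ _ |>.2 ?_)
    intro 𝒰 h𝒰
    obtain ⟨v, hv⟩ := hlimit 𝒰 h𝒰
    obtain ⟨-, hmem', hmax'⟩ := WeaklyCoupled.isGreatest_of_tendsto hB hH h𝒰 hu hv hCu
    have : v = u₀ := ContinuousMap.ext fun x => funext fun i =>
      le_antisymm (hmax v hmem' x i) (hmax' u₀ hmem x i)
    exact this ▸ hv
  · rintro _ ⟨w, hw, rfl⟩
    exact hmax w hw x i
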